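/- **Setup.** Let $p$ be a prime, $K$ a non-archimedean local field of characteristic $p$ with valuation ring $\mathcal O_K$, maximal ideal $\mathfrak m_K$ and finite residue field $k=\mathcal O_K/\mathfrak m_K$ of order $p^d$; view $k\subset\mathcal O_K$ through the unique ring homomorphism $k\to\mathcal O_K$ that splits the residue map. Fix an algebraic closure $K^{\rm alg}$ of $K$, and for an intermediate field $K'$ of $K^{\rm alg}/K$ let $\mathfrak m_{K'}\subset\mathcal O_{K'}$ be its valuation ring and maximal ideal. Let $K^{\rm perf}\subset K^{\rm alg}$ be the perfection of $K$ and $K^{\rm nr,perf}$ that of the maximal unramified extension $K^{\rm nr}$. Let $I_K={\rm Gal}(K^{\rm alg}/K^{\rm nr,perf})$, and let $J_K$ be its maximal profinite quotient that is abelian of exponent $p$. For a commutative ring $S$ of characteristic $p$ let $S[\tau]$ be the twisted polynomial ring with $\tau x=x^p\tau$. It acts on every $S$-algebra by $(\sum f_i\tau^i)(\xi)=\sum f_i\xi^{p^i}$, hence $\mathcal O_K[\tau]$ acts on $K^{\rm alg}$, on $K^{\rm alg}/\mathfrak m_{K^{\rm alg}}$ and on $K^{\rm perf}/\mathcal O_{K^{\rm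 perf}}$. For a homomorphism $\psi\colon A\to\mathcal O_K[\tau]$ and such a module $V$ write $(V,\psi)$ for $V$ with $a\in A$ acting through $\psi_a$. Let $A$ be an admissible coefficient ring with quotient field $F$: $F$ is a function field in one variable over $\mathbb F_p$ and $A$ is the ring of all elements of $F$ that are regular away from one fixed place. Let $\psi\colon A\to\mathcal O_K[\tau]$ be a Drinfeld $A$-module of positive rank and good reduction, i.e. some $\psi_a$ is non-constant and the highest coefficient of $\psi_a$ is a unit for all $a\ne0$. Let $\bar\phi\colon A\to k[\tau]\subset\mathcal O_K[\tau]$ be its reduction. The *basic Drinfeld module* is the homomorphism $\omega\colon B:=\mathbb F_p[s]\to k[\tau]$ with $\omega_s=\tau^d$; let $E$ be the quotient field of $B$. Put $$T^\circ_{\rm ad}(\psi)={\rm Hom}_A\bigl(F/A,(K^{\rm alg}/\mathfrak m_{K^{\rm alg}},\psi)\bigr)$$ with the profinite topology (pointwise convergence) and the action of ${\rm Gal}(K^{\rm alg}/K)$ on values, and likewise $T^\circ_{\rm ad}(\bar\phi)$, and $T^\circ_{\rm ad}(\omega)$ with $E/B$ in place of $F/A$. **Statement.** The reduction $\bar\phi$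 and $\omega$ are again Drinfeld modules of positive rank and good reduction, and each of the following objects exists and is unique. 1. For each $\theta\in\{\psi,\bar\phi,\omega\}$ (with coefficient ring $A,A,B$), the *local Kummer pairing* $$[\ ,\ \rangle_\theta\colon\ (K^{\rm perf}/\mathcal O_{K^{\rm perf}},\theta)\times J_K\to T^\circ_{\rm ad}(\theta),$$ given by $[\xi,\gamma\rangle_\theta(\tfrac ba)=[\theta_b(\gamma(\xi_a)-\xi_a)]$ for $\xi\in K^{\rm perf}$, $\gamma\in I_K$, all $b$ and $a\ne0$ in the coefficient ring, and every $\xi_a\in K^{\rm alg}$ with $\theta_a(\xi_a)=\xi$. It is linear over the coefficient ring in the first variable, a continuous homomorphism in the second, and ${\rm Gal}(K^{\rm alg}/K)$-equivariant. 2. The series $x=\sum_{j\le0}x_j\tau^j$ with all $x_j\in\mathcal O_K$ and $x\equiv1$ modulo $\mathfrak m_K$ such that $\psi_ax=x\bar\phi_a$ in $K^{\rm perf}(\!(\tau^{-1})\!)$ for all $a\in A$; and the isomorphism of $A$-modules $$\chi\colon(K^{\rm perf}/\mathcal O_{K^{\rm perf}},\bar\phi)\to(K^{\rm perf}/\mathcal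 O_{K^{\rm perf}},\psi),\qquad \chi([\xi])=\sum_{j\le0}[x_j\xi^{p^j}],$$ where almost all summands vanish. 3. The natural isomorphism ${\rm res}\colon T^\circ_{\rm ad}(\psi)\to T^\circ_{\rm ad}(\bar\phi)$ that sends a homomorphism to the same map $F/A\to K^{\rm alg}/\mathfrak m_{K^{\rm alg}}$. It is an $A$-linear, Galois-equivariant homeomorphism. 4. The natural isomorphism $\beta\colon T^\circ_{\rm ad}(\bar\phi)\to T^\circ_{\rm ad}(\omega)$ that comes from $R\otimes_AF/A\cong D/R\cong R\otimes_BE/B$ for $R=k[\tau]$ and its skew field of quotients $D$, i.e. $h\bigl(\beta(f)(\tfrac1b)\bigr)=g\bigl(f(\tfrac1a)\bigr)$ whenever $a\in A\setminus\{0\}$, $b\in B\setminus\{0\}$ and $g,h\in R$ satisfy $h\omega_b^{-1}\equiv g\bar\phi_a^{-1}$ modulo $R$ in $D$. It is additive, a Galois-equivariant homeomorphism, and $A$-linear for the action of $A$ on $T^\circ_{\rm ad}(\omega)$ through $\bar\phi_a\in R$ on values. For all $\xi\in K^{\rm perf}$ and $\gamma\in J_K$ one has $${\rm res}\bigl([\chi(\xi),\gamma\rangle_\psi\bigr)=[\xi,\gamma\rangle_{\bar\phi},\qquad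 \beta\bigl([\xi,\gamma\rangle_{\bar\phi}\bigr)=[\xi,\gamma\rangle_\omega,\qquad \beta\bigl({\rm res}([\chi(\xi),\gamma\rangle_\psi)\bigr)=[\xi,\gamma\rangle_\omega.$$ Thus, under $\chi$ and the isomorphism $\beta\circ{\rm res}$, the local Kummer pairing of $\psi$ corresponds exactly to that of $\omega$. -/

import Mathlib

open ValuativeRel Filter

noncomputable section

namespace LocalKummer

/-! ## Twisted polynomials `S[τ]` with `τ x = x ^ p τ` -/

section Twisted

variable (p : ℕ) (S : Type*) [CommRing S] [ExpChar S p]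

/-- The action of the powers of `τ` on `S` by the powers of the `p`-Frobenius. -/
@[reducible] def frobAction : MulSemiringAction (Multiplicative ℕ) S :=
  MulSemiringAction.compHom S (powersHom (S →+* S) (frobenius S p))

/-- The ring `S[τ]` of finite sums `∑ xᵢ τ^i` with `xᵢ ∈ S` and `τ x = x ^ p τ`. -/
@[nolint unusedArguments]
def Twisted (_p : ℕ) (S : Type*) [CommRing S] : Type _ := SkewPolynomial S

instance : Ring (Twisted p S) :=
  letI := frobAction p S
  inferInstanceAs (Ring (SkewMonoidAlgebra S (Multiplicative ℕ)))

namespace Twisted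

variable {p S}

/-- The coefficient of `τ ^ i`. -/
def coeff (f : Twisted p S) (i : ℕ) : S := SkewPolynomial.coeff (R := S) f i

/-- The monomial `c τ ^ n`. -/
def monomial (p : ℕ) {S : Type*} [CommRing S] [ExpChar S p] (n : ℕ) : S →+ Twisted p S :=
  letI := frobAction p S
  (SkewPolynomial.monomial (R := S) n).toAddMonoidHom

variable (p S) in
/-- The embedding of the constants. -/
def C : S →+* Twisted p S :=
  letI := frobAction p S
  SkewMonoidAlgebra.singleOneRingHom (k := S) (G := Multiplicative ℕ)

variable (p S) in
/-- The element `τ`. -/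
def τ : Twisted p S := monomial p 1 1

lemma frobAction_smul (y : Multiplicative ℕ) (x : S) :
    (frobAction p S).smul y x = x ^ p ^ (Multiplicative.toAdd y) := by
  change (powersHom (S →+* S) (frobenius S p) y) x = _
  rw [powersHom_apply]
  generalize Multiplicative.toAdd y = n
  induction n generalizing x with
  | zero => simp
  | succ n ih =>
    rw [pow_succ]
    change (frobenius S p ^ n) (frobenius S p x) = _
    rw [ih, frobenius_def, ← pow_mul, pow_succ']

lemma monomial_mul_monomial (n m : ℕ) (a b : S) :
    monomial p n a * monomial p m b = monomial p (n + m) (a * b ^ p ^ n) := by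
  let _ := frobAction p S
  refine (SkewMonoidAlgebra.single_mul_single (k := S) (a₁ := Multiplicative.ofAdd n)
    (a₂ := Multiplicative.ofAdd m) (b₁ := a) (b₂ := b)).trans ?_
  exact congrArg (fun z => monomial p (n + m) (a * z)) (frobAction_smul (Multiplicative.ofAdd n) b)

lemma C_apply (c : S) : C p S c = monomial p 0 c := rfl

/-- The fundamental commutation rule. -/
lemma τ_mul_C (x : S) : τ p S * C p S x = C p S (x ^ p) * τ p S := by
  rw [C_apply, C_apply, τ, monomial_mul_monomial, monomial_mul_monomial]
  simp

lemma coeff_monomial (n i : ℕ) (c : S) :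
    (monomial p n c).coeff i = if n = i then c else 0 :=
  SkewPolynomial.coeff_monomial

lemma addHom_ext {N : Type*} [AddZeroClass N] {u v : Twisted p S →+ N}
    (h : ∀ n c, u (monomial p n c) = v (monomial p n c)) : u = v :=
  SkewMonoidAlgebra.addHom_ext (k := S) (G := Multiplicative ℕ)
    fun y x => h (Multiplicative.toAdd y) x

lemma coeff_add (f g : Twisted p S) (i : ℕ) : (f + g).coeff i = f.coeff i + g.coeff i :=
  congrFun (congrArg DFunLike.coe (SkewMonoidAlgebra.coeff_add
    (G := Multiplicative ℕ) (k := S) f g)) (Multiplicative.ofAdd i)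

/-- The coefficient as an additive map. -/
def coeffHom (i : ℕ) : Twisted p S →+ S where
  toFun f := f.coeff i
  map_zero' := rfl
  map_add' f g := coeff_add f g i

/-- The powers of `τ`. -/
def τHom (p : ℕ) (S : Type*) [CommRing S] [ExpChar S p] : Multiplicative ℕ →* Twisted p S where
  toFun y := monomial p (Multiplicative.toAdd y) 1
  map_one' := rfl
  map_mul' x y := by rw [monomial_mul_monomial]; simp

/-- A ring homomorphism induces a homomorphism of twisted polynomial rings, coefficientwise. -/
def map {T : Type*} [CommRing T] [ExpChar T p] (h : S →+* T) : Twisted p S →+* Twisted p T :=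
  letI := frobAction p S
  SkewMonoidAlgebra.liftNCRingHom (k := S) (G := Multiplicative ℕ) ((C p T).comp h) (τHom p T) (by
    intro x y
    change C p T (h ((frobAction p S).smul y x)) * monomial p (Multiplicative.toAdd y) 1 =
      monomial p (Multiplicative.toAdd y) 1 * C p T (h x)
    rw [frobAction_smul, C_apply, C_apply, monomial_mul_monomial, monomial_mul_monomial]
    simp)

lemma map_monomial {T : Type*} [CommRing T] [ExpChar T p] (h : S →+* T) (n : ℕ) (c : S) :
    map h (monomial p n c) = monomial p n (h c) := by
  let _ := frobAction p S
  refine (SkewMonoidAlgebra.liftNC_single (k := S) (G := Multiplicative ℕ)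
    (R := Twisted p T) _ _ _ _).trans ?_
  change C p T (h c) * monomial p n 1 = _
  rw [C_apply, monomial_mul_monomial]
  simp

lemma coeff_map {T : Type*} [CommRing T] [ExpChar T p] (h : S →+* T) (f : Twisted p S) (i : ℕ) :
    (map h f).coeff i = h (f.coeff i) := by
  have : (coeffHom i).comp (map (p := p) h).toAddMonoidHom =
      h.toAddMonoidHom.comp (coeffHom (p := p) i) := by
    refine addHom_ext fun n c => ?_
    change (map h (monomial p n c)).coeff i = h ((monomial p n c).coeff i)
    rw [map_monomial, coeff_monomial, coeff_monomial]
    split_ifs <;> simp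
  exact DFunLike.congr_fun this f

end Twisted

lemma end_mul_apply {V : Type*} [AddCommGroup V] (f g : AddMonoid.End V) (v : V) :
    (f * g) v = f (g v) := rfl

/-! ## The left action of `S[τ]` on modules with a Frobenius -/

/-- An `S`-module with an additive endomorphism `frob` satisfying `frob (c v) = c ^ p frob v`,
through which `τ` acts. -/
class FrobModule (V : Type*) [AddCommGroup V] [Module S V] where
  frob : AddMonoid.End V
  frob_smul : ∀ (c : S) (v : V), frob (c • v) = c ^ p • frob v

/-- On an `S`-algebra of characteristic `p` the element `τ` acts by `x ↦ x ^ p`. -/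
instance (T : Type*) [CommRing T] [Algebra S T] [ExpChar T p] : FrobModule p S T where
  frob := (frobenius T p).toAddMonoidHom
  frob_smul c v := by
    change frobenius T p (c • v) = c ^ p • frobenius T p v
    simp [frobenius_def, smul_pow]

variable (V : Type*) [AddCommGroup V] [Module S V] [FrobModule p S V]

/-- The left `S[τ]`-module structure on `V`: `f(v) = ∑ fᵢ frob^i(v)`. -/
def act : Twisted p S →+* AddMonoid.End V :=
  letI := frobAction p S
  SkewMonoidAlgebra.liftNCRingHom (k := S) (G := Multiplicative ℕ) (Module.toAddMonoidEnd S V)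
    (powersHom (AddMonoid.End V) (FrobModule.frob p S)) (by
    intro x y
    change Module.toAddMonoidEnd S V ((frobAction p S).smul y x) * _ = _
    rw [Twisted.frobAction_smul, powersHom_apply]
    generalize Multiplicative.toAdd y = n
    ext v
    simp only [end_mul_apply]
    induction n generalizing x v with
    | zero => simp
    | succ n ih =>
      have e : (FrobModule.frob p S : AddMonoid.End V) ^ (n + 1) =
        FrobModule.frob p S ^ n * FrobModule.frob p S := pow_succ _ _
      rw [e, end_mul_apply, end_mul_apply, pow_succ', pow_mul, ih]
      exact congrArg _ (FrobModule.frob_smul (p := p) x v).symm)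

lemma act_monomial (n : ℕ) (c : S) (v : V) :
    act p S V (Twisted.monomial p n c) v = c • (FrobModule.frob p S : AddMonoid.End V)^[n] v := by
  let _ := frobAction p S
  have h : act p S V (Twisted.monomial p n c) =
      Module.toAddMonoidEnd S V c * (FrobModule.frob p S : AddMonoid.End V) ^ n :=
    SkewMonoidAlgebra.liftNC_single (k := S) (G := Multiplicative ℕ)
      (R := AddMonoid.End V) _ _ _ _
  rw [h, end_mul_apply]
  change c • (FrobModule.frob p S ^ n : AddMonoid.End V) v = _
  rw [AddMonoid.End.coe_pow]

variable {p S V}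

/-- The action is given by the expected formula. -/
lemma act_apply (f : Twisted p S) (v : V) :
    act p S V f v = ∑ᶠ i : ℕ, f.coeff i • (FrobModule.frob p S : AddMonoid.End V)^[i] v := by
  have hfin : ∀ g : Twisted p S, (Function.support fun i : ℕ =>
      g.coeff i • (FrobModule.frob p S : AddMonoid.End V)^[i] v).Finite := fun g => by
    refine (SkewPolynomial.support (R := S) g).finite_toSet.subset fun i hi => ?_
    simp only [Function.mem_support] at hi
    refine (SkewPolynomial.mem_support_iff (R := S)).mpr fun h0 => ?_
    apply hi
    rw [show g.coeff i = 0 from h0, zero_smul]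
  let w : Twisted p S →+ V :=
    { toFun := fun g => ∑ᶠ i : ℕ, g.coeff i • (FrobModule.frob p S : AddMonoid.End V)^[i] v
      map_zero' := by
        refine (finsum_congr fun i => ?_).trans finsum_zero
        exact zero_smul S _
      map_add' := fun g h => by
        rw [← finsum_add_distrib (hfin g) (hfin h)]
        exact finsum_congr fun i => by rw [Twisted.coeff_add, add_smul] }
  have : (AddMonoidHom.eval v).comp (act p S V).toAddMonoidHom = w := by
    refine Twisted.addHom_ext fun n c => ?_
    change act p S V (Twisted.monomial p n c) v =
      ∑ᶠ i : ℕ, (Twisted.monomial p n c).coeff i • (FrobModule.frob p S : AddMonoid.End V)^[i] v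
    rw [act_monomial, finsum_eq_single _ n]
    · rw [Twisted.coeff_monomial, if_pos rfl]
    · intro i hi
      rw [Twisted.coeff_monomial, if_neg hi.symm, zero_smul]
  exact DFunLike.congr_fun this f

/-- An `S`-linear map that commutes with the Frobenius commutes with the action of `S[τ]`. -/
lemma act_comm (u : V →ₗ[S] V)
    (hu : ∀ v, u (FrobModule.frob p S v) = FrobModule.frob p S (u v))
    (f : Twisted p S) (v : V) : u (act p S V f v) = act p S V f (u v) := by
  have : (AddMonoidHom.compHom u.toAddMonoidHom).comp (act p S V).toAddMonoidHom =
      (AddMonoidHom.compHom.flip u.toAddMonoidHom).comp (act p S V).toAddMonoidHom := by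
    refine Twisted.addHom_ext fun n c => ?_
    ext v
    change u (act p S V (Twisted.monomial p n c) v) = act p S V (Twisted.monomial p n c) (u v)
    rw [act_monomial, act_monomial, map_smul]
    congr 1
    exact Function.Semiconj.iterate_right (f := u) (ga := FrobModule.frob p S)
      (gb := FrobModule.frob p S) hu n v
  exact DFunLike.congr_fun (DFunLike.congr_fun this f) v

/-! ## `A`-modules attached to a homomorphism `A → S[τ]` -/

variable {A : Type*} [CommRing A]

/-- The `A`-module `(V, φ)`: the additive group `V` on which `a ∈ A` acts through `φ_a`. -/
@[nolint unusedArguments]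
def DMod (_φ : A →+* Twisted p S) (V : Type*) [AddCommGroup V] [Module S V] [FrobModule p S V] :
    Type _ := V

instance (φ : A →+* Twisted p S) : AddCommGroup (DMod φ V) := inferInstanceAs (AddCommGroup V)

instance (φ : A →+* Twisted p S) : Module A (DMod φ V) :=
  Module.compHom V ((act p S V).comp φ)

/-- The element of `(V, φ)` given by an element of `V`. -/
def DMod.of (φ : A →+* Twisted p S) : V ≃+ DMod φ V := AddEquiv.refl V

lemma DMod.smul_of (φ : A →+* Twisted p S) (a : A) (v : V) :
    a • DMod.of φ v = DMod.of φ (act p S V (φ a) v) := rfl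

/-- The `A`-linear endomorphism of `(V, φ)` given by an `S`-linear map commuting with Frobenius. -/
def DMod.map (φ : A →+* Twisted p S) (u : V →ₗ[S] V)
    (hu : ∀ v, u (FrobModule.frob p S v) = FrobModule.frob p S (u v)) :
    DMod φ V →ₗ[A] DMod φ V where
  toFun v := DMod.of φ (u ((DMod.of φ).symm v))
  map_add' v w := by simp
  map_smul' a v := congrArg (DMod.of φ) (act_comm u hu (φ a) ((DMod.of φ).symm v))

end Twisted

/-- The `A`-module `F / A`, where `F` is the field of fractions of `A`. -/
abbrev FracMod (A : Type*) [CommRing A] [IsDomain A] : Type _ :=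
  FractionRing A ⧸ LinearMap.range (Algebra.linearMap A (FractionRing A))

/-- The class of `b / a` in `F / A`. -/
def frac {A : Type*} [CommRing A] [IsDomain A] (b a : A) : FracMod A :=
  Submodule.Quotient.mk (algebraMap A (FractionRing A) b / algebraMap A (FractionRing A) a)

/-- `A` is an admissible coefficient ring: its field of fractions `F` is a function field in one
variable over `𝔽_p`, and `A` is the ring of elements of `F` that are regular at all places of `F`
except one (the places of `F` are its non-trivial valuation rings). -/
def IsCoefficientRing (p : ℕ) [Fact p.Prime] (A : Type*) [CommRing A] [IsDomain A]
    [Algebra (ZMod p) A] : Prop :=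
  (∃ t : FractionRing A, Transcendental (ZMod p) t ∧
    FiniteDimensional (IntermediateField.adjoin (ZMod p) {t}) (FractionRing A)) ∧
  ∃ P : ValuationSubring (FractionRing A), P ≠ ⊤ ∧
    ∀ x : FractionRing A, x ∈ Set.range (algebraMap A (FractionRing A)) ↔
      ∀ Q : ValuationSubring (FractionRing A), Q ≠ P → x ∈ Q

/-! ## Local fields of characteristic `p` -/

section LocalField

variable (p : ℕ) [Fact p.Prime] (K : Type*) [Field K] [ValuativeRel K] [TopologicalSpace K]
  [IsNonarchimedeanLocalField K] [CharP K p]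

instance : CharP 𝒪[K] p :=
  RingHom.charP 𝒪[K].subtype Subtype.val_injective p

instance : CharP 𝓀[K] p := by
  have h : ((p : ℕ) : 𝓀[K]) = 0 := by
    rw [← map_natCast (IsLocalRing.residue 𝒪[K]), CharP.cast_eq_zero, map_zero]
  exact (CharP.charP_iff_prime_eq_zero Fact.out).mpr h

lemma natCard_eq_zero (p : ℕ) [Fact p.Prime] {K : Type*} [Field K] [ValuativeRel K]
    [TopologicalSpace K] [IsNonarchimedeanLocalField K] [CharP K p] : (Nat.card 𝓀[K] : 𝒪[K]) = 0 := by
  let _ := Fintype.ofFinite 𝓀[K]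
  rw [CharP.cast_eq_zero_iff 𝒪[K] p, ← CharP.cast_eq_zero_iff 𝓀[K] p, Nat.card_eq_fintype_card]
  exact Nat.cast_card_eq_zero _

lemma exists_lift {K : Type*} [Field K] [ValuativeRel K]
    [TopologicalSpace K] [IsNonarchimedeanLocalField K]
    (h0 : (Nat.card 𝓀[K] : 𝒪[K]) = 0) (x : 𝓀[K]) :
    ∃ y : 𝒪[K], y ^ Nat.card 𝓀[K] = y ∧ IsLocalRing.residue 𝒪[K] y = x := by
  let _ := IsTopologicalAddGroup.rightUniformSpace K
  have _ := isUniformAddGroup_of_addCommGroup (G := K)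
  let _ := Fintype.ofFinite 𝓀[K]
  obtain ⟨y₀, rfl⟩ := IsLocalRing.residue_surjective x
  have hq : 1 < Nat.card 𝓀[K] := Finite.one_lt_card
  obtain ⟨y, hy, hy'⟩ := HenselianRing.is_henselian (R := 𝒪[K]) (I := 𝓂[K])
    (Polynomial.X ^ Nat.card 𝓀[K] - Polynomial.X)
    (Polynomial.monic_X_pow_sub (by rw [Polynomial.degree_X]; exact_mod_cast hq)) y₀
    (by
      rw [← IsLocalRing.residue_eq_zero_iff]
      simp [Nat.card_eq_fintype_card, FiniteField.pow_card])
    (by rw [Polynomial.derivative_sub, Polynomial.derivative_X_pow, h0]; simp)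
  refine ⟨y, by simpa [sub_eq_zero] using hy, ?_⟩
  rw [← sub_eq_zero, ← map_sub, IsLocalRing.residue_eq_zero_iff]
  exact hy'

lemma natCard_eq_pow (p : ℕ) [Fact p.Prime] {K : Type*} [Field K] [ValuativeRel K]
    [TopologicalSpace K] [IsNonarchimedeanLocalField K] [CharP K p] : ∃ n, Nat.card 𝓀[K] = p ^ n := by
  let _ := Fintype.ofFinite 𝓀[K]
  obtain ⟨n, -, hn⟩ := FiniteField.card 𝓀[K] p
  exact ⟨n, by rw [Nat.card_eq_fintype_card, hn]⟩

lemma add_pow_natCard (p : ℕ) [Fact p.Prime] {K : Type*} [Field K] [ValuativeRel K]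
    [TopologicalSpace K] [IsNonarchimedeanLocalField K] [CharP K p] (y z : 𝒪[K]) :
    (y + z) ^ Nat.card 𝓀[K] = y ^ Nat.card 𝓀[K] + z ^ Nat.card 𝓀[K] := by
  obtain ⟨n, hn⟩ := natCard_eq_pow p (K := K)
  rw [hn, add_pow_char_pow]

lemma lift_unique (p : ℕ) [Fact p.Prime] {K : Type*} [Field K] [ValuativeRel K]
    [TopologicalSpace K] [IsNonarchimedeanLocalField K] [CharP K p]
    {y z : 𝒪[K]} (hy : y ^ Nat.card 𝓀[K] = y) (hz : z ^ Nat.card 𝓀[K] = z)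
    (h : IsLocalRing.residue 𝒪[K] y = IsLocalRing.residue 𝒪[K] z) : y = z := by
  have hq : 1 < Nat.card 𝓀[K] := Finite.one_lt_card
  have hd : (y - z) ^ Nat.card 𝓀[K] = y - z := by
    obtain ⟨n, hn⟩ := natCard_eq_pow p (K := K)
    rw [hn] at hy hz ⊢
    rw [sub_pow_char_pow, hy, hz]
  have hm : y - z ∈ 𝓂[K] := by
    rw [← IsLocalRing.residue_eq_zero_iff, map_sub, h, sub_self]
  have hu : IsUnit ((y - z) ^ (Nat.card 𝓀[K] - 1) - 1) := by
    by_contra hn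
    have h1 : (y - z) ^ (Nat.card 𝓀[K] - 1) - 1 ∈ 𝓂[K] := hn
    have h2 : (y - z) ^ (Nat.card 𝓀[K] - 1) ∈ 𝓂[K] := Ideal.pow_mem_of_mem _ hm _ (by omega)
    exact (Ideal.ne_top_iff_one _).mp (IsLocalRing.maximalIdeal.isMaximal 𝒪[K]).ne_top
      (by simpa using sub_mem h2 h1)
  have h0 : (y - z) * ((y - z) ^ (Nat.card 𝓀[K] - 1) - 1) = 0 := by
    rw [mul_sub, ← pow_succ', mul_one, Nat.sub_add_cancel hq.le, hd, sub_self]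
  exact sub_eq_zero.mp ((hu.mul_left_eq_zero).mp h0)

/-- The unique ring homomorphism `k → 𝒪_K` whose composite with the residue map is the identity. -/
def teich : 𝓀[K] →+* 𝒪[K] where
  toFun x := (exists_lift (natCard_eq_zero p) x).choose
  map_zero' := lift_unique p (exists_lift (natCard_eq_zero p) _).choose_spec.1
    (zero_pow Nat.card_pos.ne')
    ((exists_lift (natCard_eq_zero p) _).choose_spec.2.trans (map_zero _).symm)
  map_one' := lift_unique p (exists_lift (natCard_eq_zero p) _).choose_spec.1
    (one_pow _)
    ((exists_lift (natCard_eq_zero p) _).choose_spec.2.trans (map_one _).symm)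
  map_add' x y := by
    refine lift_unique p (exists_lift (natCard_eq_zero p) _).choose_spec.1 ?_ ?_
    · rw [add_pow_natCard p, (exists_lift (natCard_eq_zero p) _).choose_spec.1,
        (exists_lift (natCard_eq_zero p) _).choose_spec.1]
    · rw [map_add, (exists_lift (natCard_eq_zero p) _).choose_spec.2,
        (exists_lift (natCard_eq_zero p) _).choose_spec.2,
        (exists_lift (natCard_eq_zero p) _).choose_spec.2]
  map_mul' x y := by
    refine lift_unique p (exists_lift (natCard_eq_zero p) _).choose_spec.1 ?_ ?_
    · rw [mul_pow, (exists_lift (natCard_eq_zero p) _).choose_spec.1,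
        (exists_lift (natCard_eq_zero p) _).choose_spec.1]
    · rw [map_mul, (exists_lift (natCard_eq_zero p) _).choose_spec.2,
        (exists_lift (natCard_eq_zero p) _).choose_spec.2,
        (exists_lift (natCard_eq_zero p) _).choose_spec.2]

lemma residue_teich (x : 𝓀[K]) : IsLocalRing.residue 𝒪[K] (teich p K x) = x :=
  (exists_lift (natCard_eq_zero p) x).choose_spec.2

/-- The valuation ring `𝒪_E` of an algebraic extension `E` of `K` (the integral closure of `𝒪_K`),
as a submodule of `E`. -/
def intSub (K : Type*) [Field K] [ValuativeRel K] (E : Type*) [Field E] [Algebra K E] :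
    Submodule 𝒪[K] E :=
  Subalgebra.toSubmodule (integralClosure 𝒪[K] E)

/-- The maximal ideal of the valuation ring `𝒪_E` (the Jacobson radical of this local ring). -/
def intMax (K : Type*) [Field K] [ValuativeRel K] (E : Type*) [Field E] [Algebra K E] :
    Ideal (integralClosure 𝒪[K] E) :=
  Ideal.jacobson ⊥

/-- The maximal ideal `𝔪_E` of `𝒪_E`, as a submodule of `E`. -/
def maxSub (K : Type*) [Field K] [ValuativeRel K] (E : Type*) [Field E] [Algebra K E] :
    Submodule 𝒪[K] E :=
  ((intMax K E).restrictScalars 𝒪[K]).map (integralClosure 𝒪[K] E).val.toLinearMap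

/-- The group `E / 𝒪_E` of principal parts. -/
abbrev PrincipalParts (K : Type*) [Field K] [ValuativeRel K] (E : Type*) [Field E] [Algebra K E] :
    Type _ := E ⧸ intSub K E

/-- The group `E / 𝔪_E`. -/
abbrev ModMax (K : Type*) [Field K] [ValuativeRel K] (E : Type*) [Field E] [Algebra K E] :
    Type _ := E ⧸ maxSub K E

/-- The Frobenius on the quotient by a submodule that is stable under Frobenius. -/
@[reducible] def FrobModule.quotient {p : ℕ} {S V : Type*} [CommRing S] [ExpChar S p]
    [AddCommGroup V] [Module S V] [FrobModule p S V] (N : Submodule S V)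
    (h : ∀ v ∈ N, FrobModule.frob p S v ∈ N) : FrobModule p S (V ⧸ N) where
  frob := QuotientAddGroup.map N.toAddSubgroup N.toAddSubgroup (FrobModule.frob p S : V →+ V) h
  frob_smul c v := by
    obtain ⟨v, rfl⟩ := Submodule.Quotient.mk_surjective N v
    exact congrArg (Submodule.Quotient.mk (p := N)) (FrobModule.frob_smul (p := p) c v)

instance (E : Type*) [Field E] [Algebra K E] [CharP E p] :
    FrobModule p 𝒪[K] (PrincipalParts K E) :=
  FrobModule.quotient (intSub K E) fun v hv => by
    change v ^ p ∈ integralClosure 𝒪[K] E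
    exact pow_mem (show v ∈ integralClosure 𝒪[K] E from hv) p

instance (E : Type*) [Field E] [Algebra K E] [CharP E p] :
    FrobModule p 𝒪[K] (ModMax K E) :=
  FrobModule.quotient (maxSub K E) fun v hv => by
    obtain ⟨y, hy, rfl⟩ := hv
    exact ⟨y ^ p, Ideal.pow_mem_of_mem _ hy p (Fact.out : p.Prime).pos, map_pow (integralClosure 𝒪[K] E).val y p⟩

/-- The `𝒪_K`-linear map on `E / 𝔪_E` induced by an automorphism of `E` over `K`. -/
def galRes {K : Type*} [Field K] [ValuativeRel K] {E : Type*} [Field E] [Algebra K E]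
    (σ : Gal(E/K)) : ModMax K E →ₗ[𝒪[K]] ModMax K E :=
  Submodule.mapQ _ _ ((σ : E →ₐ[K] E).toLinearMap.restrictScalars 𝒪[K]) (by
    rintro _ ⟨y, hy, rfl⟩
    let e := (σ.restrictScalars 𝒪[K]).mapIntegralClosure
    refine ⟨e y, ?_, rfl⟩
    change e y ∈ Ideal.jacobson ⊥
    replace hy : y ∈ Ideal.jacobson ⊥ := hy
    rw [Ideal.mem_jacobson_bot] at hy ⊢
    intro z
    have := (hy (e.symm z)).map e
    simpa using this)

end LocalField

section Galois

variable (K : Type*) [Field K] [ValuativeRel K] (L : Type*) [Field L] [Algebra K L]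

/-- The maximal unramified extension `K^nr` of a local field `K` in an algebraic extension `L`: the
compositum of all finite unramified extensions `E / K`, that is, of those for which `𝔪_K` generates
the maximal ideal of `𝒪_E` (their residue extensions are separable, because `k` is finite). -/
def maxUnramified : IntermediateField K L :=
  ⨆ (E : IntermediateField K L) (_ : FiniteDimensional K E ∧
    Ideal.map (algebraMap 𝒪[K] (integralClosure 𝒪[K] E)) 𝓂[K] = intMax K E), E

/-- The inertia group `I_K = Gal(L / K^{nr,perf})`, where `K^{nr,perf}` is the maximal totally
inseparable extension of `K^nr` in `L`. -/
def inertia : Subgroup Gal(L/K) :=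
  ((perfectClosure (maxUnramified K L) L).restrictScalars K).fixingSubgroup

/-- The smallest closed normal subgroup of `I_K` containing all commutators and `p`-th powers. -/
def inertiaRel (p : ℕ) : Subgroup (inertia K L) :=
  (commutator (inertia K L) ⊔
    Subgroup.normalClosure (Set.range fun γ : inertia K L => γ ^ p)).topologicalClosure

instance (p : ℕ) : (inertiaRel K L p).Normal :=
  Subgroup.is_normal_topologicalClosure _

/-- The maximal (profinite) quotient `J_K` of `I_K` that is abelian of exponent `p`. -/
abbrev InertiaQuot (p : ℕ) : Type _ := inertia K L ⧸ inertiaRel K L p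

end Galois

/-! ## Drinfeld modules of good reduction -/

section Drinfeld

variable {p : ℕ} [Fact p.Prime] {K : Type*} [Field K] [ValuativeRel K] [TopologicalSpace K]
  [IsNonarchimedeanLocalField K] [CharP K p] {A : Type*} [CommRing A]

/-- `ψ : A → 𝒪_K[τ]` is a Drinfeld `A`-module of positive rank and good reduction over `𝒪_K`: not
all `ψ_a` are constant, and for every `a ≠ 0` the highest coefficient of `ψ_a` is a unit. -/
structure IsGoodDrinfeld (ψ : A →+* Twisted p 𝒪[K]) : Prop where
  nonconstant : ∃ (a : A) (i : ℕ), 0 < i ∧ (ψ a).coeff i ≠ 0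
  leading : ∀ a : A, a ≠ 0 → ∃ n : ℕ, IsUnit ((ψ a).coeff n) ∧ ∀ m > n, (ψ a).coeff m = 0

/-- Coefficientwise reduction `𝒪_K[τ] → k[τ]`. -/
def reduce : Twisted p 𝒪[K] →+* Twisted p 𝓀[K] := Twisted.map (IsLocalRing.residue 𝒪[K])

/-- The embedding `k[τ] → 𝒪_K[τ]` induced by the embedding `k → 𝒪_K`. -/
def lift : Twisted p 𝓀[K] →+* Twisted p 𝒪[K] := Twisted.map (teich p K)

/-- The reduction of `ψ`, a homomorphism `A → k[τ]`. -/
def reduction (ψ : A →+* Twisted p 𝒪[K]) : A →+* Twisted p 𝓀[K] := reduce.comp ψ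

/-- A homomorphism `A → k[τ]` viewed again as a homomorphism `A → 𝒪_K[τ]`. -/
def overO (φ : A →+* Twisted p 𝓀[K]) : A →+* Twisted p 𝒪[K] := lift.comp φ

variable (p K) in
/-- The basic Drinfeld module `ω : 𝔽_p[s] → k[τ]`, `s ↦ τ ^ d`. -/
def basic (d : ℕ) : Polynomial (ZMod p) →+* Twisted p 𝓀[K] :=
  Polynomial.eval₂RingHom' ((Twisted.C p 𝓀[K]).comp (ZMod.castHom dvd_rfl 𝓀[K]))
    (Twisted.τ p 𝓀[K] ^ d) (by
      intro c
      refine Commute.pow_right ?_ d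
      change Twisted.C p 𝓀[K] _ * _ = _ * Twisted.C p 𝓀[K] _
      rw [Twisted.τ_mul_C, ← map_pow, ZMod.pow_card])

variable [IsDomain A] (L : Type*) [Field L] [Algebra K L] [CharP L p]

/-- The modified adelic Tate module `T°_ad(φ) = Hom_A(F / A, (L / 𝔪_L, φ))`, where `L` is an
algebraic closure of `K`. -/
abbrev Tate (φ : A →+* Twisted p 𝒪[K]) : Type _ := FracMod A →ₗ[A] DMod φ (ModMax K L)

/-- The topology of pointwise convergence, with `L / 𝔪_L` discrete; it is the profinite topology
of the inverse limit of the groups `Hom_A(a⁻¹A / A, (L / 𝔪_L, φ))`. -/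
instance (φ : A →+* Twisted p 𝒪[K]) : TopologicalSpace (Tate L φ) :=
  TopologicalSpace.induced (fun (f : Tate L φ) (z : FracMod A) => f z)
    (@Pi.topologicalSpace (FracMod A) (fun _ => DMod φ (ModMax K L)) fun _ => ⊥)

variable {L} in
/-- The action of `Gal(L/K)` on `T°_ad(φ)` through its action on `L`. -/
def galTate {φ : A →+* Twisted p 𝒪[K]} (σ : Gal(L/K)) : Tate L φ →ₗ[A] Tate L φ where
  toFun f := (DMod.map φ (galRes σ) (by
    intro v
    obtain ⟨v, rfl⟩ := Submodule.Quotient.mk_surjective _ v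
    exact congrArg (Submodule.Quotient.mk (p := maxSub K L)) (map_pow σ v p))).comp f
  map_add' f g := LinearMap.comp_add _ _ _
  map_smul' a f := LinearMap.comp_smul _ _ _

variable {L} in
/-- The class in `(L / 𝔪_L, φ)` of an element of `L`. -/
def modMax (φ : A →+* Twisted p 𝒪[K]) (ξ : L) : DMod φ (ModMax K L) :=
  DMod.of φ (Submodule.Quotient.mk ξ)

/-- The domain `(K^perf / 𝒪_{K^perf}, φ)` of the local Kummer pairing. -/
abbrev KummerDomain (φ : A →+* Twisted p 𝒪[K]) : Type _ :=
  DMod φ (PrincipalParts K (perfectClosure K L))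

variable {L} in
/-- The class in `(K^perf / 𝒪_{K^perf}, φ)` of an element of `K^perf`. -/
def principal (φ : A →+* Twisted p 𝒪[K]) (ξ : perfectClosure K L) : KummerDomain L φ :=
  DMod.of φ (Submodule.Quotient.mk ξ)

/-- `κ` is the local Kummer pairing
`(K^perf / 𝒪_{K^perf}, φ) × J_K → T°_ad(φ)` of `φ`; it is determined by `formula`. -/
structure IsKummerPairing (φ : A →+* Twisted p 𝒪[K])
    (κ : KummerDomain L φ →ₗ[A] Additive (InertiaQuot K L p) →+ Tate L φ) : Prop where
  formula : ∀ (ξ : perfectClosure K L) (γ : inertia K L) (a b : A) (ξa : L), a ≠ 0 →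
    act p 𝒪[K] L (φ a) ξa = (ξ : L) →
    κ (principal φ ξ) (Additive.ofMul (γ : InertiaQuot K L p)) (frac b a) =
      modMax φ (act p 𝒪[K] L (φ b) ((γ : Gal(L/K)) ξa - ξa))
  continuous : ∀ z : KummerDomain L φ, Continuous (κ z)
  equivariant : ∀ (z : KummerDomain L φ) (σ : Gal(L/K)) (γ γ' : inertia K L),
    (γ' : Gal(L/K)) = σ * γ * σ⁻¹ →
    κ z (Additive.ofMul (γ' : InertiaQuot K L p)) =
      galTate σ (κ z (Additive.ofMul (γ : InertiaQuot K L p)))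

/-- The map `res : T°_ad(ψ) → T°_ad(φ)`, for `φ` the reduction of `ψ`, is the natural isomorphism:
every homomorphism `F / A → L / 𝔪_L` in question has image in `𝒪_L / 𝔪_L`, where the actions of `A`
through `ψ` and `φ` agree, and it is sent to itself. -/
structure IsReductionIso (ψ φ : A →+* Twisted p 𝒪[K]) (res : Tate L ψ ≃ₗ[A] Tate L φ) :
    Prop where
  formula : ∀ (f : Tate L ψ) (z : FracMod A), (DMod.of φ).symm (res f z) = (DMod.of ψ).symm (f z)
  continuous : Continuous res
  continuous_symm : Continuous res.symm
  equivariant : ∀ (σ : Gal(L/K)) (f : Tate L ψ), res (galTate σ f) = galTate σ (res f)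

variable {B : Type*} [CommRing B] [IsDomain B]

/-- The map `β : T°_ad(φ) → T°_ad(ω)`, for `φ : A → R` and `ω : B → R` with `R = k[τ]`, is the
natural isomorphism. With `D = Quot(R)`, both sides are identified with the group of `R`-linear maps
`λ : D / R → L / 𝔪_L` by means of the isomorphisms
`R ⊗_A F/A ≅ D/R`, `g ⊗ [1/a] ↦ [g φ_a⁻¹]` and `R ⊗_B E/B ≅ D/R`, `h ⊗ [1/b] ↦ [h ω_b⁻¹]`; so `f`
and `β f` correspond if and only if `h ((β f)[1/b]) = g (f[1/a])` whenever
`h ω_b⁻¹ = g φ_a⁻¹ + r` in `D` with `r ∈ R`. As `ω_b` is central in `R`, the last equation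
means that `h φ_a = ω_b (g + r φ_a)`. -/
structure IsBasicIso (φ : A →+* Twisted p 𝓀[K]) (ω : B →+* Twisted p 𝓀[K])
    (β : Tate L (overO φ) ≃+ Tate L (overO ω)) : Prop where
  formula : ∀ (f : Tate L (overO φ)) (a : A) (b : B) (g h r : Twisted p 𝓀[K]),
    a ≠ 0 → b ≠ 0 → h * φ a = ω b * (g + r * φ a) →
    act p 𝒪[K] (ModMax K L) (lift h) ((DMod.of (overO ω)).symm (β f (frac 1 b))) =
      act p 𝒪[K] (ModMax K L) (lift g) ((DMod.of (overO φ)).symm (f (frac 1 a)))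
  linear : ∀ (a : A) (f : Tate L (overO φ)) (z : FracMod B),
    (DMod.of (overO ω)).symm (β (a • f) z) =
      act p 𝒪[K] (ModMax K L) (lift (φ a)) ((DMod.of (overO ω)).symm (β f z))
  continuous : Continuous β
  continuous_symm : Continuous β.symm
  equivariant : ∀ (σ : Gal(L/K)) (f : Tate L (overO φ)), β (galTate σ f) = galTate σ (β f)

end Drinfeld

/-! ## Laurent series in `τ⁻¹` and the isomorphism `χ` -/

section Laurent

/-- The product of twisted Laurent series `∑ f_i τ^i` in `τ⁻¹` over a perfect ring, which are given
by their coefficients `f : ℤ → S`: `(f g)_m = ∑ f_i (g_{m-i})^{p^i}`. For series that vanish in all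
large degrees the sum is finite. -/
def laurentMul (p : ℕ) {S : Type*} [CommRing S] [ExpChar S p] [PerfectRing S p] (f g : ℤ → S) :
    ℤ → S :=
  fun m => ∑ᶠ i : ℤ, f i * ((frobeniusEquiv S p : RingAut S) ^ i) (g (m - i))

variable {p : ℕ} [Fact p.Prime] {K : Type*} [Field K] [ValuativeRel K] [TopologicalSpace K]
  [IsNonarchimedeanLocalField K] [CharP K p] {A : Type*} [CommRing A]
  (E : Type*) [Field E] [Algebra K E] [CharP E p] [PerfectRing E p]

/-- A twisted polynomial over `𝒪_K` as a Laurent series in `τ⁻¹` with coefficients in `E`. -/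
def polySeries (f : Twisted p 𝒪[K]) : ℤ → E :=
  fun j => if 0 ≤ j then algebraMap 𝒪[K] E (f.coeff j.toNat) else 0

/-- The power series `∑_{n ≥ 0} x_n τ^{-n}` as a Laurent series in `τ⁻¹`. -/
def negSeries (x : ℕ → 𝒪[K]) : ℤ → E :=
  fun j => if j ≤ 0 then algebraMap 𝒪[K] E (x (-j).toNat) else 0

/-- `x = ∑_{n ≥ 0} x_n τ^{-n}` has coefficients in `𝒪_K`, is congruent to `1` modulo `𝔪_K`, and
satisfies `ψ_a x = x φ_a` for all `a ∈ A`. -/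
structure IsIntertwiner (ψ φ : A →+* Twisted p 𝒪[K]) (x : ℕ → 𝒪[K]) : Prop where
  zero : x 0 - 1 ∈ 𝓂[K]
  pos : ∀ n, 0 < n → x n ∈ 𝓂[K]
  comm : ∀ a : A, laurentMul p (polySeries E (ψ a)) (negSeries E x) =
    laurentMul p (negSeries E x) (polySeries E (φ a))

end Laurent

/-- `χ` is given on residue classes by `χ([ξ]) = ∑_{n ≥ 0} [x_n ξ^{p^{-n}}]`, a sum in which
almost all terms vanish. -/
def IsChi {p : ℕ} [Fact p.Prime] {K : Type*} [Field K] [ValuativeRel K] [TopologicalSpace K]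
    [IsNonarchimedeanLocalField K] [CharP K p] {A : Type*} [CommRing A]
    (L : Type*) [Field L] [Algebra K L] [CharP L p] [PerfectRing (perfectClosure K L) p]
    (ψ φ : A →+* Twisted p 𝒪[K]) (x : ℕ → 𝒪[K])
    (χ : KummerDomain L φ ≃ₗ[A] KummerDomain L ψ) : Prop :=
  ∀ ξ : perfectClosure K L, ∀ᶠ N in atTop,
    χ (principal φ ξ) = ∑ n ∈ Finset.range N,
      principal ψ (x n • ((frobeniusEquiv (perfectClosure K L) p).symm^[n] ξ))

end LocalKummer

end

/-!
Everything is reduced to estimates for the absolute value `N` of the algebraic closure `L` that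
extends the one of `K`, and whose valuation ring is the integral closure of `𝒪_K`
(`exists_isIntegralAbs`). A twisted polynomial with unit leading coefficient is surjective on `L`
(`exists_act_eq`), and the preimages of integral elements are integral
(`IsIntegralAbs.le_one_of_act`).

*Kummer pairing.* If `θ_a(r) ≡ θ_a(r')` modulo `𝒪_L`, then `r - r'` is integral, and the inertia
group acts trivially on `𝒪_L / 𝔪_L` (`inertia_sub_lt`): every residue class is represented by a root
of some `X ^ (p ^ n) - X`, and such roots generate unramified extensions. Hence
`[γ(r) - r]` depends only on the principal part of `θ_a(r)`. So the pairing exists on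
representatives, and it descends to the principal parts and, the target being killed by `p`, to
`J_K`.

*Reduction of Tate modules.* A torsion class of `(L / 𝔪_L, ψ)` has integral representatives, and
on integral elements `ψ_a` and its reduction agree modulo `𝔪_L`. So both Tate modules consist of the
same maps.

*The isomorphism `β`.* As `k` is finite and `A`, `B` are infinite, every nonzero element of
`R = k[τ]` divides some `φ_a` and some `ω_b`, by the pigeonhole principle in the finite group
of remainders (`Twisted.exists_eq_mul`). So `φ_a = ω_b g` for a suitable `a`, and one can put
`(β f)(1/b) = g (f(1/a))`; the elements `ω_b` are central. For the Kummer pairings,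
a root of `φ_a` over `ξ` is sent by `g` to a root of `ω_b` over `ξ`.

*The intertwining series and `χ`.* The equation `f x = x f̄` for one `f = ψ_a` of positive degree
determines the coefficients of `x` successively by Hensel's lemma. The difference `ψ_b x - x φ_b`
solves the same kind of equation and vanishes modulo `𝔪_K`; such a solution is zero, because its
leading coefficient `c ∈ 𝔪_K` satisfies `u c ^ q = v c` with units `u`, `v` and `q > 1`
(`eq_zero_of_defect_eq_zero`). On `L` the series `x` can be replaced by its partial sums, as
`|η|^{p^{-n}}` tends to `1` while `|x_n|`, for `n > 0`, is bounded by a constant smaller than `1`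
(`IsIntegralAbs.exists_act_partialSum_sub_lt`). They differ from the identity by a contraction,
which makes `χ` bijective, and they are congruent to the identity on integral elements, to which
`γ(η) - η` belongs. This gives the compatibility with the Kummer pairings.
-/

noncomputable section

set_option linter.unusedSectionVars false

namespace LocalKummer

/-! ### Twisted polynomials -/

namespace Twisted

section General

variable {p : ℕ} {S : Type*} [CommRing S] [ExpChar S p]

@[ext]
lemma ext {f g : Twisted p S} (h : ∀ i, f.coeff i = g.coeff i) : f = g :=
  SkewMonoidAlgebra.ext fun y => h (Multiplicative.toAdd y)

lemma coeff_zero (i : ℕ) : (0 : Twisted p S).coeff i = 0 := rfl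

lemma coeff_sub (f g : Twisted p S) (i : ℕ) : (f - g).coeff i = f.coeff i - g.coeff i :=
  map_sub (coeffHom i) f g

lemma coeff_sum {ι : Type*} (s : Finset ι) (f : ι → Twisted p S) (i : ℕ) :
    (∑ j ∈ s, f j).coeff i = ∑ j ∈ s, (f j).coeff i :=
  map_sum (coeffHom i) f s

lemma exists_bound (f : Twisted p S) : ∃ N, ∀ i ≥ N, f.coeff i = 0 := by
  refine ⟨(SkewPolynomial.support (R := S) f).sup id + 1, fun i hi => ?_⟩
  by_contra h
  have : i ≤ (SkewPolynomial.support (R := S) f).sup id :=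
    Finset.le_sup (f := id) ((SkewPolynomial.mem_support_iff (R := S)).mpr h)
  omega

lemma eq_sum_monomial {f : Twisted p S} {N : ℕ} (hN : ∀ i ≥ N, f.coeff i = 0) :
    f = ∑ i ∈ Finset.range N, monomial p i (f.coeff i) := by
  ext j
  rw [coeff_sum]
  simp only [coeff_monomial, Finset.sum_ite_eq', Finset.mem_range]
  split_ifs with h
  · rfl
  · exact hN j (not_lt.mp h)

lemma one_eq : (1 : Twisted p S) = monomial p 0 1 := rfl

/-- The product of twisted polynomials: `(f g)_m = ∑_{i + j = m} f_i g_j ^ (p ^ i)`. -/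
lemma coeff_mul (f g : Twisted p S) (m : ℕ) :
    (f * g).coeff m =
      ∑ x ∈ Finset.HasAntidiagonal.antidiagonal m, f.coeff x.1 * g.coeff x.2 ^ p ^ x.1 := by
  obtain ⟨N, hN⟩ := f.exists_bound
  obtain ⟨M, hM⟩ := g.exists_bound
  conv_lhs => rw [eq_sum_monomial hN, eq_sum_monomial hM]
  simp only [Finset.sum_mul_sum, coeff_sum, monomial_mul_monomial, coeff_monomial]
  rw [← Finset.sum_product', ← Finset.sum_filter]
  refine Finset.sum_subset_zero_on_sdiff ?_ ?_ fun _ _ => rfl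
  · intro x hx
    simp only [Finset.mem_filter] at hx
    simpa using hx.2
  · intro x hx
    simp only [Finset.mem_sdiff, Finset.HasAntidiagonal.mem_antidiagonal, Finset.mem_filter,
      Finset.mem_product, Finset.mem_range, not_and_or, not_lt] at hx
    rcases hx.2 with (h | h) | h
    · rw [hN _ h, zero_mul]
    · rw [hM _ h, zero_pow (pow_pos (expChar_pos S p) _).ne', mul_zero]
    · exact absurd hx.1 h

/-- The product of the top coefficients. -/
lemma coeff_mul_top {f g : Twisted p S} {n m : ℕ} (hf : ∀ i > n, f.coeff i = 0)
    (hg : ∀ i > m, g.coeff i = 0) :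
    (f * g).coeff (n + m) = f.coeff n * g.coeff m ^ p ^ n := by
  rw [coeff_mul, Finset.sum_eq_single (n, m)]
  · rintro ⟨i, j⟩ hx hne
    rw [Finset.HasAntidiagonal.mem_antidiagonal] at hx
    simp only at hx ⊢
    rcases lt_trichotomy i n with h | h | h
    · rw [hg j (by omega), zero_pow (pow_pos (expChar_pos S p) _).ne', mul_zero]
    · exact absurd (Prod.ext h (by simp; omega)) hne
    · rw [hf i h, zero_mul]
  · intro h
    simp at h

lemma coeff_mul_above {f g : Twisted p S} {n m : ℕ} (hf : ∀ i > n, f.coeff i = 0)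
    (hg : ∀ i > m, g.coeff i = 0) : ∀ i > n + m, (f * g).coeff i = 0 := by
  intro l hl
  rw [coeff_mul]
  refine Finset.sum_eq_zero ?_
  rintro ⟨i, j⟩ hx
  rw [Finset.HasAntidiagonal.mem_antidiagonal] at hx
  simp only at hx ⊢
  by_cases h : i > n
  · rw [hf i h, zero_mul]
  · rw [hg j (by omega), zero_pow (pow_pos (expChar_pos S p) _).ne', mul_zero]

lemma exists_top {f : Twisted p S} (hf : f ≠ 0) :
    ∃ n, f.coeff n ≠ 0 ∧ ∀ i > n, f.coeff i = 0 := by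
  classical
  obtain ⟨N, hN⟩ := f.exists_bound
  have hex : ∃ n, f.coeff n ≠ 0 := by
    by_contra! h
    exact hf (ext h)
  obtain ⟨n, hn⟩ := hex
  have hnN : n ≤ N := by
    by_contra h
    exact hn (hN n (by omega))
  refine ⟨Nat.findGreatest (fun i => f.coeff i ≠ 0) N, ?_, fun i hi => ?_⟩
  · exact Nat.findGreatest_spec (P := fun i => f.coeff i ≠ 0) hnN hn
  · by_cases hiN : i ≤ N
    · simpa using Nat.findGreatest_is_greatest hi hiN
    · exact hN i (by omega)

end General

section Field

variable {p : ℕ} {k : Type*} [Field k] [ExpChar k p]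

instance : NoZeroDivisors (Twisted p k) where
  eq_zero_or_eq_zero_of_mul_eq_zero {f g} h := by
    by_contra! hne
    obtain ⟨n, hn, hf⟩ := exists_top hne.1
    obtain ⟨m, hm, hg⟩ := exists_top hne.2
    have h2 := coeff_mul_top hf hg
    rw [h, coeff_zero] at h2
    exact mul_ne_zero hn (pow_ne_zero _ hm) h2.symm

instance : IsCancelMulZero (Twisted p k) := NoZeroDivisors.to_isCancelMulZero (Twisted p k)

/-- Right division with remainder. -/
lemma exists_div {P : Twisted p k} {n : ℕ} (hn : P.coeff n ≠ 0) (hP : ∀ i > n, P.coeff i = 0)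
    (N : ℕ) (f : Twisted p k) (hf : ∀ i ≥ N, f.coeff i = 0) :
    ∃ g r : Twisted p k, f = g * P + r ∧ ∀ i ≥ n, r.coeff i = 0 := by
  induction N generalizing f with
  | zero => exact ⟨0, f, by simp, fun i _ => hf i (Nat.zero_le i)⟩
  | succ N ih =>
    by_cases hNn : N < n
    · exact ⟨0, f, by simp, fun i hi => hf i (by omega)⟩
    push Not at hNn
    set c := f.coeff N / P.coeff n ^ p ^ (N - n) with hc
    have hm : ∀ i > N - n, (monomial p (N - n) c).coeff i = 0 := fun i hi => by
      rw [coeff_monomial, if_neg (by omega)]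
    obtain ⟨g, r, h, hr⟩ := ih (f - monomial p (N - n) c * P) fun i hi => by
      rw [coeff_sub]
      rcases hi.lt_or_eq with h | rfl
      · rw [hf i h, coeff_mul_above hm hP i (by omega), sub_zero]
      · have := coeff_mul_top hm hP
        rw [Nat.sub_add_cancel hNn, coeff_monomial, if_pos rfl, hc,
          div_mul_cancel₀ _ (pow_ne_zero _ hn)] at this
        rw [this, sub_self]
    refine ⟨g + monomial p (N - n) c, r, ?_, hr⟩
    rw [add_mul, add_right_comm, ← h, sub_add_cancel]

/-- Over a finite field the left ideal generated by a non-zero twisted polynomial has finite index;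
hence it meets every infinite additive group of twisted polynomials. -/
lemma exists_eq_mul [Finite k] {B : Type*} [Ring B] [Infinite B] (w : B →+* Twisted p k)
    {P : Twisted p k} (hP : P ≠ 0) : ∃ b : B, b ≠ 0 ∧ ∃ g, w b = g * P := by
  obtain ⟨n, hn, htop⟩ := exists_top hP
  have hdiv : ∀ b : B, ∃ gr : Twisted p k × Twisted p k, w b = gr.1 * P + gr.2 ∧
      ∀ i ≥ n, gr.2.coeff i = 0 := fun b => by
    obtain ⟨N, hN⟩ := (w b).exists_bound
    obtain ⟨g, r, h⟩ := exists_div hn htop N (w b) hN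
    exact ⟨(g, r), h⟩
  choose gr hgr hr using hdiv
  obtain ⟨b, b', hne, h⟩ := Finite.exists_ne_map_eq_of_infinite
    (fun (b : B) (i : Fin n) => (gr b).2.coeff i)
  have hrem : (gr b).2 = (gr b').2 := by
    ext i
    by_cases hi : i < n
    · exact congrFun h ⟨i, hi⟩
    · rw [hr b i (by omega), hr b' i (by omega)]
  refine ⟨b - b', sub_ne_zero.mpr hne, (gr b).1 - (gr b').1, ?_⟩
  rw [map_sub, hgr, hgr, hrem, sub_mul]
  abel

end Field

end Twisted

section Action

variable {p : ℕ} {S : Type*} [CommRing S] [ExpChar S p]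
  {V : Type*} [AddCommGroup V] [Module S V] [FrobModule p S V]

/-- The action as a finite sum. -/
lemma act_eq_sum {f : Twisted p S} {N : ℕ} (hN : ∀ i ≥ N, f.coeff i = 0) (v : V) :
    act p S V f v =
      ∑ i ∈ Finset.range N, f.coeff i • (FrobModule.frob p S : AddMonoid.End V)^[i] v := by
  let e : Twisted p S →+ V := (AddMonoidHom.eval v).comp (act p S V).toAddMonoidHom
  conv_lhs => rw [Twisted.eq_sum_monomial hN]
  refine (map_sum e _ _).trans ?_
  exact Finset.sum_congr rfl fun i _ => act_monomial p S V i _ v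

lemma act_mul_apply (f g : Twisted p S) (v : V) :
    act p S V (f * g) v = act p S V f (act p S V g v) := by
  rw [map_mul]
  rfl

lemma act_one_apply (v : V) : act p S V (1 : Twisted p S) v = v := by
  rw [map_one]
  rfl

lemma act_sub_apply (f g : Twisted p S) (v : V) :
    act p S V (f - g) v = act p S V f v - act p S V g v := by
  rw [map_sub]
  rfl

/-- An additive map compatible with scalars and Frobenius is compatible with twisted
polynomials. -/
lemma act_comm' {W : Type*} [AddCommGroup W] [Module S W] [FrobModule p S W] (u : V →+ W)
    (hs : ∀ (c : S) v, u (c • v) = c • u v)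
    (hu : ∀ v, u (FrobModule.frob p S v) = FrobModule.frob p S (u v))
    (f : Twisted p S) (v : V) : u (act p S V f v) = act p S W f (u v) := by
  obtain ⟨N, hN⟩ := f.exists_bound
  rw [act_eq_sum hN, act_eq_sum hN, map_sum]
  refine Finset.sum_congr rfl fun i _ => ?_
  rw [hs]
  congr 1
  exact Function.Semiconj.iterate_right (f := u) (ga := FrobModule.frob p S)
    (gb := FrobModule.frob p S) hu i v

lemma iterate_eq_pow {T : Type*} [Monoid T] {F : T → T} (hF : ∀ v, F v = v ^ p) (i : ℕ) (v : T) :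
    F^[i] v = v ^ p ^ i := by
  induction i with
  | zero => simp
  | succ i ih => rw [Function.iterate_succ_apply', ih, pow_succ, pow_mul, hF]

/-- The action on an algebra as a finite sum. -/
lemma act_algebra_eq_sum {T : Type*} [CommRing T] [Algebra S T] [ExpChar T p] {f : Twisted p S}
    {N : ℕ} (hN : ∀ i ≥ N, f.coeff i = 0) (v : T) :
    act p S T f v = ∑ i ∈ Finset.range N, algebraMap S T (f.coeff i) * v ^ p ^ i := by
  rw [act_eq_sum hN]
  exact Finset.sum_congr rfl fun i _ =>
    (congrArg (f.coeff i • ·) (iterate_eq_pow (p := p) (fun _ => rfl) i v)).trans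
      (Algebra.smul_def _ _)

end Action

/-! ### The absolute value on an algebraic extension of a local field -/

/-- `N` is a non-archimedean absolute value on `L` whose valuation ring is the integral closure of
`𝒪_K`. -/
structure IsIntegralAbs (K : Type*) [Field K] [ValuativeRel K] {L : Type*} [Field L] [Algebra K L]
    (N : AbsoluteValue L ℝ) : Prop where
  add_le_max : ∀ x y, N (x + y) ≤ max (N x) (N y)
  le_one_iff : ∀ x, N x ≤ 1 ↔ IsIntegral 𝒪[K] x

/-- The spectral norm is an absolute value on an algebraic extension of a local field, and its
valuation ring is the integral closure of `𝒪_K`. -/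
lemma exists_isIntegralAbs (K : Type*) [Field K] [ValuativeRel K] [TopologicalSpace K]
    [IsNonarchimedeanLocalField K] (L : Type*) [Field L] [Algebra K L] [Algebra.IsAlgebraic K L] :
    ∃ N : AbsoluteValue L ℝ, IsIntegralAbs K N := by
  let _ := IsTopologicalAddGroup.rightUniformSpace K
  have _ := isUniformAddGroup_of_addCommGroup (G := K)
  let _ : (Valued.v (R := K) (Γ₀ := ValueGroupWithZero K)).RankOne :=
  { hom' := IsRankLeOne.nonempty.some.emb (R := K).comp MonoidWithZeroHom.ValueGroup₀.embedding
    strictMono' := IsRankLeOne.nonempty.some.strictMono.comp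
        MonoidWithZeroHom.ValueGroup₀.embedding_strictMono }
  let _ : NontriviallyNormedField K :=
    Valued.toNontriviallyNormedField (L := K) (Γ₀ := ValueGroupWithZero K)
  have _ : IsUltrametricDist K := inferInstance
  have _ : CompleteSpace K := inferInstance
  have hnorm : ∀ x : K, ‖x‖ ≤ 1 ↔ x ∈ 𝒪[K] := fun x => Valued.toNormedField.norm_le_one_iff
  let M := spectralMulAlgNorm K L
  refine ⟨⟨⟨M, map_mul M⟩, fun x => apply_nonneg M x, fun x => map_eq_zero_iff_eq_zero M,
    fun x y => map_add_le_add M x y⟩, ?_, ?_⟩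
  · exact isNonarchimedean_spectralNorm (K := K) (L := L)
  · intro x
    have hx : IsIntegral K x := (Algebra.IsAlgebraic.isAlgebraic x).isIntegral
    change spectralNorm K L x ≤ 1 ↔ _
    rw [spectralNorm, spectralValue_le_one_iff (minpoly.monic hx)]
    constructor
    · intro h
      have hl : minpoly K x ∈ Polynomial.lifts (algebraMap 𝒪[K] K) := by
        rw [Polynomial.lifts_iff_coeff_lifts]
        exact fun n => ⟨⟨_, (hnorm _).mp (h n)⟩, rfl⟩
      obtain ⟨q, hq, -, hqm⟩ := Polynomial.lifts_and_degree_eq_and_monic hl (minpoly.monic hx)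
      refine ⟨q, hqm, ?_⟩
      rw [IsScalarTower.algebraMap_eq 𝒪[K] K L, ← Polynomial.eval₂_map, hq]
      exact minpoly.aeval K x
    · intro h n
      rw [minpoly.isIntegrallyClosed_eq_field_fractions' K h, Polynomial.coeff_map, hnorm]
      exact Subtype.property _

/-- A finite sum of elements of absolute value `< C` has absolute value `< C`. -/
lemma IsIntegralAbs.sum_lt {K : Type*} [Field K] [ValuativeRel K] {L : Type*} [Field L]
    [Algebra K L] {N : AbsoluteValue L ℝ} (hN : IsIntegralAbs K N) {ι : Type*} (s : Finset ι)
    (f : ι → L) {C : ℝ} (hC : 0 < C) (h : ∀ i ∈ s, N (f i) < C) : N (∑ i ∈ s, f i) < C := by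
  classical
  induction s using Finset.induction_on with
  | empty => simpa
  | insert a s ha ih =>
    rw [Finset.sum_insert ha]
    exact (hN.add_le_max _ _).trans_lt (max_lt (h a (Finset.mem_insert_self _ _))
      (ih fun i hi => h i (Finset.mem_insert_of_mem hi)))

lemma IsIntegralAbs.add_lt {K : Type*} [Field K] [ValuativeRel K] {L : Type*} [Field L]
    [Algebra K L] {N : AbsoluteValue L ℝ} (hN : IsIntegralAbs K N) {x y : L} {C : ℝ}
    (hx : N x < C) (hy : N y < C) : N (x + y) < C :=
  (hN.add_le_max x y).trans_lt (max_lt hx hy)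

lemma IsIntegralAbs.sub_lt {K : Type*} [Field K] [ValuativeRel K] {L : Type*} [Field L]
    [Algebra K L] {N : AbsoluteValue L ℝ} (hN : IsIntegralAbs K N) {x y : L} {C : ℝ}
    (hx : N x < C) (hy : N y < C) : N (x - y) < C := by
  rw [sub_eq_add_neg]
  exact hN.add_lt hx (by rwa [N.map_neg])

section

variable {K : Type*} [Field K] [ValuativeRel K] {L : Type*} [Field L] [Algebra K L]
  {N : AbsoluteValue L ℝ} (hN : IsIntegralAbs K N)

include hN

lemma IsIntegralAbs.mem_intSub {x : L} : x ∈ intSub K L ↔ N x ≤ 1 :=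
  (hN.le_one_iff x).symm

lemma IsIntegralAbs.mem_maxSub {x : L} : x ∈ maxSub K L ↔ N x < 1 := by
  have key : ∀ y : integralClosure 𝒪[K] L, y ∈ intMax K L ↔ N (y : L) < 1 := fun y => by
    rw [intMax, Ideal.mem_jacobson_bot]
    have hy1 : N (y : L) ≤ 1 := (hN.le_one_iff _).mpr y.2
    constructor
    · intro h
      refine lt_of_le_of_ne hy1 fun h1 => ?_
      have hy0 : (y : L) ≠ 0 := fun h0 => by simp [h0] at h1
      let z : integralClosure 𝒪[K] L := ⟨-(y : L)⁻¹, (hN.le_one_iff _).mp (by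
        rw [N.map_neg, map_inv₀, h1, inv_one])⟩
      have h2 : y * z + 1 = 0 := by
        apply Subtype.ext
        change (y : L) * (-(y : L)⁻¹) + 1 = 0
        field_simp
        ring
      have := h z
      rw [h2] at this
      exact not_isUnit_zero this
    · intro h z
      have hz : N (z : L) ≤ 1 := (hN.le_one_iff _).mpr z.2
      have hyz : N ((y : L) * z) < 1 := by
        rw [map_mul]
        exact mul_lt_one_of_nonneg_of_lt_one_left (N.nonneg _) h hz
      have h1 : 1 ≤ N ((y : L) * z + 1) := by
        by_contra! hlt
        have := hN.sub_lt hlt hyz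
        simp at this
      have hne : (y : L) * z + 1 ≠ 0 := fun h0 => by
        rw [h0, map_zero] at h1
        exact absurd h1 (by norm_num)
      refine IsUnit.of_mul_eq_one ⟨((y : L) * z + 1)⁻¹, (hN.le_one_iff _).mp ?_⟩ (Subtype.ext ?_)
      · rw [map_inv₀]
        exact inv_le_one_of_one_le₀ h1
      · exact mul_inv_cancel₀ hne
  constructor
  · rintro ⟨y, hy, rfl⟩
    exact (key y).mp hy
  · intro h
    exact ⟨⟨x, (hN.le_one_iff x).mp h.le⟩, (key _).mpr h, rfl⟩

lemma IsIntegralAbs.mem_intMax {x : integralClosure 𝒪[K] L} :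
    x ∈ intMax K L ↔ N (x : L) < 1 := by
  rw [← hN.mem_maxSub]
  constructor
  · intro h
    exact ⟨x, h, rfl⟩
  · rintro ⟨y, hy, h⟩
    rwa [show x = y from Subtype.ext h.symm]

lemma IsIntegralAbs.comp {E : Type*} [Field E] [Algebra K E] (f : E →ₐ[K] L) :
    IsIntegralAbs K (N.comp f.toRingHom.injective) where
  add_le_max x y := by
    exact (congrArg N (map_add f x y)).trans_le (hN.add_le_max (f x) (f y))
  le_one_iff x := by
    refine (hN.le_one_iff (f x)).trans ?_
    exact isIntegral_algHom_iff (f.restrictScalars 𝒪[K]) f.toRingHom.injective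

lemma IsIntegralAbs.algebraMap_le_one (c : 𝒪[K]) : N (algebraMap 𝒪[K] L c) ≤ 1 :=
  (hN.le_one_iff _).mpr isIntegral_algebraMap

lemma IsIntegralAbs.eq_one_of_isUnit {c : 𝒪[K]} (hc : IsUnit c) : N (algebraMap 𝒪[K] L c) = 1 := by
  obtain ⟨u, rfl⟩ := hc
  refine le_antisymm (hN.algebraMap_le_one _) ?_
  by_contra! h
  have h1 : N (algebraMap 𝒪[K] L (u : 𝒪[K])) * N (algebraMap 𝒪[K] L (↑u⁻¹ : 𝒪[K])) = 1 := by
    rw [← map_mul, ← map_mul, Units.mul_inv, map_one, map_one]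
  have h2 := mul_lt_one_of_nonneg_of_lt_one_left (N.nonneg _) h (hN.algebraMap_le_one (↑u⁻¹ : 𝒪[K]))
  exact absurd h1 h2.ne

end

section Local

variable {K : Type*} [Field K] [ValuativeRel K] [TopologicalSpace K]
  [IsNonarchimedeanLocalField K] {L : Type*} [Field L] [Algebra K L]
  {N : AbsoluteValue L ℝ} (hN : IsIntegralAbs K N)

include hN

lemma IsIntegralAbs.lt_one_iff_mem {c : 𝒪[K]} : N (algebraMap 𝒪[K] L c) < 1 ↔ c ∈ 𝓂[K] := by
  rw [IsLocalRing.mem_maximalIdeal, mem_nonunits_iff]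
  constructor
  · intro h hc
    exact h.ne (hN.eq_one_of_isUnit hc)
  · intro h
    refine lt_of_le_of_ne (hN.algebraMap_le_one c) fun h1 => h ?_
    have hc0 : (c : K) ≠ 0 := by
      intro h0
      rw [show c = 0 from Subtype.ext h0] at h1
      simp at h1
    have hint : IsIntegral 𝒪[K] ((c : K)⁻¹) := by
      rw [← isIntegral_algHom_iff (IsScalarTower.toAlgHom 𝒪[K] K L) (algebraMap K L).injective,
        ← hN.le_one_iff]
      change N (algebraMap K L _) ≤ 1
      rw [map_inv₀, map_inv₀]
      change (N (algebraMap 𝒪[K] L c))⁻¹ ≤ 1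
      rw [h1, inv_one]
    obtain ⟨d, hd⟩ := IsIntegrallyClosed.isIntegral_iff.mp hint
    refine IsUnit.of_mul_eq_one d (Subtype.ext ?_)
    change (c : K) * (algebraMap 𝒪[K] K d) = 1
    rw [hd, mul_inv_cancel₀ hc0]

/-- The absolute values of the elements of `𝔪_K` are bounded away from `1`, because `𝔪_K` is
principal. -/
lemma IsIntegralAbs.exists_bound :
    ∃ ρ : ℝ, 0 < ρ ∧ ρ < 1 ∧ ∀ c ∈ 𝓂[K], N (algebraMap 𝒪[K] L c) ≤ ρ := by
  obtain ⟨π, hπ⟩ := IsDiscreteValuationRing.exists_irreducible 𝒪[K]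
  have hm := hπ.maximalIdeal_eq
  refine ⟨N (algebraMap 𝒪[K] L π), ?_, ?_, fun c hc => ?_⟩
  · refine N.pos fun h0 => hπ.ne_zero ?_
    rw [IsScalarTower.algebraMap_apply 𝒪[K] K L] at h0
    exact Subtype.ext ((map_eq_zero _).mp h0)
  · rw [hN.lt_one_iff_mem, hm]
    exact Ideal.mem_span_singleton_self π
  · rw [hm, Ideal.mem_span_singleton] at hc
    obtain ⟨e, rfl⟩ := hc
    rw [map_mul, map_mul]
    exact mul_le_of_le_one_right (N.nonneg _) (hN.algebraMap_le_one e)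

end Local

section Division

variable {p : ℕ} [Fact p.Prime] {K : Type*} [Field K] [ValuativeRel K] [TopologicalSpace K]
  [IsNonarchimedeanLocalField K] [CharP K p] {L : Type*} [Field L] [Algebra K L] [CharP L p]

/-- A twisted polynomial with unit leading coefficient sends only integral elements to integral
elements. -/
lemma IsIntegralAbs.le_one_of_act {N : AbsoluteValue L ℝ} (hN : IsIntegralAbs K N)
    {f : Twisted p 𝒪[K]} {n : ℕ} (hn : IsUnit (f.coeff n)) (hf : ∀ m > n, f.coeff m = 0) {v : L}
    (hv : N (act p 𝒪[K] L f v) ≤ 1) : N v ≤ 1 := by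
  by_contra! h
  have hp := (Fact.out : p.Prime).one_lt
  rw [act_algebra_eq_sum (N := n + 1) (fun i hi => hf i (by omega)), Finset.sum_range_succ] at hv
  have h1 : 1 < N v ^ p ^ n := one_lt_pow₀ h (pow_pos (by omega) _).ne'
  have hs : N (∑ i ∈ Finset.range n, algebraMap 𝒪[K] L (f.coeff i) * v ^ p ^ i) < N v ^ p ^ n := by
    refine hN.sum_lt _ _ (by positivity) fun i hi => ?_
    rw [map_mul, map_pow]
    refine (mul_le_of_le_one_left (by positivity) (hN.algebraMap_le_one _)).trans_lt ?_
    exact pow_lt_pow_right₀ h (Nat.pow_lt_pow_right hp (Finset.mem_range.mp hi))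
  have := hN.sub_lt (hv.trans_lt h1) hs
  rw [add_sub_cancel_left, map_mul, hN.eq_one_of_isUnit hn, one_mul, map_pow] at this
  exact lt_irrefl _ this

/-- Over an algebraically closed field every element is divisible by a twisted polynomial with unit
leading coefficient. -/
lemma exists_act_eq [IsAlgClosed L] {f : Twisted p 𝒪[K]} {n : ℕ} (hn : IsUnit (f.coeff n))
    (hf : ∀ m > n, f.coeff m = 0) (ξ : L) : ∃ v : L, act p 𝒪[K] L f v = ξ := by
  have hp := (Fact.out : p.Prime).one_lt
  let P : Polynomial L := ∑ i ∈ Finset.range (n + 1),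
    Polynomial.C (algebraMap 𝒪[K] L (f.coeff i)) * Polynomial.X ^ p ^ i - Polynomial.C ξ
  have hc : P.coeff (p ^ n) = algebraMap 𝒪[K] L (f.coeff n) := by
    have h0 : p ^ n ≠ 0 := (pow_pos (by omega) _).ne'
    simp only [P, Polynomial.coeff_sub, Polynomial.finsetSum_coeff, Polynomial.coeff_C_mul,
      Polynomial.coeff_X_pow, Polynomial.coeff_C, h0, if_false, sub_zero]
    rw [Finset.sum_eq_single n]
    · simp
    · intro i _ hi
      rw [if_neg, mul_zero]
      exact fun h => hi (Nat.pow_right_injective hp h).symm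
    · intro h
      simp at h
  have hdeg : P.degree ≠ 0 := by
    intro h
    have h2 := Polynomial.le_degree_of_ne_zero (n := p ^ n) (p := P)
      (by rw [hc]; exact (hn.map _).ne_zero)
    rw [h] at h2
    have : p ^ n ≤ 0 := by exact_mod_cast h2
    exact absurd (pow_pos (by omega : 0 < p) n) (by omega)
  obtain ⟨v, hv⟩ := IsAlgClosed.exists_root P hdeg
  refine ⟨v, ?_⟩
  rw [act_algebra_eq_sum (N := n + 1) (fun i hi => hf i (by omega))]
  rw [Polynomial.IsRoot, Polynomial.eval_sub, Polynomial.eval_finsetSum, Polynomial.eval_C,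
    sub_eq_zero] at hv
  simpa using hv

end Division

/-! ### Inertia acts trivially on the residue field -/

section

variable {p : ℕ} [Fact p.Prime] {K : Type*} [Field K] [ValuativeRel K] [TopologicalSpace K]
  [IsNonarchimedeanLocalField K] [CharP K p] {L : Type*} [Field L] [Algebra K L] [CharP L p]
  {N : AbsoluteValue L ℝ}

/-- The residue class of an integral element is algebraic over the finite field `k`, hence fixed by
a power of Frobenius. -/
lemma IsIntegralAbs.exists_pow_sub_lt (hN : IsIntegralAbs K N) {x : L} (hx : N x ≤ 1) :
    ∃ n, 0 < n ∧ N (x ^ p ^ n - x) < 1 := by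
  obtain ⟨P, hP, hPx⟩ := (hN.le_one_iff x).mp hx
  -- the reductions of the remainders of `X ^ (p ^ m)` modulo `P` lie in a finite set
  obtain ⟨i, j, hne, hij⟩ := Finite.exists_ne_map_eq_of_infinite
    (fun (m : ℕ) (l : Fin P.natDegree) =>
      IsLocalRing.residue 𝒪[K] ((Polynomial.X ^ p ^ m %ₘ P).coeff l))
  wlog hlt : i < j generalizing i j
  · exact this j i hne.symm hij.symm (by omega)
  have hmod : ∀ m, x ^ p ^ m = ∑ l ∈ Finset.range P.natDegree,
      algebraMap 𝒪[K] L ((Polynomial.X ^ p ^ m %ₘ P).coeff l) * x ^ l := fun m => by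
    have h1 := congrArg (Polynomial.eval₂ (algebraMap 𝒪[K] L) x)
      (Polynomial.modByMonic_add_div (Polynomial.X ^ p ^ m) P)
    rw [Polynomial.eval₂_add, Polynomial.eval₂_mul, hPx, zero_mul, add_zero,
      Polynomial.eval₂_pow, Polynomial.eval₂_X] at h1
    rw [← h1]
    by_cases hP1 : P = 1
    · simp [hP1]
    · exact Polynomial.eval₂_eq_sum_range' _ (Polynomial.natDegree_modByMonic_lt _ hP hP1) _
  have hdiff : N (x ^ p ^ j - x ^ p ^ i) < 1 := by
    rw [hmod, hmod, ← Finset.sum_sub_distrib]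
    refine hN.sum_lt _ _ one_pos fun l hl => ?_
    rw [← sub_mul, ← map_sub, map_mul, map_pow]
    refine mul_lt_one_of_nonneg_of_lt_one_left (N.nonneg _) ?_ (pow_le_one₀ (N.nonneg _) hx)
    rw [hN.lt_one_iff_mem, ← IsLocalRing.residue_eq_zero_iff, map_sub, sub_eq_zero]
    exact (congrFun hij ⟨l, Finset.mem_range.mp hl⟩).symm
  refine ⟨j - i, by omega, ?_⟩
  rw [show p ^ j = p ^ (j - i) * p ^ i by rw [← pow_add]; congr 1; omega, pow_mul,
    ← sub_pow_char_pow, map_pow] at hdiff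
  by_contra! h
  exact absurd (one_le_pow₀ h) (not_le.mpr hdiff)

omit [TopologicalSpace K] [IsNonarchimedeanLocalField K] [CharP K p] in
/-- The roots of `X ^ (p ^ n) - X` represent all residue classes that are fixed by the `n`-th power
of Frobenius. -/
lemma exists_root_sub_lt [IsAlgClosed L] {n : ℕ} (hn : 0 < n) {x : L}
    (hx : N (x ^ p ^ n - x) < 1) : ∃ y : L, y ^ p ^ n = y ∧ N (x - y) < 1 := by
  have hp := (Fact.out : p.Prime).one_lt
  have key : ∀ s : Multiset L, N ((s.map (fun y => x - y)).prod) < 1 → ∃ y ∈ s, N (x - y) < 1 := by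
    intro s
    induction s using Multiset.induction_on with
    | empty => simp
    | cons a s ih =>
      intro h
      rw [Multiset.map_cons, Multiset.prod_cons, map_mul] at h
      by_cases h1 : N (x - a) < 1
      · exact ⟨a, Multiset.mem_cons_self _ _, h1⟩
      · obtain ⟨y, hy, hxy⟩ := ih (by
          by_contra! h2
          exact absurd (one_le_mul_of_one_le_of_one_le (not_lt.mp h1) h2) (not_le.mpr h))
        exact ⟨y, Multiset.mem_cons_of_mem hy, hxy⟩
  let P : Polynomial L := Polynomial.X ^ p ^ n - Polynomial.X
  have hP : P.Monic := Polynomial.monic_X_pow_sub (by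
    rw [Polynomial.degree_X]
    exact_mod_cast one_lt_pow₀ hp hn.ne')
  have hprod := (IsAlgClosed.splits P).eq_prod_roots_of_monic hP
  have hev : x ^ p ^ n - x = (P.roots.map (fun y => x - y)).prod := by
    have := congrArg (Polynomial.eval x) hprod
    rw [Polynomial.eval_multiset_prod, Multiset.map_map] at this
    simpa [P] using this
  rw [hev] at hx
  obtain ⟨y, hy, hxy⟩ := key _ hx
  refine ⟨y, ?_, hxy⟩
  have := Polynomial.isRoot_of_mem_roots hy
  simpa [P, sub_eq_zero] using this

variable (p K L) in
/-- The `k`-algebra structure on an extension of `K` given by the embedding `k → 𝒪_K`. -/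
@[reducible] def residueAlgebra : Algebra 𝓀[K] L :=
  ((algebraMap 𝒪[K] L).comp (teich p K)).toAlgebra

/-- A non-zero element that is algebraic over `k` has absolute value `1`, because its inverse is
algebraic over `k`, too, and both are integral over `𝒪_K`. -/
lemma IsIntegralAbs.eq_zero_of_isIntegral (hN : IsIntegralAbs K N) {w : L}
    (hw : letI := residueAlgebra p K L; IsIntegral 𝓀[K] w) (h1 : N w < 1) : w = 0 := by
  let _ := residueAlgebra p K L
  have key : ∀ v : L, IsIntegral 𝓀[K] v → N v ≤ 1 := by
    rintro v ⟨P, hP, hv⟩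
    refine (hN.le_one_iff v).mpr ⟨P.map (teich p K), hP.map _, ?_⟩
    rw [Polynomial.eval₂_map]
    exact hv
  by_contra h0
  have h2 := key _ hw.inv
  rw [map_inv₀] at h2
  exact absurd h2 (not_le.mpr ((one_lt_inv₀ (N.pos h0)).mpr h1))

/-- Adjoining an element that is algebraic over `k` does not change the value group: if `z` is
written as `∑ cᵢ y ^ i` with fewer terms than the degree of `y` over `k`, then `|z| = max |cᵢ|`,
because the powers of `y` stay linearly independent over `k` after reduction. -/
lemma IsIntegralAbs.exists_eq_of_mem_adjoin (hN : IsIntegralAbs K N) {y : L}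
    (hy : letI := residueAlgebra p K L; IsIntegral 𝓀[K] y) {z : L}
    (hz : z ∈ Algebra.adjoin K {y}) (hz0 : z ≠ 0) : ∃ c : K, N z = N (algebraMap K L c) := by
  let _ := residueAlgebra p K L
  rw [Algebra.adjoin_singleton_eq_range_aeval] at hz
  obtain ⟨G, rfl⟩ := hz
  let M : Polynomial K := (minpoly 𝓀[K] y).map ((algebraMap 𝒪[K] K).comp (teich p K))
  have hMm : M.Monic := (minpoly.monic hy).map _
  have hMy : Polynomial.aeval y M = 0 := by
    rw [Polynomial.aeval_def, Polynomial.eval₂_map]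
    exact minpoly.aeval 𝓀[K] y
  have hM1 : M ≠ 1 := fun h => by simp [h] at hMy
  set G' := G %ₘ M with hG'
  have hGG : Polynomial.aeval y G = Polynomial.aeval y G' := by
    have h1 := congrArg (Polynomial.aeval y) (Polynomial.modByMonic_add_div G M)
    rw [map_add, map_mul, hMy, zero_mul, add_zero] at h1
    exact h1.symm
  change Polynomial.aeval y G ≠ 0 at hz0
  change ∃ c : K, N (Polynomial.aeval y G) = _
  rw [hGG] at hz0 ⊢
  have hdeg : G'.natDegree < (minpoly 𝓀[K] y).natDegree := by
    have := Polynomial.natDegree_modByMonic_lt G hMm hM1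
    rwa [(minpoly.monic hy).natDegree_map] at this
  have hne : G'.support.Nonempty := Polynomial.support_nonempty.mpr fun h =>
    hz0 (by rw [h, map_zero])
  obtain ⟨i₀, hi₀, hmax⟩ := G'.support.exists_max_image
    (fun i => N (algebraMap K L (G'.coeff i))) hne
  set c := G'.coeff i₀ with hc
  have hc0 : c ≠ 0 := Polynomial.mem_support_iff.mp hi₀
  have hNc : 0 < N (algebraMap K L c) := N.pos ((map_ne_zero _).mpr hc0)
  have hint : ∀ i, ∃ g : 𝒪[K], (g : K) = G'.coeff i / c := fun i => by
    have h1 : N (algebraMap K L (G'.coeff i / c)) ≤ 1 := by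
      by_cases hi : i ∈ G'.support
      · rw [map_div₀, map_div₀]
        exact div_le_one_of_le₀ (hmax i hi) (N.nonneg _)
      · rw [Polynomial.notMem_support_iff.mp hi]
        simp
    rw [hN.le_one_iff] at h1
    have h2 := (isIntegral_algHom_iff (IsScalarTower.toAlgHom 𝒪[K] K L)
      (algebraMap K L).injective).mp h1
    exact IsIntegrallyClosed.isIntegral_iff.mp h2
  choose g hg using hint
  set D := (minpoly 𝓀[K] y).natDegree with hD
  have hsum : Polynomial.aeval y G' =
      algebraMap K L c * ∑ i ∈ Finset.range D, algebraMap 𝒪[K] L (g i) * y ^ i := by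
    rw [Polynomial.aeval_eq_sum_range' hdeg, Finset.mul_sum]
    refine Finset.sum_congr rfl fun i _ => ?_
    rw [IsScalarTower.algebraMap_apply 𝒪[K] K L]
    change _ = algebraMap K L c * (algebraMap K L (g i : K) * y ^ i)
    rw [hg, ← mul_assoc, ← map_mul, mul_div_cancel₀ _ hc0, Algebra.smul_def]
  refine ⟨c, ?_⟩
  rw [hsum, map_mul]
  refine mul_eq_left₀ hNc.ne' |>.mpr ?_
  have hy1 : N y ≤ 1 := by
    obtain ⟨P, hP, hv⟩ := hy
    refine (hN.le_one_iff y).mpr ⟨P.map (teich p K), hP.map _, ?_⟩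
    rw [Polynomial.eval₂_map]
    exact hv
  refine le_antisymm ?_ ?_
  · rw [hN.le_one_iff]
    exact IsIntegral.sum _ fun i _ => isIntegral_algebraMap.mul (((hN.le_one_iff y).mp hy1).pow i)
  -- otherwise the reduction `H` would vanish at `y`, but its degree is smaller than that of the
  -- minimal polynomial, and its coefficient in degree `i₀` is `1`
  by_contra! hlt
  let H : Polynomial 𝓀[K] := ∑ i ∈ Finset.range D,
    Polynomial.C (IsLocalRing.residue 𝒪[K] (g i)) * Polynomial.X ^ i
  have hHc : ∀ i ∈ Finset.range D, H.coeff i = IsLocalRing.residue 𝒪[K] (g i) := fun i hi => by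
    simp only [H, Polynomial.finsetSum_coeff, Polynomial.coeff_C_mul, Polynomial.coeff_X_pow]
    rw [Finset.sum_eq_single i]
    · simp
    · intro j _ hj
      rw [if_neg hj.symm, mul_zero]
    · intro h
      exact absurd hi h
  have hHy : Polynomial.aeval y H =
      ∑ i ∈ Finset.range D,
        algebraMap 𝒪[K] L (teich p K (IsLocalRing.residue 𝒪[K] (g i))) * y ^ i := by
    rw [map_sum]
    refine Finset.sum_congr rfl fun i _ => ?_
    rw [map_mul, map_pow, Polynomial.aeval_X, Polynomial.aeval_C]
    rfl
  have hHlt : N (Polynomial.aeval y H) < 1 := by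
    have hd : N (∑ i ∈ Finset.range D, algebraMap 𝒪[K] L (g i) * y ^ i -
        Polynomial.aeval y H) < 1 := by
      rw [hHy, ← Finset.sum_sub_distrib]
      refine hN.sum_lt _ _ one_pos fun i _ => ?_
      rw [← sub_mul, ← map_sub, map_mul, map_pow]
      refine mul_lt_one_of_nonneg_of_lt_one_left (N.nonneg _) ?_ (pow_le_one₀ (N.nonneg _) hy1)
      rw [hN.lt_one_iff_mem, ← IsLocalRing.residue_eq_zero_iff, map_sub, residue_teich, sub_self]
    have := hN.sub_lt hlt hd
    rwa [sub_sub_cancel] at this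
  have hH0 : Polynomial.aeval y H = 0 := by
    refine hN.eq_zero_of_isIntegral (p := p) ?_ hHlt
    rw [map_sum]
    refine IsIntegral.sum _ fun i _ => ?_
    rw [map_mul, map_pow, Polynomial.aeval_X, Polynomial.aeval_C]
    exact isIntegral_algebraMap.mul (hy.pow i)
  have hi₀D : i₀ < D := (Polynomial.le_natDegree_of_mem_supp _ hi₀).trans_lt hdeg
  have hHne : H ≠ 0 := fun h => by
    have h1 := hHc i₀ (Finset.mem_range.mpr hi₀D)
    have h2 : g i₀ = 1 := Subtype.ext (by rw [hg, ← hc, div_self hc0]; rfl)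
    rw [h, h2, map_one] at h1
    simp at h1
  have h1 := minpoly.degree_le_of_ne_zero 𝓀[K] y hHne hH0
  rw [Polynomial.degree_eq_natDegree (minpoly.ne_zero hy)] at h1
  refine absurd h1 (not_le.mpr ((Polynomial.degree_lt_iff_coeff_zero _ _).mpr fun m hm => ?_))
  simp only [H, Polynomial.finsetSum_coeff, Polynomial.coeff_C_mul, Polynomial.coeff_X_pow]
  refine Finset.sum_eq_zero fun i hi => ?_
  rw [if_neg, mul_zero]
  have := Finset.mem_range.mp hi
  omega

/-- The elements that are fixed by a power of Frobenius generate unramified extensions. -/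
lemma mem_maxUnramified [Algebra.IsAlgebraic K L] {n : ℕ} (hn : 0 < n) {y : L}
    (hy : y ^ p ^ n = y) : y ∈ maxUnramified K L := by
  obtain ⟨N, hN⟩ := exists_isIntegralAbs K L
  have hyK : IsIntegral K y := (Algebra.IsAlgebraic.isAlgebraic y).isIntegral
  have hyk : letI := residueAlgebra p K L; IsIntegral 𝓀[K] y := by
    let _ := residueAlgebra p K L
    refine ⟨Polynomial.X ^ p ^ n - Polynomial.X, Polynomial.monic_X_pow_sub ?_, ?_⟩
    · rw [Polynomial.degree_X]
      exact_mod_cast one_lt_pow₀ (Fact.out : p.Prime).one_lt hn.ne'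
    · simp [hy]
  let E : IntermediateField K L := IntermediateField.adjoin K {y}
  have hE : E ≤ maxUnramified K L := by
    refine le_iSup₂_of_le E ⟨IntermediateField.adjoin.finiteDimensional hyK, ?_⟩ le_rfl
    have hNE := hN.comp E.val
    apply le_antisymm
    · rw [Ideal.map_le_iff_le_comap]
      intro c hc
      rw [Ideal.mem_comap, hNE.mem_intMax]
      exact hN.lt_one_iff_mem.mpr hc
    · intro z hz
      rw [hNE.mem_intMax] at hz
      change N ((z : E) : L) < 1 at hz
      by_cases hz0 : ((z : E) : L) = 0
      · rw [show z = 0 from Subtype.ext (Subtype.ext hz0)]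
        exact zero_mem _
      have hzE : ((z : E) : L) ∈ Algebra.adjoin K {y} := by
        rw [← IntermediateField.adjoin_simple_toSubalgebra_of_isAlgebraic hyK.isAlgebraic]
        exact (z : E).2
      obtain ⟨c, hc⟩ := hN.exists_eq_of_mem_adjoin hyk hzE hz0
      have hcint : ∃ e : 𝒪[K], (e : K) = c := by
        have h1 : N (algebraMap K L c) ≤ 1 := hc ▸ hz.le
        rw [hN.le_one_iff] at h1
        exact IsIntegrallyClosed.isIntegral_iff.mp
          ((isIntegral_algHom_iff (IsScalarTower.toAlgHom 𝒪[K] K L)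
            (algebraMap K L).injective).mp h1)
      obtain ⟨e, rfl⟩ := hcint
      have he : e ∈ 𝓂[K] := by
        rw [← hN.lt_one_iff_mem]
        exact hc ▸ hz
      have he0 : algebraMap K L (e : K) ≠ 0 := fun h0 => by
        rw [h0, map_zero] at hc
        exact hz0 (N.eq_zero.mp hc)
      have hc' : N ((z : E) : L) = N (algebraMap K L (e : K)) := hc
      have hw : IsIntegral 𝒪[K] ((z : E) / algebraMap K E (e : K)) := by
        rw [← hNE.le_one_iff]
        change N (((z : E) : L) / algebraMap K L (e : K)) ≤ 1
        rw [map_div₀, hc']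
        exact div_self_le_one _
      have hzw : z = algebraMap 𝒪[K] (integralClosure 𝒪[K] E) e * ⟨_, hw⟩ := by
        refine Subtype.ext (Subtype.ext ?_)
        change ((z : E) : L) = algebraMap K L (e : K) * (((z : E) : L) / algebraMap K L (e : K))
        field_simp
      rw [hzw]
      exact Ideal.mul_mem_right _ _ (Ideal.mem_map_of_mem _ he)
  exact hE (IntermediateField.mem_adjoin_simple_self K y)

/-- Automorphisms preserve the maximal ideal of the valuation ring. -/
lemma IsIntegralAbs.gal_lt_one (hN : IsIntegralAbs K N) (σ : Gal(L/K)) {x : L} (hx : N x < 1) :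
    N (σ x) < 1 := by
  have h := hN.comp (σ : L →ₐ[K] L)
  rw [← hN.mem_maxSub, h.mem_maxSub] at hx
  exact hx

/-- The inertia group acts trivially on the residue field of `L`. -/
lemma inertia_sub_lt (p : ℕ) [Fact p.Prime] [CharP K p] [CharP L p]
    [Algebra.IsAlgebraic K L] [IsAlgClosed L] (hN : IsIntegralAbs K N)
    (γ : inertia K L) {x : L} (hx : N x ≤ 1) : N ((γ : Gal(L/K)) x - x) < 1 := by
  obtain ⟨n, hn, hxn⟩ := hN.exists_pow_sub_lt (p := p) hx
  obtain ⟨y, hy, hxy⟩ := exists_root_sub_lt hn hxn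
  have hyu := mem_maxUnramified (K := K) hn hy
  have hfix : (γ : Gal(L/K)) y = y := by
    have h1 : y ∈ (perfectClosure (maxUnramified K L) L).restrictScalars K :=
      (perfectClosure (maxUnramified K L) L).algebraMap_mem ⟨y, hyu⟩
    exact (IntermediateField.mem_fixingSubgroup_iff _ _).mp γ.2 y h1
  have h2 : (γ : Gal(L/K)) x - x = (γ : Gal(L/K)) (x - y) - (x - y) := by
    rw [map_sub, hfix]
    ring
  rw [h2]
  exact hN.sub_lt (hN.gal_lt_one _ hxy) hxy

/-- Every automorphism over `K` fixes the perfection of `K`. -/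
lemma gal_perfectClosure (p : ℕ) [Fact p.Prime] [CharP K p] [CharP L p] (σ : Gal(L/K))
    (ξ : perfectClosure K L) : σ (ξ : L) = ξ := by
  have := ξ.2
  rw [mem_perfectClosure_iff_pow_mem p] at this
  obtain ⟨n, c, hc⟩ := this
  apply iterateFrobenius_inj L p n
  change (σ (ξ : L)) ^ p ^ n = (ξ : L) ^ p ^ n
  rw [← map_pow, ← hc, σ.commutes]

end

/-! ### Homomorphisms from `F / A` -/

section FracMod

variable {A : Type*} [CommRing A] [IsDomain A]

lemma exists_eq_frac (z : FracMod A) : ∃ b a : A, a ≠ 0 ∧ z = frac b a := by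
  obtain ⟨x, rfl⟩ := Submodule.Quotient.mk_surjective _ z
  obtain ⟨b, a, ha, rfl⟩ := IsFractionRing.div_surjective (A := A) x
  exact ⟨b, a, nonZeroDivisors.ne_zero ha, rfl⟩

lemma smul_frac (c b a : A) : c • frac b a = frac (c * b) a := by
  rw [frac, frac, ← Submodule.Quotient.mk_smul, Algebra.smul_def, map_mul, mul_div_assoc]

lemma frac_eq_smul (b a : A) : frac b a = b • frac 1 a := by
  rw [smul_frac, mul_one]

lemma frac_eq_frac {b a b' a' : A} (ha : a ≠ 0) (ha' : a' ≠ 0) :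
    frac b a = frac b' a' ↔ ∃ c, b * a' - b' * a = c * (a * a') := by
  have h1 : algebraMap A (FractionRing A) a ≠ 0 := by simpa using ha
  have h2 : algebraMap A (FractionRing A) a' ≠ 0 := by simpa using ha'
  rw [frac, frac, Submodule.Quotient.eq, LinearMap.mem_range]
  refine exists_congr fun c => ?_
  rw [Algebra.linearMap_apply, ← (IsFractionRing.injective A (FractionRing A)).eq_iff]
  simp only [map_sub, map_mul]
  rw [div_sub_div _ _ h1 h2, eq_div_iff (mul_ne_zero h1 h2)]
  constructor
  · intro h
    rw [h]
    ring
  · intro h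
    rw [← h]
    ring

lemma frac_add_frac {b a b' a' : A} (ha : a ≠ 0) (ha' : a' ≠ 0) :
    frac b a + frac b' a' = frac (b * a' + b' * a) (a * a') := by
  have h1 : algebraMap A (FractionRing A) a ≠ 0 := by simpa using ha
  have h2 : algebraMap A (FractionRing A) a' ≠ 0 := by simpa using ha'
  rw [frac, frac, frac, ← Submodule.Quotient.mk_add, div_add_div _ _ h1 h2]
  simp only [map_add, map_mul]
  rw [mul_comm (algebraMap A (FractionRing A) a) (algebraMap A (FractionRing A) b')]

lemma frac_mul_self {c a : A} (ha : a ≠ 0) : frac (c * a) a = 0 := by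
  have : (0 : FracMod A) = frac 0 1 := by simp [frac]
  rw [this, frac_eq_frac ha one_ne_zero]
  exact ⟨c, by ring⟩

lemma smul_frac_mul {a a' : A} (ha : a ≠ 0) (ha' : a' ≠ 0) :
    a' • frac 1 (a * a') = frac 1 a := by
  rw [smul_frac, frac_eq_frac (mul_ne_zero ha ha') ha]
  exact ⟨0, by ring⟩

variable {V : Type*} [AddCommGroup V] [Module A V]

lemma fracHom_ext {f g : FracMod A →ₗ[A] V} (h : ∀ a : A, a ≠ 0 → f (frac 1 a) = g (frac 1 a)) :
    f = g := by
  ext z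
  obtain ⟨b, a, ha, hz⟩ := exists_eq_frac (Submodule.Quotient.mk z)
  change f (Submodule.Quotient.mk z) = g (Submodule.Quotient.mk z)
  rw [hz, frac_eq_smul, map_smul, map_smul, h a ha]

/-- A homomorphism `F / A → V` is given by a compatible family of images of the classes of
`1 / a`. -/
lemma exists_fracHom (u : A → V) (hu : ∀ a a', a ≠ 0 → a' ≠ 0 → a' • u (a * a') = u a)
    (h1 : u 1 = 0) : ∃ f : FracMod A →ₗ[A] V, ∀ b a, a ≠ 0 → f (frac b a) = b • u a := by
  have hwd : ∀ b a b' a', a ≠ 0 → a' ≠ 0 → frac b a = frac b' a' → b • u a = b' • u a' := by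
    intro b a b' a' ha ha' h
    obtain ⟨c, hc⟩ := (frac_eq_frac ha ha').mp h
    rw [← sub_eq_zero, ← hu a a' ha ha', ← hu a' a ha' ha, mul_comm a' a, ← mul_smul, ← mul_smul,
      ← sub_smul, hc, mul_smul]
    have := hu 1 (a * a') one_ne_zero (mul_ne_zero ha ha')
    rw [one_mul] at this
    rw [this, h1, smul_zero]
  choose nu de hde hz using exists_eq_frac (A := A)
  have hf : ∀ b a, a ≠ 0 → nu (frac b a) • u (de (frac b a)) = b • u a := fun b a ha =>
    hwd _ _ _ _ (hde _) ha (hz _).symm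
  refine ⟨{ toFun := fun z => nu z • u (de z), map_add' := fun z z' => ?_,
            map_smul' := fun c z => ?_ }, hf⟩
  · obtain ⟨b, a, ha, rfl⟩ := exists_eq_frac z
    obtain ⟨b', a', ha', rfl⟩ := exists_eq_frac z'
    rw [frac_add_frac ha ha', hf _ _ (mul_ne_zero ha ha'), hf _ _ ha, hf _ _ ha', add_smul,
      mul_smul, mul_smul, hu a a' ha ha', mul_comm a a', hu a' a ha' ha]
  · obtain ⟨b, a, ha, rfl⟩ := exists_eq_frac z
    rw [smul_frac, hf _ _ ha, hf _ _ ha, mul_smul]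
    rfl

end FracMod

/-! ### The local Kummer pairing -/

section Basics

variable {p : ℕ} [Fact p.Prime] {K : Type*} [Field K] [ValuativeRel K] [TopologicalSpace K]
  [IsNonarchimedeanLocalField K] [CharP K p] {A : Type*} [CommRing A]
  {L : Type*} [Field L] [Algebra K L] [CharP L p]
  {N : AbsoluteValue L ℝ} (θ : A →+* Twisted p 𝒪[K])

lemma act_mk (f : Twisted p 𝒪[K]) (v : L) :
    act p 𝒪[K] (ModMax K L) f (Submodule.Quotient.mk v) =
      Submodule.Quotient.mk (act p 𝒪[K] L f v) :=
  (act_comm' (maxSub K L).mkQ.toAddMonoidHom (fun _ _ => rfl) (fun _ => rfl) f v).symm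

lemma act_mk_principal {E : Type*} [Field E] [Algebra K E] [CharP E p] (f : Twisted p 𝒪[K])
    (v : E) : act p 𝒪[K] (PrincipalParts K E) f (Submodule.Quotient.mk v) =
      Submodule.Quotient.mk (act p 𝒪[K] E f v) :=
  (act_comm' (intSub K E).mkQ.toAddMonoidHom (fun _ _ => rfl) (fun _ => rfl) f v).symm

lemma act_algHom {E : Type*} [Field E] [Algebra K E] [CharP E p] (u : E →ₐ[K] L)
    (f : Twisted p 𝒪[K]) (v : E) : u (act p 𝒪[K] E f v) = act p 𝒪[K] L f (u v) :=
  act_comm' (u : E →+ L) (fun c v => map_smul (u.restrictScalars 𝒪[K]) c v)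
    (fun v => map_pow u v p) f v

lemma act_gal (σ : Gal(L/K)) (f : Twisted p 𝒪[K]) (v : L) :
    σ (act p 𝒪[K] L f v) = act p 𝒪[K] L f (σ v) :=
  act_algHom (σ : L →ₐ[K] L) f v

lemma modMax_surjective (v : DMod θ (ModMax K L)) : ∃ x : L, v = modMax θ x := by
  obtain ⟨x, hx⟩ := Submodule.Quotient.mk_surjective _ ((DMod.of θ).symm v)
  exact ⟨x, by rw [modMax, hx, AddEquiv.apply_symm_apply]⟩

lemma modMax_add (x y : L) : modMax θ (x + y) = modMax θ x + modMax θ y := rfl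

lemma modMax_sub (x y : L) : modMax θ (x - y) = modMax θ x - modMax θ y := rfl

lemma smul_modMax (a : A) (x : L) : a • modMax θ x = modMax θ (act p 𝒪[K] L (θ a) x) :=
  congrArg (DMod.of θ) (act_mk (θ a) x)

lemma modMax_eq_zero (hN : IsIntegralAbs K N) {x : L} : modMax θ x = 0 ↔ N x < 1 := by
  rw [← hN.mem_maxSub]
  exact Submodule.Quotient.mk_eq_zero _

lemma modMax_eq (hN : IsIntegralAbs K N) {x y : L} :
    modMax θ x = modMax θ y ↔ N (x - y) < 1 := by
  rw [← sub_eq_zero, ← modMax_sub, modMax_eq_zero θ hN]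

lemma principal_surjective (v : KummerDomain L θ) : ∃ x, v = principal θ x := by
  obtain ⟨x, hx⟩ := Submodule.Quotient.mk_surjective _ ((DMod.of θ).symm v)
  exact ⟨x, by rw [principal, hx, AddEquiv.apply_symm_apply]⟩

lemma principal_add (x y : perfectClosure K L) :
    principal θ (x + y) = principal θ x + principal θ y := rfl

lemma principal_sub (x y : perfectClosure K L) :
    principal θ (x - y) = principal θ x - principal θ y := rfl

lemma smul_principal (a : A) (x : perfectClosure K L) :
    a • principal θ x = principal θ (act p 𝒪[K] (perfectClosure K L) (θ a) x) :=
  congrArg (DMod.of θ) (act_mk_principal (θ a) x)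

lemma principal_eq_zero (hN : IsIntegralAbs K N) {x : perfectClosure K L} :
    principal θ x = 0 ↔ N (x : L) ≤ 1 := by
  refine Iff.trans (Submodule.Quotient.mk_eq_zero _) ?_
  exact (hN.comp (perfectClosure K L).val).mem_intSub

lemma principal_eq (hN : IsIntegralAbs K N) {x y : perfectClosure K L} :
    principal θ x = principal θ y ↔ N ((x : L) - y) ≤ 1 := by
  rw [← sub_eq_zero, ← principal_sub, principal_eq_zero θ hN]
  rfl

variable {θ} [IsDomain A]

lemma galTate_apply (σ : Gal(L/K)) (f : Tate L θ) (z : FracMod A) :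
    galTate σ f z = DMod.of θ (galRes σ ((DMod.of θ).symm (f z))) := rfl

lemma galTate_eq_modMax {σ : Gal(L/K)} {f : Tate L θ} {z : FracMod A} {x : L}
    (h : f z = modMax θ x) : galTate σ f z = modMax θ (σ x) := by
  rw [galTate_apply, h]
  rfl

lemma continuous_tate_iff {X : Type*} [TopologicalSpace X] {u : X → Tate L θ} :
    Continuous u ↔ ∀ z, IsLocallyConstant fun x => u x z := by
  let _ : TopologicalSpace (DMod θ (ModMax K L)) := ⊥
  have : DiscreteTopology (DMod θ (ModMax K L)) := ⟨rfl⟩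
  refine continuous_induced_rng.trans (continuous_pi_iff.trans (forall_congr' fun z => ?_))
  exact (IsLocallyConstant.iff_continuous _).symm

lemma isLocallyConstant_tate_apply (z : FracMod A) :
    IsLocallyConstant fun f : Tate L θ => f z :=
  continuous_tate_iff.mp continuous_id z

end Basics

section Kummer

variable {p : ℕ} [Fact p.Prime] {K : Type*} [Field K] [ValuativeRel K] [TopologicalSpace K]
  [IsNonarchimedeanLocalField K] [CharP K p] {A : Type*} [CommRing A]
  {L : Type*} [Field L] [Algebra K L] [CharP L p] [Algebra.IsAlgebraic K L] [IsAlgClosed L]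
  {N : AbsoluteValue L ℝ} {θ : A →+* Twisted p 𝒪[K]}

lemma IsGoodDrinfeld.exists_root (hθ : IsGoodDrinfeld θ) {a : A} (ha : a ≠ 0) (ξ : L) :
    ∃ r : L, act p 𝒪[K] L (θ a) r = ξ := by
  obtain ⟨n, hn, h⟩ := hθ.leading a ha
  exact exists_act_eq hn h ξ

/-- The class `[γ(r) - r]` depends only on `θ_a(r)` modulo integral elements, because `γ` acts
trivially on the residue field. -/
lemma IsGoodDrinfeld.modMax_inertia_congr (hθ : IsGoodDrinfeld θ) (hN : IsIntegralAbs K N)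
    (γ : inertia K L) {a : A} (ha : a ≠ 0) {r r' : L}
    (h : N (act p 𝒪[K] L (θ a) r - act p 𝒪[K] L (θ a) r') ≤ 1) :
    modMax θ ((γ : Gal(L/K)) r - r) = modMax θ ((γ : Gal(L/K)) r' - r') := by
  obtain ⟨n, hn, hlead⟩ := hθ.leading a ha
  rw [← map_sub] at h
  have h2 := inertia_sub_lt p hN γ (hN.le_one_of_act hn hlead h)
  rw [modMax_eq θ hN]
  convert h2 using 2
  rw [map_sub]
  ring

lemma IsGoodDrinfeld.inertia_sub_le (hθ : IsGoodDrinfeld θ) (hN : IsIntegralAbs K N)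
    (σ : Gal(L/K)) {a : A} (ha : a ≠ 0) {r : L} {ξ : perfectClosure K L}
    (h : act p 𝒪[K] L (θ a) r = ξ) : N (σ r - r) ≤ 1 := by
  obtain ⟨n, hn, hlead⟩ := hθ.leading a ha
  refine hN.le_one_of_act hn hlead ?_
  rw [map_sub, ← act_gal, h, gal_perfectClosure p, sub_self, map_zero]
  exact zero_le_one

variable [IsDomain A]

/-- The value of the local Kummer pairing on a representative `ξ` and an element `γ` of the inertia
group. -/
lemma exists_kummerValue (hθ : IsGoodDrinfeld θ) (hN : IsIntegralAbs K N)
    (ξ : perfectClosure K L) (γ : inertia K L) :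
    ∃ f : Tate L θ, ∀ (a b : A) (r : L), a ≠ 0 → N (act p 𝒪[K] L (θ a) r - ξ) ≤ 1 →
      f (frac b a) = b • modMax θ ((γ : Gal(L/K)) r - r) := by
  classical
  have hroot : ∀ a : A, ∃ r : L, a ≠ 0 → act p 𝒪[K] L (θ a) r = ξ := fun a => by
    by_cases ha : a = 0
    · exact ⟨0, fun h => absurd ha h⟩
    · obtain ⟨r, hr⟩ := hθ.exists_root ha (ξ : L)
      exact ⟨r, fun _ => hr⟩
  choose r hr using hroot
  let u : A → DMod θ (ModMax K L) := fun a => modMax θ ((γ : Gal(L/K)) (r a) - r a)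
  have hu : ∀ a a', a ≠ 0 → a' ≠ 0 → a' • u (a * a') = u a := by
    intro a a' ha ha'
    change a' • modMax θ _ = modMax θ _
    rw [smul_modMax, map_sub, ← act_gal]
    refine hθ.modMax_inertia_congr hN γ ha ?_
    rw [← act_mul_apply, ← map_mul, hr _ (mul_ne_zero ha ha'), hr a ha, sub_self, map_zero]
    exact zero_le_one
  have hu1 : u 1 = 0 := by
    have h1 := hr 1 one_ne_zero
    rw [map_one, act_one_apply] at h1
    change modMax θ _ = 0
    rw [h1, gal_perfectClosure p, sub_self]
    rfl
  obtain ⟨f, hf⟩ := exists_fracHom u hu hu1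
  refine ⟨f, fun a b r' ha hr' => ?_⟩
  rw [hf b a ha]
  congr 1
  refine hθ.modMax_inertia_congr hN γ ha ?_
  rwa [hr a ha, N.map_sub]

/-- The local Kummer pairing on representatives. -/
def kummerValue (hθ : IsGoodDrinfeld θ) (hN : IsIntegralAbs K N)
    (ξ : perfectClosure K L) (γ : inertia K L) : Tate L θ :=
  (exists_kummerValue hθ hN ξ γ).choose

section

variable (hθ : IsGoodDrinfeld θ) (hN : IsIntegralAbs K N)

lemma kummerValue_frac_of_le {ξ : perfectClosure K L} {γ : inertia K L} {a b : A} {r : L}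
    (ha : a ≠ 0) (hr : N (act p 𝒪[K] L (θ a) r - ξ) ≤ 1) :
    kummerValue hθ hN ξ γ (frac b a) = b • modMax θ ((γ : Gal(L/K)) r - r) :=
  (exists_kummerValue hθ hN ξ γ).choose_spec a b r ha hr

lemma kummerValue_frac {ξ : perfectClosure K L} {γ : inertia K L} {a b : A} {r : L}
    (ha : a ≠ 0) (hr : act p 𝒪[K] L (θ a) r = ξ) :
    kummerValue hθ hN ξ γ (frac b a) = b • modMax θ ((γ : Gal(L/K)) r - r) :=
  kummerValue_frac_of_le hθ hN ha (by rw [hr, sub_self, map_zero]; exact zero_le_one)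

lemma kummerValue_add (ξ ξ' : perfectClosure K L) (γ : inertia K L) :
    kummerValue hθ hN (ξ + ξ') γ = kummerValue hθ hN ξ γ + kummerValue hθ hN ξ' γ := by
  refine fracHom_ext fun a ha => ?_
  obtain ⟨r, hr⟩ := hθ.exists_root ha (ξ : L)
  obtain ⟨r', hr'⟩ := hθ.exists_root ha (ξ' : L)
  have hrr : act p 𝒪[K] L (θ a) (r + r') = ((ξ + ξ' : perfectClosure K L) : L) := by
    rw [map_add, hr, hr']
    rfl
  rw [LinearMap.add_apply, kummerValue_frac hθ hN ha hr, kummerValue_frac hθ hN ha hr',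
    kummerValue_frac hθ hN ha hrr, ← smul_add, ← modMax_add, map_add]
  congr 2
  ring

lemma kummerValue_of_le_one {ξ : perfectClosure K L} (hξ : N (ξ : L) ≤ 1) (γ : inertia K L) :
    kummerValue hθ hN ξ γ = 0 := by
  refine fracHom_ext fun a ha => ?_
  rw [kummerValue_frac_of_le hθ hN (r := 0) ha (by rwa [map_zero, zero_sub, N.map_neg])]
  rw [map_zero, sub_zero, one_smul]
  rfl

lemma kummerValue_smul (c : A) (ξ : perfectClosure K L) (γ : inertia K L) :
    kummerValue hθ hN (act p 𝒪[K] (perfectClosure K L) (θ c) ξ) γ =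
      c • kummerValue hθ hN ξ γ := by
  refine fracHom_ext fun a ha => ?_
  obtain ⟨r, hr⟩ := hθ.exists_root ha (ξ : L)
  have hrc : act p 𝒪[K] L (θ a) (act p 𝒪[K] L (θ c) r) =
      (act p 𝒪[K] (perfectClosure K L) (θ c) ξ : perfectClosure K L) := by
    rw [← act_mul_apply, ← map_mul, mul_comm, map_mul, act_mul_apply, hr]
    exact (act_algHom (perfectClosure K L).val (θ c) ξ).symm
  rw [LinearMap.smul_apply, kummerValue_frac hθ hN ha hr, kummerValue_frac hθ hN ha hrc,
    one_smul, one_smul, smul_modMax, map_sub, act_gal]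

lemma kummerValue_mul (ξ : perfectClosure K L) (γ γ' : inertia K L) :
    kummerValue hθ hN ξ (γ * γ') = kummerValue hθ hN ξ γ + kummerValue hθ hN ξ γ' := by
  refine fracHom_ext fun a ha => ?_
  obtain ⟨r, hr⟩ := hθ.exists_root ha (ξ : L)
  rw [LinearMap.add_apply, kummerValue_frac hθ hN ha hr, kummerValue_frac hθ hN ha hr,
    kummerValue_frac hθ hN ha hr, ← smul_add, ← modMax_add, one_smul, one_smul, modMax_eq θ hN]
  convert inertia_sub_lt p hN γ (hθ.inertia_sub_le hN (γ' : Gal(L/K)) ha hr) using 2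
  rw [map_sub]
  change (γ : Gal(L/K)) ((γ' : Gal(L/K)) r) - r - _ = _
  ring

lemma kummerValue_conj (ξ : perfectClosure K L) (σ : Gal(L/K)) (γ γ' : inertia K L)
    (h : (γ' : Gal(L/K)) = σ * γ * σ⁻¹) :
    kummerValue hθ hN ξ γ' = galTate σ (kummerValue hθ hN ξ γ) := by
  refine fracHom_ext fun a ha => ?_
  obtain ⟨r, hr⟩ := hθ.exists_root ha (ξ : L)
  have hr' : act p 𝒪[K] L (θ a) (σ⁻¹ r) = ξ := by
    rw [← act_gal, hr, gal_perfectClosure p]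
  have hval := kummerValue_frac hθ hN (γ := γ) (b := 1) ha hr'
  rw [one_smul] at hval
  rw [kummerValue_frac hθ hN ha hr, galTate_eq_modMax hval, one_smul, h, map_sub]
  change modMax θ (σ ((γ : Gal(L/K)) (σ⁻¹ r)) - r) = modMax θ (_ - (σ * σ⁻¹) r)
  rw [mul_inv_cancel]
  rfl

lemma isLocallyConstant_kummerValue (ξ : perfectClosure K L) (z : FracMod A) :
    IsLocallyConstant fun γ : inertia K L => kummerValue hθ hN ξ γ z := by
  obtain ⟨b, a, ha, rfl⟩ := exists_eq_frac z
  obtain ⟨r, hr⟩ := hθ.exists_root ha (ξ : L)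
  rw [IsLocallyConstant.iff_exists_open]
  intro γ
  let U : Set (inertia K L) :=
    {δ | γ⁻¹ * δ ∈ ((MulAction.stabilizer Gal(L/K) r).comap (inertia K L).subtype)}
  refine ⟨U, ?_, ?_, fun δ hδ => ?_⟩
  · have h1 : IsOpen (MulAction.stabilizer Gal(L/K) r : Set Gal(L/K)) :=
      stabilizer_isOpen_of_isIntegral r
    exact (h1.preimage continuous_subtype_val).preimage (continuous_const_mul γ⁻¹)
  · change γ⁻¹ * γ ∈ (MulAction.stabilizer Gal(L/K) r).comap (inertia K L).subtype
    rw [inv_mul_cancel]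
    exact one_mem _
  · have h1 : ((γ : Gal(L/K))⁻¹ * (δ : Gal(L/K))) r = r := hδ
    have h2 : (δ : Gal(L/K)) r = (γ : Gal(L/K)) r := by
      conv_rhs => rw [← h1]
      change _ = ((γ : Gal(L/K)) * ((γ : Gal(L/K))⁻¹ * (δ : Gal(L/K)))) r
      rw [mul_inv_cancel_left]
    rw [kummerValue_frac hθ hN ha hr, kummerValue_frac hθ hN ha hr, h2]

omit [Algebra.IsAlgebraic K L] [IsAlgClosed L] in
lemma smul_tate_eq_zero (f : Tate L θ) : p • f = 0 := by
  refine LinearMap.ext fun z => ?_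
  obtain ⟨x, hx⟩ := modMax_surjective θ (f z)
  rw [LinearMap.smul_apply, hx]
  change modMax θ (p • x) = 0
  rw [nsmul_eq_mul, CharP.cast_eq_zero, zero_mul]
  rfl

/-- The Kummer homomorphism `I_K → T°_ad(θ)` of a representative `ξ`. -/
def kummerInertia (ξ : perfectClosure K L) : inertia K L →* Multiplicative (Tate L θ) where
  toFun γ := Multiplicative.ofAdd (kummerValue hθ hN ξ γ)
  map_one' := by
    have := kummerValue_mul hθ hN ξ 1 1
    rw [mul_one, left_eq_add] at this
    rw [this]
    rfl
  map_mul' γ γ' := by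
    rw [kummerValue_mul]
    rfl

lemma inertiaRel_le_ker (ξ : perfectClosure K L) :
    inertiaRel K L p ≤ (kummerInertia hθ hN ξ).ker := by
  refine Subgroup.topologicalClosure_minimal _ (sup_le ?_ ?_) ?_
  · exact Abelianization.commutator_subset_ker _
  · refine Subgroup.normalClosure_le_normal ?_
    rintro _ ⟨γ, rfl⟩
    change kummerInertia hθ hN ξ (γ ^ p) = 1
    rw [map_pow]
    exact smul_tate_eq_zero (kummerValue hθ hN ξ γ)
  · have : ((kummerInertia hθ hN ξ).ker : Set (inertia K L)) =
        ⋂ z : FracMod A, {γ | kummerValue hθ hN ξ γ z = 0} := by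
      ext γ
      rw [Set.mem_iInter]
      exact LinearMap.ext_iff
    rw [this]
    exact isClosed_iInter fun z => (isLocallyConstant_kummerValue hθ hN ξ z).isClosed_fiber 0

/-- The Kummer homomorphism `J_K → T°_ad(θ)` of a representative `ξ`. -/
def kummerHom (ξ : perfectClosure K L) : Additive (InertiaQuot K L p) →+ Tate L θ :=
  MonoidHom.toAdditiveLeft
    (QuotientGroup.lift (inertiaRel K L p) (kummerInertia hθ hN ξ) (inertiaRel_le_ker hθ hN ξ))

lemma kummerHom_mk (ξ : perfectClosure K L) (γ : inertia K L) :
    kummerHom hθ hN ξ (Additive.ofMul (γ : InertiaQuot K L p)) = kummerValue hθ hN ξ γ := rfl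

omit [Algebra.IsAlgebraic K L] [IsAlgClosed L] in
lemma inertiaHom_ext {T : Type*} [AddCommGroup T] {u v : Additive (InertiaQuot K L p) →+ T}
    (h : ∀ γ : inertia K L, u (Additive.ofMul (γ : InertiaQuot K L p)) =
      v (Additive.ofMul (γ : InertiaQuot K L p))) : u = v := by
  refine AddMonoidHom.ext fun x => ?_
  obtain ⟨γ, hγ⟩ := QuotientGroup.mk_surjective (s := inertiaRel K L p) x.toMul
  have hx : x = Additive.ofMul (γ : InertiaQuot K L p) := congrArg Additive.ofMul hγ.symm
  rw [hx, h]

lemma kummerHom_congr {ξ ξ' : perfectClosure K L} (h : principal θ ξ = principal θ ξ') :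
    kummerHom hθ hN ξ = kummerHom hθ hN ξ' := by
  refine inertiaHom_ext fun γ => ?_
  rw [kummerHom_mk, kummerHom_mk]
  have h1 : N ((ξ - ξ' : perfectClosure K L) : L) ≤ 1 := (principal_eq θ hN).mp h
  have h2 := kummerValue_add hθ hN (ξ - ξ') ξ' γ
  rw [sub_add_cancel, kummerValue_of_le_one hθ hN h1, zero_add] at h2
  exact h2

/-- The local Kummer pairing. -/
def kummerPairing : KummerDomain L θ →ₗ[A] Additive (InertiaQuot K L p) →+ Tate L θ :=
  have key : ∀ ξ, kummerHom hθ hN (principal_surjective θ (principal θ ξ)).choose =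
      kummerHom hθ hN ξ := fun ξ =>
    kummerHom_congr hθ hN (principal_surjective θ (principal θ ξ)).choose_spec.symm
  { toFun := fun z => kummerHom hθ hN (principal_surjective θ z).choose
    map_add' := fun z z' => by
      obtain ⟨ξ, rfl⟩ := principal_surjective θ z
      obtain ⟨ξ', rfl⟩ := principal_surjective θ z'
      rw [← principal_add, key, key, key]
      refine inertiaHom_ext fun γ => ?_
      rw [AddMonoidHom.add_apply, kummerHom_mk, kummerHom_mk, kummerHom_mk, kummerValue_add]
    map_smul' := fun c z => by
      obtain ⟨ξ, rfl⟩ := principal_surjective θ z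
      rw [smul_principal, key, key]
      refine inertiaHom_ext fun γ => ?_
      rw [kummerHom_mk, kummerValue_smul]
      rfl }

lemma kummerPairing_principal (ξ : perfectClosure K L) :
    kummerPairing hθ hN (principal θ ξ) = kummerHom hθ hN ξ :=
  kummerHom_congr hθ hN (principal_surjective θ (principal θ ξ)).choose_spec.symm

include hN in
lemma isKummerPairing_kummerPairing : IsKummerPairing L θ (kummerPairing hθ hN) where
  formula ξ γ a b r ha hr := by
    rw [kummerPairing_principal, kummerHom_mk, kummerValue_frac hθ hN ha hr, smul_modMax]
  continuous z := by
    obtain ⟨ξ, rfl⟩ := principal_surjective θ z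
    rw [kummerPairing_principal]
    have h1 : Continuous fun γ : inertia K L => kummerValue hθ hN ξ γ :=
      continuous_tate_iff.mpr (isLocallyConstant_kummerValue hθ hN ξ)
    have h2 : Continuous fun x : InertiaQuot K L p => kummerHom hθ hN ξ (Additive.ofMul x) :=
      continuous_quot_lift _ h1
    exact h2.comp continuous_toMul
  equivariant z σ γ γ' h := by
    obtain ⟨ξ, rfl⟩ := principal_surjective θ z
    rw [kummerPairing_principal, kummerHom_mk, kummerHom_mk]
    exact kummerValue_conj hθ hN ξ σ γ γ' h

end

lemma IsKummerPairing.apply_frac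
    {κ : KummerDomain L θ →ₗ[A] Additive (InertiaQuot K L p) →+ Tate L θ}
    (hκ : IsKummerPairing L θ κ) (ξ : perfectClosure K L) (γ : inertia K L) {a : A} (b : A)
    {r : L} (ha : a ≠ 0) (hr : act p 𝒪[K] L (θ a) r = ξ) :
    κ (principal θ ξ) (Additive.ofMul (γ : InertiaQuot K L p)) (frac b a) =
      b • modMax θ ((γ : Gal(L/K)) r - r) := by
  rw [hκ.formula ξ γ a b r ha hr, smul_modMax]

/-- The local Kummer pairing exists and is unique. -/
lemma existsUnique_kummerPairing (hθ : IsGoodDrinfeld θ) : ∃! κ, IsKummerPairing L θ κ := by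
  obtain ⟨N, hN⟩ := exists_isIntegralAbs K L
  refine ⟨kummerPairing hθ hN, isKummerPairing_kummerPairing hθ hN, fun κ hκ => ?_⟩
  refine LinearMap.ext fun z => ?_
  obtain ⟨ξ, rfl⟩ := principal_surjective θ z
  refine inertiaHom_ext fun γ => fracHom_ext fun a ha => ?_
  obtain ⟨r, hr⟩ := hθ.exists_root ha (ξ : L)
  rw [hκ.apply_frac ξ γ 1 ha hr, (isKummerPairing_kummerPairing hθ hN).apply_frac ξ γ 1 ha hr]

end Kummer

/-! ### Good reduction of the reduction and of the basic Drinfeld module -/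

section Good

variable {p : ℕ} [Fact p.Prime] {K : Type*} [Field K] [ValuativeRel K] [TopologicalSpace K]
  [IsNonarchimedeanLocalField K] [CharP K p] {A : Type*} [CommRing A]

lemma coeff_reduce (f : Twisted p 𝒪[K]) (i : ℕ) :
    (reduce f).coeff i = IsLocalRing.residue 𝒪[K] (f.coeff i) := Twisted.coeff_map _ _ _

lemma coeff_lift (f : Twisted p 𝓀[K]) (i : ℕ) : (lift f).coeff i = teich p K (f.coeff i) :=
  Twisted.coeff_map _ _ _

lemma isUnit_teich {c : 𝓀[K]} (hc : c ≠ 0) : IsUnit (teich p K c) := (IsUnit.mk0 c hc).map _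

lemma isGoodDrinfeld_overO {φ : A →+* Twisted p 𝓀[K]} (hφ : ∀ a, a ≠ 0 → φ a ≠ 0)
    (h : ∃ (a : A) (i : ℕ), 0 < i ∧ (φ a).coeff i ≠ 0) : IsGoodDrinfeld (overO φ) where
  nonconstant := by
    obtain ⟨a, i, hi, h⟩ := h
    refine ⟨a, i, hi, ?_⟩
    change (lift (φ a)).coeff i ≠ 0
    rw [coeff_lift]
    exact (isUnit_teich h).ne_zero
  leading a ha := by
    obtain ⟨n, hn, htop⟩ := Twisted.exists_top (hφ a ha)
    refine ⟨n, ?_, fun m hm => ?_⟩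
    · change IsUnit ((lift (φ a)).coeff n)
      rw [coeff_lift]
      exact isUnit_teich hn
    · change (lift (φ a)).coeff m = 0
      rw [coeff_lift, htop m hm, map_zero]

variable {ψ : A →+* Twisted p 𝒪[K]}

lemma IsGoodDrinfeld.exists_top (hψ : IsGoodDrinfeld ψ) : ∃ (a : A) (n : ℕ), a ≠ 0 ∧ 0 < n ∧
    IsUnit ((ψ a).coeff n) ∧ ∀ m > n, (ψ a).coeff m = 0 := by
  obtain ⟨a, i, hi, h⟩ := hψ.nonconstant
  have ha : a ≠ 0 := fun h0 => h (by rw [h0, map_zero, Twisted.coeff_zero])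
  obtain ⟨n, hn, htop⟩ := hψ.leading a ha
  refine ⟨a, n, ha, ?_, hn, htop⟩
  by_contra hn0
  exact h (htop i (by omega))

lemma coeff_reduction_ne_zero {a : A} {n : ℕ} (hn : IsUnit ((ψ a).coeff n)) :
    (reduction ψ a).coeff n ≠ 0 := by
  change (reduce (ψ a)).coeff n ≠ 0
  rw [coeff_reduce]
  exact (hn.map _).ne_zero

lemma IsGoodDrinfeld.reduction_ne_zero (hψ : IsGoodDrinfeld ψ) (a : A) (ha : a ≠ 0) :
    reduction ψ a ≠ 0 := by
  obtain ⟨n, hn, -⟩ := hψ.leading a ha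
  intro h
  apply coeff_reduction_ne_zero hn
  rw [h, Twisted.coeff_zero]

lemma IsGoodDrinfeld.isGoodDrinfeld_reduction (hψ : IsGoodDrinfeld ψ) :
    IsGoodDrinfeld (overO (reduction ψ)) := by
  obtain ⟨a, n, -, hn0, hn, -⟩ := hψ.exists_top
  exact isGoodDrinfeld_overO hψ.reduction_ne_zero ⟨a, n, hn0, coeff_reduction_ne_zero hn⟩

/-- The coefficient ring of a Drinfeld module of positive rank is infinite. -/
lemma IsGoodDrinfeld.infinite (hψ : IsGoodDrinfeld ψ) : Infinite A := by
  obtain ⟨a, n, -, hn0, hn, htop⟩ := hψ.exists_top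
  have key : ∀ m : ℕ, (reduction ψ (a ^ m)).coeff (m * n) ≠ 0 ∧
      ∀ i > m * n, (reduction ψ (a ^ m)).coeff i = 0 := by
    intro m
    have h1 : ∀ i > n, (reduction ψ a).coeff i = 0 := fun i hi => by
      change (reduce (ψ a)).coeff i = 0
      rw [coeff_reduce, htop i hi, map_zero]
    induction m with
    | zero =>
      rw [pow_zero, map_one, Twisted.one_eq, zero_mul]
      refine ⟨?_, fun i hi => ?_⟩
      · rw [Twisted.coeff_monomial, if_pos rfl]
        exact one_ne_zero
      · rw [Twisted.coeff_monomial, if_neg (by omega)]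
    | succ m ih =>
      rw [pow_succ, map_mul, Nat.succ_mul]
      refine ⟨?_, Twisted.coeff_mul_above ih.2 h1⟩
      rw [Twisted.coeff_mul_top ih.2 h1]
      exact mul_ne_zero ih.1 (pow_ne_zero _ (coeff_reduction_ne_zero hn))
  refine Infinite.of_injective (fun m : ℕ => a ^ m) fun m m' h => ?_
  simp only at h
  by_contra hne
  wlog hlt : m < m' generalizing m m'
  · exact this m' m h.symm (Ne.symm hne) (by omega)
  refine (key m').1 ?_
  rw [← h]
  exact (key m).2 _ (Nat.mul_lt_mul_of_pos_right hlt hn0)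

variable {d : ℕ}

lemma pos_of_natCard (hd : Nat.card 𝓀[K] = p ^ d) : 0 < d := by
  by_contra h
  rw [Nat.eq_zero_of_not_pos h, pow_zero] at hd
  exact absurd (Finite.one_lt_card (α := 𝓀[K])) (by omega)

lemma τ_pow (n : ℕ) : Twisted.τ p 𝓀[K] ^ n = Twisted.monomial p n 1 := by
  induction n with
  | zero => rfl
  | succ n ih =>
    rw [pow_succ, ih, Twisted.τ, Twisted.monomial_mul_monomial]
    simp

lemma basic_C (c : ZMod p) :
    basic p K d (Polynomial.C c) = Twisted.monomial p 0 (ZMod.castHom dvd_rfl 𝓀[K] c) := by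
  change Polynomial.eval₂ _ _ _ = _
  rw [Polynomial.eval₂_C]
  rfl

lemma basic_X : basic p K d Polynomial.X = Twisted.monomial p d 1 := by
  change Polynomial.eval₂ _ _ _ = _
  rw [Polynomial.eval₂_X, τ_pow]

lemma basic_eq_sum (b : Polynomial (ZMod p)) : basic p K d b =
    ∑ i ∈ Finset.range (b.natDegree + 1),
      Twisted.monomial p (d * i) (ZMod.castHom dvd_rfl 𝓀[K] (b.coeff i)) := by
  conv_lhs => rw [b.as_sum_range_C_mul_X_pow]
  rw [map_sum]
  refine Finset.sum_congr rfl fun i _ => ?_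
  rw [map_mul, map_pow, basic_C, basic_X, ← τ_pow, ← pow_mul, τ_pow, Twisted.monomial_mul_monomial,
    zero_add, one_pow, mul_one]

lemma coeff_basic (hd : Nat.card 𝓀[K] = p ^ d) (b : Polynomial (ZMod p)) {i : ℕ}
    (hi : i ≤ b.natDegree) :
    (basic p K d b).coeff (d * i) = ZMod.castHom dvd_rfl 𝓀[K] (b.coeff i) := by
  rw [basic_eq_sum, Twisted.coeff_sum, Finset.sum_eq_single i]
  · rw [Twisted.coeff_monomial, if_pos rfl]
  · intro j _ hj
    rw [Twisted.coeff_monomial, if_neg]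
    exact fun h => hj (Nat.eq_of_mul_eq_mul_left (pos_of_natCard hd) h)
  · intro h
    exact absurd (Finset.mem_range.mpr (by omega)) h

lemma basic_ne_zero (hd : Nat.card 𝓀[K] = p ^ d) (b : Polynomial (ZMod p)) (hb : b ≠ 0) :
    basic p K d b ≠ 0 := by
  intro h
  have h1 := coeff_basic hd b le_rfl
  rw [h, Twisted.coeff_zero, eq_comm, map_eq_zero] at h1
  exact hb (Polynomial.leadingCoeff_eq_zero.mp h1)

lemma isGoodDrinfeld_basic (hd : Nat.card 𝓀[K] = p ^ d) :
    IsGoodDrinfeld (overO (basic p K d)) := by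
  refine isGoodDrinfeld_overO (basic_ne_zero hd) ⟨Polynomial.X, d, pos_of_natCard hd, ?_⟩
  rw [basic_X, Twisted.coeff_monomial, if_pos rfl]
  exact one_ne_zero

lemma monomial_commute (hd : Nat.card 𝓀[K] = p ^ d) (n : ℕ) (c : 𝓀[K]) (b : Polynomial (ZMod p)) :
    Commute (Twisted.monomial p n c) (basic p K d b) := by
  have hX : Commute (Twisted.monomial p n c) (basic p K d Polynomial.X) := by
    have hc : c ^ p ^ d = c := by
      let _ := Fintype.ofFinite 𝓀[K]
      rw [← hd, Nat.card_eq_fintype_card, FiniteField.pow_card]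
    rw [basic_X]
    change _ * _ = _ * _
    rw [Twisted.monomial_mul_monomial, Twisted.monomial_mul_monomial, hc, one_pow, mul_one, one_mul,
      add_comm]
  induction b using Polynomial.induction_on' with
  | add f g hf hg =>
    rw [map_add]
    exact hf.add_right hg
  | monomial m e =>
    rw [← Polynomial.C_mul_X_pow_eq_monomial, map_mul, map_pow]
    refine Commute.mul_right ?_ (hX.pow_right m)
    rw [basic_C]
    change _ * _ = _ * _
    have he : ∀ k, e ^ p ^ k = e := fun k => by
      induction k with
      | zero => simp
      | succ k ih => rw [pow_succ, pow_mul, ih, ZMod.pow_card]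
    rw [Twisted.monomial_mul_monomial, Twisted.monomial_mul_monomial, ← map_pow, he, pow_zero,
      pow_one, add_comm, mul_comm]

/-- The image of `ω` is contained in the centre of `k[τ]`. -/
lemma basic_commute (hd : Nat.card 𝓀[K] = p ^ d) (f : Twisted p 𝓀[K]) (b : Polynomial (ZMod p)) :
    Commute f (basic p K d b) := by
  obtain ⟨M, hM⟩ := f.exists_bound
  rw [Twisted.eq_sum_monomial hM]
  exact Commute.sum_left _ _ _ fun i _ => monomial_commute hd _ _ _

end Good

/-! ### The reduction isomorphism of Tate modules -/

section Res

variable {p : ℕ} [Fact p.Prime] {K : Type*} [Field K] [ValuativeRel K] [TopologicalSpace K]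
  [IsNonarchimedeanLocalField K] [CharP K p] {A : Type*} [CommRing A]
  {L : Type*} [Field L] [Algebra K L] [CharP L p]
  {N : AbsoluteValue L ℝ} {ψ θ : A →+* Twisted p 𝒪[K]}

/-- On integral elements a twisted polynomial with coefficients in `𝔪_K` is small. -/
lemma IsIntegralAbs.act_lt_one (hN : IsIntegralAbs K N) {f : Twisted p 𝒪[K]}
    (hf : ∀ i, f.coeff i ∈ 𝓂[K]) {x : L} (hx : N x ≤ 1) : N (act p 𝒪[K] L f x) < 1 := by
  obtain ⟨M, hM⟩ := f.exists_bound
  rw [act_algebra_eq_sum hM]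
  refine hN.sum_lt _ _ one_pos fun i _ => ?_
  rw [map_mul, map_pow]
  exact mul_lt_one_of_nonneg_of_lt_one_left (N.nonneg _) (hN.lt_one_iff_mem.mpr (hf i))
    (pow_le_one₀ (N.nonneg _) hx)

lemma IsIntegralAbs.act_sub_lift_lt_one (hN : IsIntegralAbs K N) (f : Twisted p 𝒪[K]) {x : L}
    (hx : N x ≤ 1) : N (act p 𝒪[K] L f x - act p 𝒪[K] L (lift (reduce f)) x) < 1 := by
  rw [← act_sub_apply]
  refine hN.act_lt_one (fun i => ?_) hx
  rw [Twisted.coeff_sub, coeff_lift, coeff_reduce, ← IsLocalRing.residue_eq_zero_iff, map_sub,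
    residue_teich, sub_self]

variable [IsDomain A]

/-- The values of elements of the Tate module are integral, because they are torsion. -/
lemma IsGoodDrinfeld.exists_tate_eq (hθ : IsGoodDrinfeld θ) (hN : IsIntegralAbs K N)
    (f : Tate L θ) (z : FracMod A) : ∃ x : L, f z = modMax θ x ∧ N x ≤ 1 := by
  obtain ⟨b, a, ha, rfl⟩ := exists_eq_frac z
  obtain ⟨x, hx⟩ := modMax_surjective θ (f (frac b a))
  refine ⟨x, hx, ?_⟩
  obtain ⟨n, hn, htop⟩ := hθ.leading a ha
  refine hN.le_one_of_act hn htop ?_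
  have h1 : a • f (frac b a) = 0 := by
    rw [← map_smul, smul_frac, mul_comm, frac_mul_self ha, map_zero]
  rw [hx, smul_modMax, modMax_eq_zero θ hN] at h1
  exact h1.le

/-- The map between Tate modules that leaves the values unchanged, for homomorphisms whose actions
agree on integral elements modulo the maximal ideal. -/
def tateIdent (hθ : IsGoodDrinfeld θ) (hN : IsIntegralAbs K N)
    (h : ∀ (a : A) (x : L), N x ≤ 1 →
      N (act p 𝒪[K] L (θ a) x - act p 𝒪[K] L (ψ a) x) < 1) : Tate L θ →ₗ[A] Tate L ψ where
  toFun f :=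
    { toFun := fun z => DMod.of ψ ((DMod.of θ).symm (f z))
      map_add' := fun z z' => by simp
      map_smul' := fun a z => by
        obtain ⟨x, hx, hx1⟩ := hθ.exists_tate_eq hN f z
        rw [map_smul, hx, smul_modMax]
        change modMax ψ _ = a • modMax ψ x
        rw [smul_modMax, modMax_eq ψ hN]
        exact h a x hx1 }
  map_add' f g := rfl
  map_smul' a f := by
    refine LinearMap.ext fun z => ?_
    obtain ⟨x, hx, hx1⟩ := hθ.exists_tate_eq hN f z
    change DMod.of ψ ((DMod.of θ).symm (a • f z)) = a • DMod.of ψ ((DMod.of θ).symm (f z))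
    rw [hx, smul_modMax]
    change modMax ψ _ = a • modMax ψ x
    rw [smul_modMax, modMax_eq ψ hN]
    exact h a x hx1

/-- The reduction isomorphism exists and is unique. -/
lemma existsUnique_reductionIso [Algebra.IsAlgebraic K L] (hψ : IsGoodDrinfeld ψ) :
    ∃! res, IsReductionIso L ψ (overO (reduction ψ)) res := by
  obtain ⟨N, hN⟩ := exists_isIntegralAbs K L
  have h1 : ∀ (a : A) (x : L), N x ≤ 1 →
      N (act p 𝒪[K] L (ψ a) x - act p 𝒪[K] L (overO (reduction ψ) a) x) < 1 :=
    fun a x hx => hN.act_sub_lift_lt_one (ψ a) hx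
  have h2 : ∀ (a : A) (x : L), N x ≤ 1 →
      N (act p 𝒪[K] L (overO (reduction ψ) a) x - act p 𝒪[K] L (ψ a) x) < 1 := fun a x hx => by
    rw [N.map_sub]
    exact h1 a x hx
  let res : Tate L ψ ≃ₗ[A] Tate L (overO (reduction ψ)) :=
    LinearEquiv.ofLinearMap (tateIdent hψ hN h1)
      (tateIdent hψ.isGoodDrinfeld_reduction hN h2) rfl rfl
  refine ⟨res, ⟨fun f z => rfl, ?_, ?_, fun σ f => rfl⟩, fun res' hres' => ?_⟩
  · rw [continuous_tate_iff]
    exact fun z => (isLocallyConstant_tate_apply z).comp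
      fun v => DMod.of (overO (reduction ψ)) ((DMod.of ψ).symm v)
  · rw [continuous_tate_iff]
    exact fun z => (isLocallyConstant_tate_apply z).comp
      fun v => DMod.of ψ ((DMod.of (overO (reduction ψ))).symm v)
  · refine LinearEquiv.ext fun f => LinearMap.ext fun z => ?_
    exact (DMod.of (overO (reduction ψ))).symm.injective (hres'.formula f z)

end Res

/-! ### The comparison of Tate modules over different coefficient rings -/

section Beta

variable {p : ℕ} [Fact p.Prime] {K : Type*} [Field K] [ValuativeRel K] [TopologicalSpace K]
  [IsNonarchimedeanLocalField K] [CharP K p] {A B : Type*} [CommRing A] [CommRing B]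
  {L : Type*} [Field L] [Algebra K L] [CharP L p]
  {φ : A →+* Twisted p 𝓀[K]} {ω : B →+* Twisted p 𝓀[K]}

variable (L) in
/-- The action of `k[τ]` on `L / 𝔪_L`. -/
def resAct : Twisted p 𝓀[K] →+* AddMonoid.End (ModMax K L) :=
  (act p 𝒪[K] (ModMax K L)).comp lift

lemma resAct_mul (g h : Twisted p 𝓀[K]) (v : ModMax K L) :
    resAct L (g * h) v = resAct L g (resAct L h v) := by
  rw [map_mul]
  rfl

lemma resAct_add (g h : Twisted p 𝓀[K]) (v : ModMax K L) :
    resAct L (g + h) v = resAct L g v + resAct L h v := by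
  rw [map_add]
  rfl

lemma resAct_one (v : ModMax K L) : resAct L (1 : Twisted p 𝓀[K]) v = v := by
  rw [map_one]
  rfl

lemma resAct_galRes (σ : Gal(L/K)) (g : Twisted p 𝓀[K]) (v : ModMax K L) :
    resAct L g (galRes σ v) = galRes σ (resAct L g v) := by
  refine (act_comm (galRes σ) (fun v => ?_) (lift g) v).symm
  obtain ⟨v, rfl⟩ := Submodule.Quotient.mk_surjective _ v
  exact congrArg (Submodule.Quotient.mk (p := maxSub K L)) (map_pow σ v p)

variable [IsDomain A] [IsDomain B]

/-- The value of an element of the Tate module at the class of `1 / a`. -/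
def tval (f : Tate L (overO φ)) (a : A) : ModMax K L := (DMod.of (overO φ)).symm (f (frac 1 a))

lemma of_tval (f : Tate L (overO φ)) (a : A) : DMod.of (overO φ) (tval f a) = f (frac 1 a) := rfl

lemma smul_of_overO (a : A) (v : ModMax K L) :
    a • DMod.of (overO φ) v = DMod.of (overO φ) (resAct L (φ a) v) := rfl

lemma resAct_tval_mul (f : Tate L (overO φ)) {a a' : A} (ha : a ≠ 0) (ha' : a' ≠ 0) :
    resAct L (φ a') (tval f (a * a')) = tval f a := by
  apply (DMod.of (overO φ)).injective
  rw [← smul_of_overO, of_tval, ← map_smul, smul_frac_mul ha ha', of_tval]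

lemma resAct_tval_self (f : Tate L (overO φ)) {a : A} (ha : a ≠ 0) :
    resAct L (φ a) (tval f a) = 0 := by
  apply (DMod.of (overO φ)).injective
  have h : frac a a = 0 := by simpa using frac_mul_self (c := 1) ha
  rw [← smul_of_overO, of_tval, ← map_smul, smul_frac, mul_one, h, map_zero, map_zero]

lemma tval_add (f f' : Tate L (overO φ)) (a : A) : tval (f + f') a = tval f a + tval f' a := rfl

lemma tval_galTate (σ : Gal(L/K)) (f : Tate L (overO φ)) (a : A) :
    tval (galTate σ f) a = galRes σ (tval f a) := rfl

lemma tval_ext {f f' : Tate L (overO φ)} (h : ∀ a, a ≠ 0 → tval f a = tval f' a) : f = f' :=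
  fracHom_ext fun a ha => (DMod.of (overO φ)).symm.injective (h a ha)

/-- Let `D` be the skew field of quotients of `k[τ]`. The value at `g φ_a⁻¹` of the `k[τ]`-linear
map `D / k[τ] → L / 𝔪_L` attached to an element of the Tate module is `g` applied to its value at
`1 / a`, and it depends only on the class of `g φ_a⁻¹`. The hypotheses say that
`h g' φ_{a'}⁻¹ = h u⁻¹ = u⁻¹ h = g φ_a⁻¹ + r`. -/
lemma resAct_tval_congr {f : Tate L (overO φ)} {a a' : A} {u g g' h r : Twisted p 𝓀[K]}
    (hu : u ≠ 0) (ha : a ≠ 0) (ha' : a' ≠ 0) (h1 : φ a' = u * g') (h2 : Commute h u)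
    (h3 : h * φ a = u * (g + r * φ a)) :
    resAct L h (resAct L g' (tval f a')) = resAct L g (tval f a) := by
  have hcomm : φ a * φ a' = φ a' * φ a := by rw [← map_mul, ← map_mul, mul_comm]
  have key : h * g' * φ a = g * φ a' + r * φ (a * a') := by
    apply mul_left_cancel₀ hu
    calc u * (h * g' * φ a) = h * (u * g') * φ a := by
          rw [← mul_assoc, ← mul_assoc, ← h2.eq, mul_assoc h u g']
      _ = h * φ a * φ a' := by rw [← h1, mul_assoc, ← hcomm, mul_assoc]
      _ = u * (g * φ a' + r * φ (a * a')) := by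
        rw [h3, mul_assoc, add_mul, map_mul, mul_assoc r]
  rw [← resAct_tval_mul f ha ha', ← resAct_tval_mul f ha' ha, ← resAct_mul, ← resAct_mul,
    ← resAct_mul, key, mul_comm a' a, resAct_add, resAct_mul r,
    resAct_tval_self f (mul_ne_zero ha ha'),
    map_zero, add_zero]

/-- If every `ω_b` divides some `φ_a`, then elements of `T°_ad(φ)` are transferred to `T°_ad(ω)` by
`1 / b ↦ g(1 / a)` for `φ_a = ω_b g`. -/
lemma exists_transfer (hω : ∀ b, b ≠ 0 → ω b ≠ 0)
    (hdiv : ∀ b : B, b ≠ 0 → ∃ a : A, a ≠ 0 ∧ ∃ g, φ a = ω b * g) (f : Tate L (overO φ)) :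
    ∃ f' : Tate L (overO ω), ∀ (a : A) (b : B) (g : Twisted p 𝓀[K]), a ≠ 0 → b ≠ 0 →
      φ a = ω b * g → tval f' b = resAct L g (tval f a) := by
  classical
  have hdiv' : ∀ b : B, ∃ (a : A) (g : Twisted p 𝓀[K]), b ≠ 0 → a ≠ 0 ∧ φ a = ω b * g := fun b => by
    by_cases hb : b = 0
    · exact ⟨0, 0, fun h => absurd hb h⟩
    · obtain ⟨a, ha, g, hg⟩ := hdiv b hb
      exact ⟨a, g, fun _ => ⟨ha, hg⟩⟩
  choose a g hag using hdiv'
  have hwd : ∀ (a₁ : A) (b : B) (g₁ : Twisted p 𝓀[K]), a₁ ≠ 0 → b ≠ 0 → φ a₁ = ω b * g₁ →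
      resAct L (g b) (tval f (a b)) = resAct L g₁ (tval f a₁) := fun a₁ b g₁ ha₁ hb h => by
    have := resAct_tval_congr (f := f) (h := 1) (r := 0) (hω b hb) ha₁ (hag b hb).1 (hag b hb).2
      (Commute.one_left _) (g := g₁) (by rw [one_mul, zero_mul, add_zero, h])
    rwa [resAct_one] at this
  let u : B → DMod (overO ω) (ModMax K L) := fun b =>
    DMod.of (overO ω) (resAct L (g b) (tval f (a b)))
  have hu : ∀ b b', b ≠ 0 → b' ≠ 0 → b' • u (b * b') = u b := by
    intro b b' hb hb'
    obtain ⟨ha, hg⟩ := hag (b * b') (mul_ne_zero hb hb')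
    change b' • DMod.of (overO ω) _ = DMod.of (overO ω) _
    rw [smul_of_overO, ← resAct_mul]
    refine congrArg _ (hwd (a (b * b')) b (ω b' * g (b * b')) ha hb ?_).symm
    rw [hg, map_mul, mul_assoc]
  have hu1 : u 1 = 0 := by
    obtain ⟨ha, hg⟩ := hag 1 one_ne_zero
    rw [map_one, one_mul] at hg
    change DMod.of (overO ω) _ = 0
    rw [← hg, resAct_tval_self f ha, map_zero]
  obtain ⟨f', hf'⟩ := exists_fracHom u hu hu1
  refine ⟨f', fun a₁ b g₁ ha₁ hb h => ?_⟩
  rw [tval, hf' 1 b hb, one_smul]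
  exact hwd a₁ b g₁ ha₁ hb h

/-- The transfer of elements of the Tate module, see `exists_transfer`. -/
def transfer (hω : ∀ b, b ≠ 0 → ω b ≠ 0)
    (hdiv : ∀ b : B, b ≠ 0 → ∃ a : A, a ≠ 0 ∧ ∃ g, φ a = ω b * g) (f : Tate L (overO φ)) :
    Tate L (overO ω) :=
  (exists_transfer hω hdiv f).choose

section

variable (hφ : ∀ a, a ≠ 0 → φ a ≠ 0) (hω : ∀ b, b ≠ 0 → ω b ≠ 0)
  (hdiv : ∀ b : B, b ≠ 0 → ∃ a : A, a ≠ 0 ∧ ∃ g, φ a = ω b * g)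
  (hdiv' : ∀ a : A, a ≠ 0 → ∃ b : B, b ≠ 0 ∧ ∃ g, ω b = φ a * g)

lemma tval_transfer (f : Tate L (overO φ)) {a : A} {b : B} {g : Twisted p 𝓀[K]} (ha : a ≠ 0)
    (hb : b ≠ 0) (h : φ a = ω b * g) : tval (transfer hω hdiv f) b = resAct L g (tval f a) :=
  (exists_transfer hω hdiv f).choose_spec a b g ha hb h

include hφ in
lemma transfer_transfer (f : Tate L (overO φ)) :
    transfer hφ hdiv' (transfer hω hdiv f) = f := by
  refine tval_ext fun a ha => ?_
  obtain ⟨b, hb, g, hg⟩ := hdiv' a ha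
  obtain ⟨a', ha', g', hg'⟩ := hdiv b hb
  rw [tval_transfer hφ hdiv' _ hb ha hg, tval_transfer hω hdiv f ha' hb hg', ← resAct_mul]
  have := resAct_tval_congr (f := f) (h := 1) (r := 0) (g := 1) (g' := g * g') (hφ a ha) ha ha'
    (by rw [hg', hg, mul_assoc]) (Commute.one_left _) (by rw [one_mul, zero_mul, add_zero, mul_one])
  rwa [resAct_one, resAct_one] at this

lemma transfer_add (f f' : Tate L (overO φ)) :
    transfer hω hdiv (f + f') = transfer hω hdiv f + transfer hω hdiv f' := by
  refine tval_ext fun b hb => ?_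
  obtain ⟨a, ha, g, hg⟩ := hdiv b hb
  rw [tval_add, tval_transfer hω hdiv _ ha hb hg, tval_transfer hω hdiv _ ha hb hg,
    tval_transfer hω hdiv _ ha hb hg, tval_add, map_add]

lemma transfer_galTate (σ : Gal(L/K)) (f : Tate L (overO φ)) :
    transfer hω hdiv (galTate σ f) = galTate σ (transfer hω hdiv f) := by
  refine tval_ext fun b hb => ?_
  obtain ⟨a, ha, g, hg⟩ := hdiv b hb
  rw [tval_galTate, tval_transfer hω hdiv _ ha hb hg, tval_transfer hω hdiv _ ha hb hg,
    tval_galTate, resAct_galRes]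

lemma continuous_transfer : Continuous (transfer (L := L) hω hdiv) := by
  rw [continuous_tate_iff]
  intro z
  obtain ⟨c, b, hb, rfl⟩ := exists_eq_frac z
  obtain ⟨a, ha, g, hg⟩ := hdiv b hb
  have h1 : (fun f : Tate L (overO φ) => transfer hω hdiv f (frac c b)) =
      (fun v => c • DMod.of (overO ω) (resAct L g ((DMod.of (overO φ)).symm v))) ∘
        fun f : Tate L (overO φ) => f (frac 1 a) := by
    funext f
    rw [frac_eq_smul, map_smul, ← of_tval, tval_transfer hω hdiv f ha hb hg]
    rfl
  rw [h1]
  exact (isLocallyConstant_tate_apply _).comp _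

end

/-- The natural isomorphism of Tate modules exists and is unique if `ω` has central image. -/
lemma existsUnique_basicIso (hφ : ∀ a, a ≠ 0 → φ a ≠ 0) (hω : ∀ b, b ≠ 0 → ω b ≠ 0)
    (hcentral : ∀ g b, Commute g (ω b)) [Infinite A] [Infinite B] :
    ∃! β, IsBasicIso L φ ω β := by
  have hdiv : ∀ b : B, b ≠ 0 → ∃ a : A, a ≠ 0 ∧ ∃ g, φ a = ω b * g := fun b hb => by
    obtain ⟨a, ha, g, hg⟩ := Twisted.exists_eq_mul φ (hω b hb)
    exact ⟨a, ha, g, by rw [hg, (hcentral g b).eq]⟩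
  have hdiv' : ∀ a : A, a ≠ 0 → ∃ b : B, b ≠ 0 ∧ ∃ g, ω b = φ a * g := fun a ha => by
    obtain ⟨b, hb, g, hg⟩ := Twisted.exists_eq_mul ω (hφ a ha)
    refine ⟨b, hb, g, mul_right_cancel₀ (hφ a ha) ?_⟩
    rw [mul_assoc, ← hg, (hcentral _ _).eq]
  let β : Tate L (overO φ) ≃+ Tate L (overO ω) :=
    { toFun := transfer hω hdiv
      invFun := transfer hφ hdiv'
      left_inv := transfer_transfer hφ hω hdiv hdiv'
      right_inv := transfer_transfer hω hφ hdiv' hdiv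
      map_add' := transfer_add hω hdiv }
  refine ⟨β, ⟨?_, ?_, continuous_transfer hω hdiv, continuous_transfer hφ hdiv',
    transfer_galTate hω hdiv⟩, fun β' hβ' => ?_⟩
  · intro f a b g h r ha hb hh
    obtain ⟨a', ha', g', hg'⟩ := hdiv b hb
    change resAct L h (tval (transfer hω hdiv f) b) = resAct L g (tval f a)
    rw [tval_transfer hω hdiv f ha' hb hg']
    exact resAct_tval_congr (hω b hb) ha ha' hg' (hcentral h b) hh
  · intro a f z
    obtain ⟨c, b, hb, rfl⟩ := exists_eq_frac z
    obtain ⟨a', ha', g', hg'⟩ := hdiv b hb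
    change (DMod.of (overO ω)).symm (transfer hω hdiv (a • f) (frac c b)) =
      resAct L (φ a) ((DMod.of (overO ω)).symm (transfer hω hdiv f (frac c b)))
    have hval : ∀ f : Tate L (overO φ),
        (DMod.of (overO ω)).symm (transfer hω hdiv f (frac c b)) =
          resAct L (ω c * g') (tval f a') := fun f => by
      rw [frac_eq_smul, map_smul, ← of_tval, smul_of_overO, AddEquiv.symm_apply_apply,
        tval_transfer hω hdiv f ha' hb hg', resAct_mul]
    have hcomm : Commute (φ a) g' := by
      apply mul_left_cancel₀ (hω b hb)
      rw [← mul_assoc, ← (hcentral _ b).eq, mul_assoc, ← hg', ← mul_assoc, ← hg', ← map_mul,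
        ← map_mul, mul_comm]
    rw [hval, hval]
    change resAct L (ω c * g') (resAct L (φ a) (tval f a')) = _
    rw [← resAct_mul, ← resAct_mul, ((hcentral (φ a) c).mul_right hcomm).eq]
  · refine AddEquiv.ext fun f => tval_ext fun b hb => ?_
    obtain ⟨a, ha, g, hg⟩ := hdiv b hb
    have h1 := hβ'.formula f a b g 1 0 ha hb (by rw [one_mul, zero_mul, add_zero, hg])
    change resAct L 1 (tval (β' f) b) = resAct L g (tval f a) at h1
    rw [resAct_one] at h1
    rw [h1]
    exact (tval_transfer hω hdiv f ha hb hg).symm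

/-- The natural isomorphism of Tate modules is compatible with the local Kummer pairings: if
`φ_a = ω_b g` and `φ_a(r) = ξ`, then `ω_b(g(r)) = ξ`. -/
lemma IsBasicIso.apply_kummer [Algebra.IsAlgebraic K L] [IsAlgClosed L]
    (hφ : IsGoodDrinfeld (overO φ)) (hω : ∀ b, b ≠ 0 → ω b ≠ 0)
    (hcentral : ∀ g b, Commute g (ω b)) [Infinite A]
    {β : Tate L (overO φ) ≃+ Tate L (overO ω)} (hβ : IsBasicIso L φ ω β)
    {κφ : KummerDomain L (overO φ) →ₗ[A] Additive (InertiaQuot K L p) →+ Tate L (overO φ)}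
    {κω : KummerDomain L (overO ω) →ₗ[B] Additive (InertiaQuot K L p) →+ Tate L (overO ω)}
    (hκφ : IsKummerPairing L (overO φ) κφ) (hκω : IsKummerPairing L (overO ω) κω)
    (ξ : perfectClosure K L) (γ : inertia K L) :
    β (κφ (principal (overO φ) ξ) (Additive.ofMul (γ : InertiaQuot K L p))) =
      κω (principal (overO ω) ξ) (Additive.ofMul (γ : InertiaQuot K L p)) := by
  refine tval_ext fun b hb => ?_
  obtain ⟨a, ha, g, hg⟩ := Twisted.exists_eq_mul φ (hω b hb)
  rw [← (hcentral g b).eq.symm] at hg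
  obtain ⟨r, hr⟩ := hφ.exists_root ha (ξ : L)
  have h1 := hβ.formula (κφ (principal (overO φ) ξ) (Additive.ofMul (γ : InertiaQuot K L p)))
    a b g 1 0 ha hb (by rw [one_mul, zero_mul, add_zero, hg])
  have hr' : act p 𝒪[K] L (overO ω b) (act p 𝒪[K] L (lift g) r) = ξ := by
    rw [← act_mul_apply, ← hr]
    change act p 𝒪[K] L (lift (ω b) * lift g) r = act p 𝒪[K] L (lift (φ a)) r
    rw [hg]
    exact congrArg (fun f => act p 𝒪[K] L f r) (map_mul lift _ _).symm
  change resAct L 1 (tval _ b) = resAct L g _ at h1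
  rw [resAct_one] at h1
  rw [h1, hκφ.apply_frac ξ γ 1 ha hr, tval, hκω.apply_frac ξ γ 1 hb hr', one_smul, one_smul,
    act_gal, ← map_sub]
  exact act_mk (lift g) _

end Beta

/-! ### Twisted Laurent series with integral coefficients -/

section Series

variable {p : ℕ} [Fact p.Prime] {K : Type*} [Field K] [ValuativeRel K] [TopologicalSpace K]
  [IsNonarchimedeanLocalField K] [CharP K p]

/-- The powers of Frobenius on a perfect ring, with exponents in `ℤ`. -/
def frobZ (p : ℕ) {R : Type*} [CommRing R] [ExpChar R p] [PerfectRing R p] (n : ℤ) : R →+* R :=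
  ((frobeniusEquiv R p : RingAut R) ^ n : RingAut R)

section FrobZ

variable {R : Type*} [CommRing R] [ExpChar R p] [PerfectRing R p]

lemma frobZ_add_nat (n : ℤ) (i : ℕ) (c : R) : frobZ p (n + i) c = frobZ p n c ^ p ^ i := by
  induction i with
  | zero => simp
  | succ i ih =>
    rw [pow_succ, pow_mul, ← ih]
    change ((frobeniusEquiv R p : RingAut R) ^ (n + ((i + 1 : ℕ) : ℤ))) c =
      (((frobeniusEquiv R p : RingAut R) ^ (n + (i : ℤ))) c) ^ p
    rw [Nat.cast_succ, ← add_assoc, add_comm (n + (i : ℤ)) 1, zpow_add, zpow_one]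
    rfl

lemma frobZ_zero (c : R) : frobZ p 0 c = c := rfl

lemma frobZ_nat (i : ℕ) (c : R) : frobZ p i c = c ^ p ^ i := by
  rw [← zero_add (i : ℤ), frobZ_add_nat, frobZ_zero]

lemma frobZ_pow (n : ℤ) (i : ℕ) (c : R) : frobZ p n (c ^ p ^ i) = frobZ p (n + i) c := by
  rw [map_pow, frobZ_add_nat]

lemma frobZ_map {E : Type*} [CommRing E] [ExpChar E p] [PerfectRing E p] (h : R →+* E) (n : ℤ)
    (c : R) : frobZ p n (h c) = h (frobZ p n c) := by
  obtain ⟨i, rfl | rfl⟩ := n.eq_nat_or_neg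
  · rw [frobZ_nat, frobZ_nat, map_pow]
  · apply (iterateFrobeniusEquiv E p i).injective
    rw [iterateFrobeniusEquiv_def, iterateFrobeniusEquiv_def, ← frobZ_add_nat, ← map_pow,
      ← frobZ_add_nat, neg_add_cancel, frobZ_zero, frobZ_zero]

lemma frobZ_neg_nat (i : ℕ) (c : R) : frobZ p (-i) c = (frobeniusEquiv R p).symm^[i] c := by
  induction i generalizing c with
  | zero => rfl
  | succ i ih =>
    rw [Function.iterate_succ_apply, ← ih]
    change ((frobeniusEquiv R p : RingAut R) ^ (-((i + 1 : ℕ) : ℤ))) c =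
      ((frobeniusEquiv R p : RingAut R) ^ (-(i : ℤ))) _
    rw [Nat.cast_succ, neg_add, zpow_add, zpow_neg_one]
    rfl

end FrobZ

/-- The Teichmüller representative of `c ^ (p ^ n)` for `c ∈ k` and `n ∈ ℤ`. -/
def teichFrob (n : ℤ) : 𝓀[K] →+* 𝒪[K] := (teich p K).comp (frobZ p n)

lemma teichFrob_add_nat (n : ℤ) (i : ℕ) (c : 𝓀[K]) :
    teichFrob (p := p) (n + i) c = teichFrob (p := p) n c ^ p ^ i := by
  change teich p K _ = (teich p K _) ^ p ^ i
  rw [frobZ_add_nat, map_pow]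

lemma teichFrob_pow (n : ℤ) (i : ℕ) (c : 𝓀[K]) :
    teichFrob (p := p) n (c ^ p ^ i) = teichFrob (p := p) (n + i) c := by
  change teich p K _ = teich p K _
  rw [frobZ_pow]

lemma isUnit_teichFrob (n : ℤ) {c : 𝓀[K]} (hc : c ≠ 0) : IsUnit (teichFrob (p := p) n c) :=
  (IsUnit.mk0 c hc).map _

lemma residue_teichFrob_zero (c : 𝓀[K]) :
    IsLocalRing.residue 𝒪[K] (teichFrob (p := p) 0 c) = c :=
  residue_teich p K c

lemma frobZ_algebraMap_teich {E : Type*} [Field E] [Algebra K E] [CharP E p] [PerfectRing E p]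
    (n : ℤ) (c : 𝓀[K]) :
    frobZ p n (algebraMap 𝒪[K] E (teich p K c)) = algebraMap 𝒪[K] E (teichFrob n c) :=
  frobZ_map ((algebraMap 𝒪[K] E).comp (teich p K)) n c

variable (K) in
/-- Formal series `∑ g_m τ^m` over `m ∈ ℤ` with coefficients in `𝒪_K`. Twisted polynomials over
`𝒪_K` act from the left, and twisted polynomials over `k` from the right; no boundedness is needed
for this. -/
def IntSeries : Type _ := ℤ → 𝒪[K]

instance : AddCommGroup (IntSeries K) := inferInstanceAs (AddCommGroup (ℤ → 𝒪[K]))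

instance : Module 𝒪[K] (IntSeries K) := inferInstanceAs (Module 𝒪[K] (ℤ → 𝒪[K]))

/-- Left multiplication by `τ`. -/
instance : FrobModule p 𝒪[K] (IntSeries K) where
  frob :=
    { toFun := fun g m => g (m - 1) ^ p
      map_zero' := funext fun _ => zero_pow (Fact.out : p.Prime).ne_zero
      map_add' := fun g h => funext fun m => add_pow_char (g (m - 1)) (h (m - 1)) p }
  frob_smul c g := funext fun m => mul_pow c (g (m - 1)) p

namespace IntSeries

lemma add_apply (g h : IntSeries K) (m : ℤ) : (g + h) m = g m + h m := rfl

lemma sub_apply (g h : IntSeries K) (m : ℤ) : (g - h) m = g m - h m := rfl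

lemma sum_apply {ι : Type*} (s : Finset ι) (g : ι → IntSeries K) (m : ℤ) :
    (∑ i ∈ s, g i) m = ∑ i ∈ s, g i m :=
  Finset.sum_apply (M := fun _ : ℤ => 𝒪[K]) m s g

lemma frob_apply (g : IntSeries K) (m : ℤ) :
    (FrobModule.frob p 𝒪[K] g : IntSeries K) m = g (m - 1) ^ p := rfl

lemma frob_iterate (i : ℕ) (g : IntSeries K) (m : ℤ) :
    ((FrobModule.frob p 𝒪[K] : AddMonoid.End (IntSeries K))^[i] g) m = g (m - i) ^ p ^ i := by
  induction i generalizing m with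
  | zero => simp
  | succ i ih =>
    rw [Function.iterate_succ_apply', frob_apply, ih, ← pow_mul, ← pow_succ, Nat.cast_succ]
    congr 2
    ring

lemma act_apply {f : Twisted p 𝒪[K]} {M : ℕ} (hM : ∀ i ≥ M, f.coeff i = 0) (g : IntSeries K)
    (m : ℤ) : (act p 𝒪[K] (IntSeries K) f g) m =
      ∑ i ∈ Finset.range M, f.coeff i * g (m - i) ^ p ^ i := by
  rw [act_eq_sum hM, sum_apply]
  refine Finset.sum_congr rfl fun i _ => ?_
  rw [← frob_iterate]
  rfl

/-- The right multiplication by a twisted polynomial over `k`. -/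
def rmul (φ : Twisted p 𝓀[K]) (g : IntSeries K) : IntSeries K :=
  fun m => ∑ᶠ j : ℕ, g (m - j) * teichFrob (p := p) (m - j) (φ.coeff j)

lemma rmul_apply {φ : Twisted p 𝓀[K]} {M : ℕ} (hM : ∀ i ≥ M, φ.coeff i = 0) (g : IntSeries K)
    (m : ℤ) : rmul φ g m =
      ∑ j ∈ Finset.range M, g (m - j) * teichFrob (p := p) (m - j) (φ.coeff j) := by
  refine finsum_eq_sum_of_support_subset _ fun j hj => ?_
  rw [Finset.coe_range, Set.mem_Iio]
  by_contra h
  exact hj (by simp only [hM j (by omega), map_zero, mul_zero])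

lemma rmul_add (φ : Twisted p 𝓀[K]) (g h : IntSeries K) :
    rmul φ (g + h) = rmul φ g + rmul φ h := by
  obtain ⟨M, hM⟩ := φ.exists_bound
  funext m
  rw [add_apply, rmul_apply hM, rmul_apply hM, rmul_apply hM, ← Finset.sum_add_distrib]
  exact Finset.sum_congr rfl fun j _ => by rw [add_apply, add_mul]

lemma rmul_smul (φ : Twisted p 𝓀[K]) (c : 𝒪[K]) (g : IntSeries K) :
    rmul φ (c • g) = c • rmul φ g := by
  obtain ⟨M, hM⟩ := φ.exists_bound
  funext m
  change _ = c * rmul φ g m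
  rw [rmul_apply hM, rmul_apply hM, Finset.mul_sum]
  exact Finset.sum_congr rfl fun j _ => mul_assoc _ _ _

/-- Right multiplication as a linear map. -/
def rmulHom (φ : Twisted p 𝓀[K]) : IntSeries K →ₗ[𝒪[K]] IntSeries K where
  toFun := rmul φ
  map_add' := rmul_add φ
  map_smul' := rmul_smul φ

lemma rmul_sub (φ : Twisted p 𝓀[K]) (g h : IntSeries K) :
    rmul φ (g - h) = rmul φ g - rmul φ h :=
  map_sub (rmulHom φ) g h

lemma add_rmul (φ χ : Twisted p 𝓀[K]) (g : IntSeries K) :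
    rmul (φ + χ) g = rmul φ g + rmul χ g := by
  obtain ⟨M, hM⟩ := φ.exists_bound
  obtain ⟨M', hM'⟩ := χ.exists_bound
  have h1 : ∀ i ≥ max M M', φ.coeff i = 0 := fun i hi => hM i (le_trans (le_max_left _ _) hi)
  have h2 : ∀ i ≥ max M M', χ.coeff i = 0 := fun i hi => hM' i (le_trans (le_max_right _ _) hi)
  funext m
  rw [add_apply, rmul_apply h1, rmul_apply h2, rmul_apply (M := max M M'),
    ← Finset.sum_add_distrib]
  · exact Finset.sum_congr rfl fun j _ => by rw [Twisted.coeff_add, map_add, mul_add]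
  · intro i hi
    rw [Twisted.coeff_add, h1 i hi, h2 i hi, add_zero]

lemma rmul_monomial (n : ℕ) (c : 𝓀[K]) (g : IntSeries K) (m : ℤ) :
    rmul (Twisted.monomial p n c) g m = g (m - n) * teichFrob (p := p) (m - n) c := by
  rw [rmul_apply (M := n + 1), Finset.sum_eq_single n]
  · rw [Twisted.coeff_monomial, if_pos rfl]
  · intro j _ hj
    rw [Twisted.coeff_monomial, if_neg hj.symm, map_zero, mul_zero]
  · simp
  · intro i hi
    rw [Twisted.coeff_monomial, if_neg (by omega)]

/-- Right multiplication as an additive map in the twisted polynomial. -/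
def rmulFlip (g : IntSeries K) : Twisted p 𝓀[K] →+ IntSeries K :=
  AddMonoidHom.mk' (fun φ => rmul φ g) fun φ χ => add_rmul φ χ g

lemma rmul_mul (φ χ : Twisted p 𝓀[K]) (g : IntSeries K) :
    rmul (φ * χ) g = rmul χ (rmul φ g) := by
  have h1 : ∀ (n : ℕ) (c : 𝓀[K]), rmul (Twisted.monomial p n c * χ) g =
      rmul χ (rmul (Twisted.monomial p n c) g) := fun n c => by
    have : (rmulFlip g).comp (AddMonoidHom.mulLeft (Twisted.monomial p n c)) =
        rmulFlip (rmul (Twisted.monomial p n c) g) := by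
      refine Twisted.addHom_ext fun l e => funext fun m => ?_
      change rmul (Twisted.monomial p n c * Twisted.monomial p l e) g m =
        rmul (Twisted.monomial p l e) (rmul (Twisted.monomial p n c) g) m
      rw [Twisted.monomial_mul_monomial, rmul_monomial, rmul_monomial, rmul_monomial, map_mul,
        teichFrob_pow, mul_assoc, show m - ((n + l : ℕ) : ℤ) = m - l - n by push_cast; ring,
        sub_add_cancel]
    exact DFunLike.congr_fun this χ
  have : (rmulFlip g).comp (AddMonoidHom.mulRight χ) =
      (rmulHom χ).toAddMonoidHom.comp (rmulFlip g) :=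
    Twisted.addHom_ext fun n c => h1 n c
  exact DFunLike.congr_fun this φ

lemma act_rmul (f : Twisted p 𝒪[K]) (φ : Twisted p 𝓀[K]) (g : IntSeries K) :
    act p 𝒪[K] (IntSeries K) f (rmul φ g) = rmul φ (act p 𝒪[K] (IntSeries K) f g) := by
  refine (act_comm (rmulHom φ) (fun g => ?_) f g).symm
  obtain ⟨M, hM⟩ := φ.exists_bound
  funext m
  change rmul φ _ m = (FrobModule.frob p 𝒪[K] (rmul φ g) : IntSeries K) m
  rw [frob_apply, rmul_apply hM, rmul_apply hM, sum_pow_char]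
  refine Finset.sum_congr rfl fun j _ => ?_
  have := teichFrob_add_nat (p := p) (m - 1 - j) 1 (φ.coeff j)
  rw [pow_one] at this
  rw [frob_apply, mul_pow, ← this]
  congr 3 <;> push_cast <;> ring

/-- The difference `f g - g φ`. -/
def defect (f : Twisted p 𝒪[K]) (φ : Twisted p 𝓀[K]) (g : IntSeries K) : IntSeries K :=
  act p 𝒪[K] (IntSeries K) f g - rmul φ g

lemma defect_sub (f : Twisted p 𝒪[K]) (φ : Twisted p 𝓀[K]) (g h : IntSeries K) :
    defect f φ (g - h) = defect f φ g - defect f φ h := by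
  rw [defect, defect, defect, map_sub, rmul_sub]
  abel

lemma defect_add (f : Twisted p 𝒪[K]) (φ : Twisted p 𝓀[K]) (g h : IntSeries K) :
    defect f φ (g + h) = defect f φ g + defect f φ h := by
  rw [defect, defect, defect, map_add, rmul_add]
  abel

lemma defect_apply {f : Twisted p 𝒪[K]} {φ : Twisted p 𝓀[K]} {M : ℕ}
    (hf : ∀ i ≥ M, f.coeff i = 0) (hφ : ∀ i ≥ M, φ.coeff i = 0) (g : IntSeries K) (m : ℤ) :
    defect f φ g m = ∑ i ∈ Finset.range M, (f.coeff i * g (m - i) ^ p ^ i -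
      g (m - i) * teichFrob (p := p) (m - i) (φ.coeff i)) := by
  rw [defect, sub_apply, act_apply hf, rmul_apply hφ, Finset.sum_sub_distrib]

lemma defect_eq_zero_of {f : Twisted p 𝒪[K]} {φ : Twisted p 𝓀[K]} {M : ℕ}
    (hf : ∀ i ≥ M, f.coeff i = 0) (hφ : ∀ i ≥ M, φ.coeff i = 0) {g : IntSeries K} {m : ℤ}
    (hg : ∀ j > m - M, g j = 0) : defect f φ g m = 0 := by
  rw [defect_apply hf hφ]
  refine Finset.sum_eq_zero fun i hi => ?_
  have := Finset.mem_range.mp hi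
  rw [hg (m - i) (by omega), zero_pow (pow_pos (Fact.out : p.Prime).pos _).ne', mul_zero, zero_mul,
    sub_zero]

/-- The top coefficient of `f g - g φ`. -/
lemma defect_top {f : Twisted p 𝒪[K]} {φ : Twisted p 𝓀[K]} {r : ℕ}
    (hf : ∀ i > r, f.coeff i = 0) (hφ : ∀ i > r, φ.coeff i = 0) {g : IntSeries K} {l : ℤ}
    (hg : ∀ j > l, g j = 0) : defect f φ g (l + r) =
      f.coeff r * g l ^ p ^ r - g l * teichFrob (p := p) l (φ.coeff r) := by
  rw [defect_apply (M := r + 1) (fun i hi => hf i (by omega)) (fun i hi => hφ i (by omega)),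
    Finset.sum_range_succ, Finset.sum_eq_zero, zero_add]
  · simp
  · intro i hi
    have := Finset.mem_range.mp hi
    rw [hg (l + r - i) (by omega), zero_pow (pow_pos (Fact.out : p.Prime).pos _).ne', mul_zero,
      zero_mul, sub_zero]

/-- The series with a single term `z τ^l`. -/
def single (l : ℤ) (z : 𝒪[K]) : IntSeries K := fun j => if j = l then z else 0

lemma single_apply (l : ℤ) (z : 𝒪[K]) (j : ℤ) : single l z j = if j = l then z else 0 := rfl

/-- If `g` is congruent to `1` modulo `𝔪_K`, then `f g` is congruent to `g f̄`. -/
lemma defect_mem (f : Twisted p 𝒪[K]) {g : IntSeries K}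
    (hg : ∀ j, g j - single 0 1 j ∈ 𝓂[K]) (m : ℤ) : defect f (reduce f) g m ∈ 𝓂[K] := by
  obtain ⟨M, hM⟩ := f.exists_bound
  have hM' : ∀ i ≥ M, (reduce f).coeff i = 0 := fun i hi => by
    rw [coeff_reduce, hM i hi, map_zero]
  rw [← sub_add_cancel g (single 0 1), defect_add, add_apply]
  refine add_mem ?_ ?_
  · rw [defect_apply hM hM']
    refine sum_mem fun i _ => sub_mem ?_ ?_
    · exact Ideal.mul_mem_left _ _ (Ideal.pow_mem_of_mem _ (hg _) _
        (pow_pos (Fact.out : p.Prime).pos _))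
    · exact Ideal.mul_mem_right _ _ (hg _)
  · rw [defect_apply hM hM']
    refine sum_mem fun i _ => ?_
    rw [single_apply]
    split_ifs with h
    · rw [h, one_pow, mul_one, one_mul, ← IsLocalRing.residue_eq_zero_iff, map_sub, coeff_reduce]
      rw [residue_teichFrob_zero, sub_self]
    · rw [zero_pow (pow_pos (Fact.out : p.Prime).pos _).ne', mul_zero, zero_mul, sub_zero]
      exact zero_mem _

/-- The equation `f z = z f̄` with `f` of positive degree and unit leading coefficient has only the
zero solution among the series that vanish in large degrees and are congruent to `0`: the leading
coefficient `c` of a solution satisfies `u c ^ (p ^ r) = v c` with units `u`, `v`. -/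
lemma eq_zero_of_defect_eq_zero {f : Twisted p 𝒪[K]} {r : ℕ} (hr : 0 < r)
    (hu : IsUnit (f.coeff r)) (hf : ∀ i > r, f.coeff i = 0) {z : IntSeries K}
    (hz : ∀ j, z j ∈ 𝓂[K]) (hbound : ∃ M : ℕ, ∀ j : ℤ, j > M → z j = 0)
    (h : defect f (reduce f) z = 0) : z = 0 := by
  obtain ⟨M, hM⟩ := hbound
  have hφ : ∀ i > r, (reduce f).coeff i = 0 := fun i hi => by
    rw [coeff_reduce, hf i hi, map_zero]
  have key : ∀ n : ℕ, ∀ j : ℤ, j > M - n → z j = 0 := by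
    intro n
    induction n with
    | zero => simpa using hM
    | succ n ih =>
      intro j hj
      by_cases hjn : j > M - n
      · exact ih j hjn
      have hj' : j = M - n := by
        push_cast at hj
        omega
      have h1 := defect_top (l := j) hf hφ (g := z) fun i hi => ih i (by omega)
      rw [h] at h1
      have h2 : z j * (f.coeff r * z j ^ (p ^ r - 1) -
          teichFrob (p := p) j ((reduce f).coeff r)) = 0 := by
        have hp : z j ^ p ^ r = z j * z j ^ (p ^ r - 1) := by
          rw [← pow_succ', Nat.sub_add_cancel (pow_pos (Fact.out : p.Prime).pos _)]
        rw [mul_sub, mul_left_comm, ← hp]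
        exact h1.symm
      rcases mul_eq_zero.mp h2 with h3 | h3
      · exact h3
      · exfalso
        have h4 : teichFrob (p := p) j ((reduce f).coeff r) ∈ 𝓂[K] := by
          rw [← sub_eq_zero.mp h3]
          refine Ideal.mul_mem_left _ _ (Ideal.pow_mem_of_mem _ (hz j) _ ?_)
          have := one_lt_pow₀ (Fact.out : p.Prime).one_lt hr.ne'
          omega
        refine h4 (isUnit_teichFrob j ?_)
        rw [coeff_reduce]
        exact (hu.map _).ne_zero
  funext j
  exact key (M - j + 1).toNat j (by omega)

end IntSeries

end Series

/-! ### The intertwining series -/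

/-- Recursive construction of a sequence whose `n`-th term depends on the earlier ones. -/
lemma exists_seq {α : Type*} [Zero α] (P : ℕ → (ℕ → α) → α → Prop) (h : ∀ n s, ∃ z, P n s z) :
    ∃ x : ℕ → α, ∀ n, P n (fun i => if i < n then x i else 0) (x n) := by
  choose F hF using h
  let s : ℕ → ℕ → α := fun n =>
    Nat.rec (fun _ => 0) (fun n t => Function.update t n (F n t)) n
  have hs : ∀ n, s (n + 1) = Function.update (s n) n (F n (s n)) := fun n => rfl
  have hx : ∀ n, s (n + 1) n = F n (s n) := fun n => by rw [hs, Function.update_self]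
  have key : ∀ n, (fun i => if i < n then s (i + 1) i else 0) = s n := by
    intro n
    induction n with
    | zero => rfl
    | succ n ih =>
      funext i
      change _ = Function.update (s n) n (F n (s n)) i
      by_cases hi : i = n
      · rw [hi, Function.update_self, if_pos n.lt_succ_self, hx]
      · rw [Function.update_of_ne hi, ← ih]
        simp only [show i < n + 1 ↔ i < n by omega]
  refine ⟨fun n => s (n + 1) n, fun n => ?_⟩
  rw [key]
  change P n (s n) (s (n + 1) n)
  rw [hx]
  exact hF n _

section Intertwiner

variable {p : ℕ} [Fact p.Prime] {K : Type*} [Field K] [ValuativeRel K] [TopologicalSpace K]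
  [IsNonarchimedeanLocalField K] [CharP K p]

/-- Hensel's lemma for `v X ^ q - u X + c` with units `u`, `v` and `q` a power of `p`. -/
lemma exists_hensel {r : ℕ} (hr : 0 < r) {u v c a : 𝒪[K]} (hu : IsUnit u) (hv : IsUnit v)
    (h : v * a ^ p ^ r - a * u + c ∈ 𝓂[K]) :
    ∃ y : 𝒪[K], v * y ^ p ^ r - y * u + c = 0 ∧ y - a ∈ 𝓂[K] := by
  let _ := IsTopologicalAddGroup.rightUniformSpace K
  have _ := isUniformAddGroup_of_addCommGroup (G := K)
  obtain ⟨w, rfl⟩ := hv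
  have hq : 1 < p ^ r := one_lt_pow₀ (Fact.out : p.Prime).one_lt hr.ne'
  have hq0 : ((p ^ r : ℕ) : 𝒪[K]) = 0 := by
    rw [Nat.cast_pow, CharP.cast_eq_zero, zero_pow hr.ne']
  set b : 𝒪[K] := (↑w⁻¹ : 𝒪[K]) * u with hb
  set e : 𝒪[K] := -((↑w⁻¹ : 𝒪[K]) * c) with he
  have hscale : ∀ y : 𝒪[K], y ^ p ^ r - (b * y + e) = ↑w⁻¹ * (w * y ^ p ^ r - y * u + c) :=
    fun y => by
      have hw : (↑w⁻¹ : 𝒪[K]) * w = 1 := w.inv_mul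
      rw [mul_add, mul_sub, ← mul_assoc, hw, hb, he]
      ring
  obtain ⟨y, hy, hya⟩ := HenselianRing.is_henselian (R := 𝒪[K]) (I := 𝓂[K])
    (Polynomial.X ^ p ^ r - (Polynomial.C b * Polynomial.X + Polynomial.C e))
    (Polynomial.monic_X_pow_sub (Polynomial.degree_linear_le.trans_lt (by exact_mod_cast hq))) a
    (by
      have : Polynomial.eval a (Polynomial.X ^ p ^ r -
          (Polynomial.C b * Polynomial.X + Polynomial.C e)) = a ^ p ^ r - (b * a + e) := by simp
      rw [this, hscale]
      exact Ideal.mul_mem_left _ _ h)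
    (by
      rw [Polynomial.derivative_sub, Polynomial.derivative_X_pow, hq0]
      have : IsUnit (-b) := (w⁻¹.isUnit.mul hu).neg
      simpa using this.map (Ideal.Quotient.mk 𝓂[K]))
  refine ⟨y, ?_, hya⟩
  have h1 : y ^ p ^ r - (b * y + e) = 0 := by simpa using hy
  rw [hscale] at h1
  exact (Units.mul_right_eq_zero w⁻¹).mp h1

namespace IntSeries

/-- The series `∑ x_n τ^{-n}`. -/
def ofNeg (x : ℕ → 𝒪[K]) : IntSeries K := fun j => if j ≤ 0 then x (-j).toNat else 0

lemma ofNeg_neg (x : ℕ → 𝒪[K]) (n : ℕ) : ofNeg x (-n) = x n := by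
  simp [ofNeg]

lemma ofNeg_pos (x : ℕ → 𝒪[K]) {j : ℤ} (hj : 0 < j) : ofNeg x j = 0 := by
  rw [ofNeg, if_neg (by omega)]

/-- The congruence `x ≡ 1` modulo `𝔪_K`. -/
lemma ofNeg_sub_single_mem {x : ℕ → 𝒪[K]} (h0 : x 0 - 1 ∈ 𝓂[K]) (h : ∀ n, 0 < n → x n ∈ 𝓂[K])
    (j : ℤ) : ofNeg x j - single 0 1 j ∈ 𝓂[K] := by
  rcases lt_trichotomy j 0 with hj | rfl | hj
  · obtain ⟨n, rfl⟩ : ∃ n : ℕ, j = -n := ⟨(-j).toNat, by omega⟩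
    rw [ofNeg_neg, single_apply, if_neg hj.ne, sub_zero]
    exact h n (by omega)
  · rw [single_apply, if_pos rfl]
    exact h0
  · rw [ofNeg_pos x hj, single_apply, if_neg hj.ne', sub_zero]
    exact zero_mem _

/-- The equation `f x = x f̄` has a solution `x = ∑_{n ≥ 0} x_n τ^{-n}` with `x ≡ 1`, if `f` has
positive degree and unit leading coefficient: the coefficients are determined successively by
Hensel's lemma. -/
lemma exists_defect_eq_zero {f : Twisted p 𝒪[K]} {r : ℕ} (hr : 0 < r)
    (hu : IsUnit (f.coeff r)) (hf : ∀ i > r, f.coeff i = 0) :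
    ∃ x : ℕ → 𝒪[K], x 0 - 1 ∈ 𝓂[K] ∧ (∀ n, 0 < n → x n ∈ 𝓂[K]) ∧
      defect f (reduce f) (ofNeg x) = 0 := by
  have hφ : ∀ i > r, (reduce f).coeff i = 0 := fun i hi => by
    rw [coeff_reduce, hf i hi, map_zero]
  have hφr : (reduce f).coeff r ≠ 0 := by
    rw [coeff_reduce]
    exact (hu.map _).ne_zero
  let start : ℕ → 𝒪[K] := fun n => if n = 0 then 1 else 0
  have hstep : ∀ (n : ℕ) (z : 𝒪[K]), defect f (reduce f) (single (-n) z) (-n + r) =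
      f.coeff r * z ^ p ^ r - z * teichFrob (p := p) (-n) ((reduce f).coeff r) := fun n z => by
    rw [defect_top hf hφ]
    · rw [single_apply, if_pos rfl]
    · intro j hj
      rw [single_apply, if_neg (by omega)]
  obtain ⟨x, hx⟩ := exists_seq (fun (n : ℕ) (s : ℕ → 𝒪[K]) (z : 𝒪[K]) =>
      (∀ i, (if i < n then s i else 0) - (if i < n then start i else 0) ∈ 𝓂[K]) →
        z - start n ∈ 𝓂[K] ∧ defect f (reduce f)
          (ofNeg (fun i => if i < n then s i else 0) + single (-n) z) (-n + r) = 0) (by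
    intro n s
    by_cases hs : ∀ i, (if i < n then s i else 0) - (if i < n then start i else 0) ∈ 𝓂[K]
    swap
    · exact ⟨0, fun h => absurd h hs⟩
    set t : ℕ → 𝒪[K] := fun i => if i < n then s i else 0 with ht
    have hmem := defect_mem f (g := ofNeg t + single (-n) (start n)) (fun j => by
      rw [add_apply]
      rcases lt_or_ge 0 j with hj | hj
      · rw [ofNeg_pos t hj, single_apply, single_apply, if_neg (by omega), if_neg (by omega)]
        simp
      obtain ⟨m, rfl⟩ : ∃ m : ℕ, j = -m := ⟨(-j).toNat, by omega⟩
      have h1 := hs m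
      rw [ofNeg_neg, single_apply, single_apply]
      change t m - _ ∈ _ at h1
      have hneg : ∀ i : ℕ, ((-m : ℤ) = -i) ↔ m = i := fun i => by omega
      simp only [show ((-(m : ℤ) = 0) ↔ m = 0) by omega, hneg]
      by_cases hmn : m = n
      · subst hmn
        have : t m = 0 := by simp [ht]
        rw [this, if_pos rfl]
        simp [start]
      · rw [if_neg hmn, add_zero]
        by_cases hlt : m < n
        · rwa [if_pos hlt] at h1
        · rw [if_neg hlt, sub_zero] at h1
          rwa [if_neg (by omega), sub_zero]) (-n + r)
    rw [defect_add, add_apply, hstep, add_comm] at hmem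
    obtain ⟨y, hy, hys⟩ := exists_hensel hr (isUnit_teichFrob (-(n : ℤ)) hφr) hu hmem
    refine ⟨y, fun _ => ⟨hys, ?_⟩⟩
    rw [defect_add, add_apply, hstep, add_comm]
    exact hy)
  have hgood : ∀ n, x n - start n ∈ 𝓂[K] := by
    intro n
    induction n using Nat.strong_induction_on with
    | _ n ih =>
      refine (hx n fun i => ?_).1
      by_cases hi : i < n
      · simpa only [if_pos hi] using ih i hi
      · simp [hi]
  refine ⟨x, hgood 0, fun n hn => ?_, ?_⟩
  · have := hgood n
    rwa [show start n = 0 from if_neg hn.ne', sub_zero] at this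
  funext m
  change defect f (reduce f) (ofNeg x) m = 0
  rcases lt_or_ge (r : ℤ) m with hm | hm
  · refine defect_eq_zero_of (M := r + 1) (fun i hi => hf i (by omega))
      (fun i hi => hφ i (by omega)) fun j hj => ofNeg_pos x ?_
    push_cast at hj
    omega
  · obtain ⟨n, rfl⟩ : ∃ n : ℕ, m = -n + r := ⟨(r - m).toNat, by omega⟩
    have h1 := (hx n fun i => by
      by_cases hi : i < n
      · simpa only [if_pos hi] using hgood i
      · simp [hi]).2
    rw [← h1, ← sub_eq_zero, ← sub_apply, ← defect_sub]
    refine defect_eq_zero_of (M := r + 1) (fun i hi => hf i (by omega))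
      (fun i hi => hφ i (by omega)) fun j hj => ?_
    push_cast at hj
    rw [sub_apply, add_apply, sub_eq_zero]
    rcases lt_or_ge 0 j with hj0 | hj0
    · rw [ofNeg_pos _ hj0, ofNeg_pos _ hj0, single_apply, if_neg (by omega), add_zero]
    · obtain ⟨i, rfl⟩ : ∃ i : ℕ, j = -i := ⟨(-j).toNat, by omega⟩
      rw [ofNeg_neg, ofNeg_neg, single_apply]
      by_cases hin : i = n
      · rw [hin]
        simp
      · rw [if_neg (show ¬(-(i : ℤ) = -n) by omega), add_zero]
        simp only [show i < n by omega, if_true]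

/-- A solution of `f x = x f̄` is a solution of `g x = x ḡ` for all `g` that commute with `f`. -/
lemma defect_eq_zero_of_commute {f g : Twisted p 𝒪[K]} (hfg : Commute f g) {r : ℕ} (hr : 0 < r)
    (hu : IsUnit (f.coeff r)) (hf : ∀ i > r, f.coeff i = 0) {x : ℕ → 𝒪[K]}
    (h0 : x 0 - 1 ∈ 𝓂[K]) (hpos : ∀ n, 0 < n → x n ∈ 𝓂[K])
    (hx : defect f (reduce f) (ofNeg x) = 0) : defect g (reduce g) (ofNeg x) = 0 := by
  refine eq_zero_of_defect_eq_zero hr hu hf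
    (defect_mem g (ofNeg_sub_single_mem h0 hpos)) ?_ ?_
  · obtain ⟨M, hM⟩ := g.exists_bound
    refine ⟨M, fun j hj => defect_eq_zero_of hM
      (fun i hi => by rw [coeff_reduce, hM i hi, map_zero]) fun i hi => ofNeg_pos x (by omega)⟩
  · have hx' := sub_eq_zero.mp hx
    rw [defect, defect, map_sub, rmul_sub, act_rmul, ← act_mul_apply, hfg.eq, act_mul_apply, hx',
      act_rmul, ← rmul_mul, ← rmul_mul, ← map_mul, ← map_mul, hfg.eq, sub_self]

lemma algebraMap_act_ofNeg {E : Type*} [Field E] [Algebra K E] [CharP E p] [PerfectRing E p]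
    (f : Twisted p 𝒪[K]) (x : ℕ → 𝒪[K]) (m : ℤ) :
    laurentMul p (polySeries E f) (negSeries E x) m =
      algebraMap 𝒪[K] E (act p 𝒪[K] (IntSeries K) f (ofNeg x) m) := by
  obtain ⟨M, hM⟩ := f.exists_bound
  have hneg : ∀ j, negSeries E x j = algebraMap 𝒪[K] E (ofNeg x j) := fun j => by
    rw [negSeries, ofNeg]
    split_ifs <;> simp
  rw [act_apply hM, map_sum, laurentMul,
    finsum_eq_sum_of_support_subset (s := (Finset.range M).map Nat.castEmbedding)]
  · rw [Finset.sum_map]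
    refine Finset.sum_congr rfl fun i _ => ?_
    change polySeries E f i * frobZ p (i : ℤ) (negSeries E x (m - i)) = _
    rw [frobZ_nat, hneg, polySeries, if_pos (by omega), Int.toNat_natCast, map_mul, map_pow]
  · intro j hj
    by_contra h
    apply hj
    have : polySeries E f j = 0 := by
      rw [polySeries]
      split_ifs with hj0
      · obtain ⟨i, rfl⟩ := Int.eq_ofNat_of_zero_le hj0
        rw [Int.toNat_natCast, hM, map_zero]
        by_contra hi
        exact h (by simpa using hi)
      · rfl
    simp only [this, zero_mul]

lemma algebraMap_rmul_ofNeg {E : Type*} [Field E] [Algebra K E] [CharP E p] [PerfectRing E p]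
    (φ : Twisted p 𝓀[K]) (x : ℕ → 𝒪[K]) (m : ℤ) :
    laurentMul p (negSeries E x) (polySeries E (lift φ)) m =
      algebraMap 𝒪[K] E (rmul φ (ofNeg x) m) := by
  obtain ⟨M, hM⟩ := φ.exists_bound
  have hneg : ∀ j, negSeries E x j = algebraMap 𝒪[K] E (ofNeg x j) := fun j => by
    rw [negSeries, ofNeg]
    split_ifs <;> simp
  let e : ℕ ↪ ℤ := ⟨fun j => m - j, fun i j h => by
    have : m - (i : ℤ) = m - j := h
    omega⟩
  rw [rmul_apply hM, map_sum, laurentMul,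
    finsum_eq_sum_of_support_subset (s := (Finset.range M).map e)]
  · rw [Finset.sum_map]
    refine Finset.sum_congr rfl fun i _ => ?_
    change negSeries E x (m - i) * frobZ p (m - i) (polySeries E (lift φ) (m - (m - i))) = _
    rw [sub_sub_cancel, hneg, polySeries, if_pos (by omega), Int.toNat_natCast, coeff_lift,
      frobZ_algebraMap_teich, map_mul]
  · intro j hj
    by_contra h
    apply hj
    have : polySeries E (lift φ) (m - j) = 0 := by
      rw [polySeries]
      split_ifs with hj0
      · obtain ⟨i, hi⟩ := Int.eq_ofNat_of_zero_le hj0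
        rw [hi, Int.toNat_natCast, coeff_lift, hM, map_zero, map_zero]
        by_contra hiM
        refine h ?_
        rw [Finset.coe_map]
        refine ⟨i, by simpa using hiM, ?_⟩
        change m - (i : ℤ) = j
        omega
      · rfl
    simp only [this, map_zero, mul_zero]

end IntSeries

open IntSeries

variable {A : Type*} [CommRing A] {ψ : A →+* Twisted p 𝒪[K]}
  {E : Type*} [Field E] [Algebra K E] [CharP E p] [PerfectRing E p]

lemma comm_iff_defect (f : Twisted p 𝒪[K]) (x : ℕ → 𝒪[K]) :
    laurentMul p (polySeries E f) (negSeries E x) =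
      laurentMul p (negSeries E x) (polySeries E (lift (reduce f))) ↔
    defect f (reduce f) (ofNeg x) = 0 := by
  have hinj : Function.Injective (algebraMap 𝒪[K] E) := by
    rw [IsScalarTower.algebraMap_eq 𝒪[K] K E]
    exact (algebraMap K E).injective.comp Subtype.val_injective
  rw [defect, sub_eq_zero]
  constructor
  · intro h
    funext m
    apply hinj
    rw [← algebraMap_act_ofNeg, ← algebraMap_rmul_ofNeg, h]
  · intro h
    funext m
    rw [algebraMap_act_ofNeg, algebraMap_rmul_ofNeg, h]

lemma IsIntertwiner.defect_eq_zero {x : ℕ → 𝒪[K]}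
    (hx : IsIntertwiner E ψ (overO (reduction ψ)) x) (a : A) :
    defect (ψ a) (reduction ψ a) (ofNeg x) = 0 :=
  (comm_iff_defect (E := E) (ψ a) x).mp (hx.comm a)

/-- The intertwining series exists and is unique. -/
lemma existsUnique_intertwiner (hψ : IsGoodDrinfeld ψ) :
    ∃! x, IsIntertwiner E ψ (overO (reduction ψ)) x := by
  obtain ⟨a, r, -, hr, hu, hf⟩ := hψ.exists_top
  obtain ⟨x, h0, hpos, hx⟩ := exists_defect_eq_zero hr hu hf
  refine ⟨x, ⟨h0, hpos, fun b => ?_⟩, fun y hy => ?_⟩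
  · exact (comm_iff_defect (ψ b) x).mpr
      (defect_eq_zero_of_commute ((Commute.all a b).map ψ) hr hu hf h0 hpos hx)
  · have hz : ofNeg y - ofNeg x = 0 := by
      refine eq_zero_of_defect_eq_zero hr hu hf (fun j => ?_) ⟨0, fun j hj => ?_⟩ ?_
      · have h1 := sub_mem (ofNeg_sub_single_mem hy.zero hy.pos j) (ofNeg_sub_single_mem h0 hpos j)
        rwa [sub_sub_sub_cancel_right] at h1
      · rw [IntSeries.sub_apply, ofNeg_pos _ (by simpa using hj),
          ofNeg_pos _ (by simpa using hj), sub_zero]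
      · rw [defect_sub, hx, sub_zero]
        exact hy.defect_eq_zero a
    funext n
    rw [← ofNeg_neg y, ← ofNeg_neg x, sub_eq_zero.mp hz]

end Intertwiner

/-! ### The isomorphism `χ` and the comparison of the pairings of `ψ` and its reduction -/

section Chi

variable {p : ℕ} [Fact p.Prime] {K : Type*} [Field K] [ValuativeRel K] [TopologicalSpace K]
  [IsNonarchimedeanLocalField K] [CharP K p]

open IntSeries

section PartialSum

variable {E : Type*} [Field E] [Algebra K E] [CharP E p] [PerfectRing E p]

/-- The partial sum `∑_{n < M} x_n η^{p^{-n}}` of `x(η)`. -/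
def partialSum (p : ℕ) [Fact p.Prime] [CharP E p] [PerfectRing E p] (x : ℕ → 𝒪[K]) (M : ℕ) :
    E →+ E where
  toFun η := ∑ n ∈ Finset.range M, algebraMap 𝒪[K] E (x n) * frobZ p (-n) η
  map_zero' := Finset.sum_eq_zero fun n _ => by rw [map_zero, mul_zero]
  map_add' η η' := by
    rw [← Finset.sum_add_distrib]
    exact Finset.sum_congr rfl fun n _ => by rw [map_add, mul_add]

lemma partialSum_apply (x : ℕ → 𝒪[K]) (M : ℕ) (η : E) :
    partialSum p x M η = ∑ n ∈ Finset.range M, algebraMap 𝒪[K] E (x n) * frobZ p (-n) η := rfl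

lemma map_partialSum {E' : Type*} [Field E'] [Algebra K E'] [CharP E' p] [PerfectRing E' p]
    (u : E →ₐ[K] E') (x : ℕ → 𝒪[K]) (M : ℕ) (η : E) :
    u (partialSum p x M η) = partialSum p x M (u η) := by
  rw [partialSum_apply, partialSum_apply, map_sum]
  refine Finset.sum_congr rfl fun n _ => ?_
  rw [map_mul]
  exact congrArg₂ (· * ·) ((u.restrictScalars 𝒪[K]).commutes (x n))
    (frobZ_map (u : E →+* E') (-n) η).symm

/-- The failure of the partial sums to intertwine `f` and `φ`, in terms of the truncated series. -/
lemma act_partialSum_sub {f : Twisted p 𝒪[K]} {φ : Twisted p 𝓀[K]} {D : ℕ}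
    (hf : ∀ i ≥ D, f.coeff i = 0) (hφ : ∀ i ≥ D, φ.coeff i = 0) (x : ℕ → 𝒪[K]) (M : ℕ) (η : E) :
    act p 𝒪[K] E f (partialSum p x M η) - partialSum p x M (act p 𝒪[K] E (lift φ) η) =
      ∑ m ∈ Finset.Ico (-M : ℤ) D, algebraMap 𝒪[K] E
        (defect f φ (ofNeg fun n => if n < M then x n else 0) m) * frobZ p m η := by
  set g : IntSeries K := ofNeg fun n => if n < M then x n else 0 with hg
  have hgn : ∀ n < M, g (-n) = x n := fun n hn => by rw [hg, ofNeg_neg, if_pos hn]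
  have hlift : ∀ i ≥ D, (lift φ).coeff i = 0 := fun i hi => by
    rw [coeff_lift, hφ i hi, map_zero]
  have hleft : act p 𝒪[K] E f (partialSum p x M η) = ∑ i ∈ Finset.range D, ∑ n ∈ Finset.range M,
      algebraMap 𝒪[K] E (f.coeff i * g (-n) ^ p ^ i) * frobZ p (-n + i) η := by
    rw [act_algebra_eq_sum hf]
    refine Finset.sum_congr rfl fun i _ => ?_
    rw [partialSum_apply, sum_pow_char_pow, Finset.mul_sum]
    refine Finset.sum_congr rfl fun n hn => ?_
    rw [hgn n (Finset.mem_range.mp hn), map_mul, map_pow, frobZ_add_nat, mul_pow, mul_assoc]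
  have hright : partialSum p x M (act p 𝒪[K] E (lift φ) η) =
      ∑ i ∈ Finset.range D, ∑ n ∈ Finset.range M,
        algebraMap 𝒪[K] E (g (-n) * teichFrob (p := p) (-n) (φ.coeff i)) *
          frobZ p (-n + i) η := by
    rw [Finset.sum_comm, partialSum_apply]
    refine Finset.sum_congr rfl fun n hn => ?_
    rw [act_algebra_eq_sum hlift, map_sum, Finset.mul_sum]
    refine Finset.sum_congr rfl fun i _ => ?_
    rw [hgn n (Finset.mem_range.mp hn), map_mul, map_mul, coeff_lift, frobZ_algebraMap_teich,
      frobZ_pow, mul_assoc]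
  have hsum : ∀ m ∈ Finset.Ico (-M : ℤ) D, algebraMap 𝒪[K] E (defect f φ g m) * frobZ p m η =
      ∑ i ∈ Finset.range D, algebraMap 𝒪[K] E (f.coeff i * g (m - i) ^ p ^ i -
        g (m - i) * teichFrob (p := p) (m - i) (φ.coeff i)) * frobZ p m η := fun m _ => by
    rw [defect_apply hf hφ, map_sum, Finset.sum_mul]
  rw [hleft, hright, ← Finset.sum_sub_distrib, Finset.sum_congr rfl hsum, Finset.sum_comm]
  refine Finset.sum_congr rfl fun i hi => ?_
  rw [← Finset.sum_sub_distrib]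
  have hi' := Finset.mem_range.mp hi
  refine Finset.sum_of_injOn (fun n : ℕ => -(n : ℤ) + i) ?_ ?_ ?_ ?_
  · intro n _ n' _ h
    have : -(n : ℤ) + i = -(n' : ℤ) + i := h
    omega
  · intro n hn
    have : n < M := by simpa using hn
    simp only [Finset.coe_Ico, Set.mem_Ico]
    omega
  · intro m _ hm
    have hg0 : g (m - i) = 0 := by
      rcases lt_or_ge 0 (m - i) with h | h
      · exact ofNeg_pos _ h
      · obtain ⟨n, hn⟩ : ∃ n : ℕ, m - i = -n := ⟨(i - m).toNat, by omega⟩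
        rw [hn, hg, ofNeg_neg, if_neg]
        intro hnM
        exact hm ⟨n, by simpa using hnM, by simp only; omega⟩
    rw [hg0, zero_pow (pow_pos (Fact.out : p.Prime).pos _).ne', mul_zero, zero_mul, sub_zero,
      map_zero, zero_mul]
  · intro n _
    rw [add_sub_cancel_right, ← sub_mul, ← map_sub]

variable {N : AbsoluteValue E ℝ}

lemma frobZ_neg_pow (n : ℕ) (η : E) : frobZ p (-n) η ^ p ^ n = η := by
  rw [← frobZ_add_nat, neg_add_cancel, frobZ_zero]

lemma abs_frobZ_le (N : AbsoluteValue E ℝ) (n : ℕ) (η : E) :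
    N (frobZ p (-n) η) ≤ max 1 (N η) := by
  by_contra! h
  have h1 := (le_max_left _ _).trans_lt h
  have h2 := le_self_pow₀ h1.le (pow_pos (Fact.out : p.Prime).pos n).ne'
  rw [← map_pow, frobZ_neg_pow] at h2
  exact absurd ((le_max_right _ _).trans_lt h) h2.not_gt

/-- The terms of `x(η)` with coefficients in `𝔪_K` eventually lie in the maximal ideal, because
`|η|^{p^{-n}}` tends to `1`, whereas the coefficients are bounded away from `1`. -/
lemma IsIntegralAbs.exists_mul_frobZ_lt (hN : IsIntegralAbs K N) (η : E) :
    ∃ n₀ : ℕ, ∀ n ≥ n₀, ∀ c ∈ 𝓂[K], N (algebraMap 𝒪[K] E c * frobZ p (-n) η) < 1 := by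
  obtain ⟨ρ, hρ0, hρ1, hρ⟩ := hN.exists_bound
  have hp := (Fact.out : p.Prime).one_lt
  have hlim : Tendsto (fun n : ℕ => ρ ^ p ^ n * N η) atTop (nhds (0 * N η)) :=
    ((tendsto_pow_atTop_nhds_zero_of_lt_one hρ0.le hρ1).comp
      (tendsto_pow_atTop_atTop_of_one_lt hp)).mul_const _
  rw [zero_mul] at hlim
  obtain ⟨n₀, hn₀⟩ := eventually_atTop.mp (hlim.eventually_lt_const one_pos)
  refine ⟨n₀, fun n hn c hc => ?_⟩
  by_contra! h
  have h1 := one_le_pow₀ h (n := p ^ n)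
  rw [← map_pow, mul_pow, frobZ_neg_pow, map_mul, map_pow] at h1
  refine absurd (h1.trans (mul_le_mul_of_nonneg_right ?_ (N.nonneg η))) (hn₀ n hn).not_ge
  exact pow_le_pow_left₀ (N.nonneg _) (hρ c hc) _

lemma IsIntegralAbs.exists_partialSum_sub_lt (hN : IsIntegralAbs K N) {x : ℕ → 𝒪[K]}
    (hpos : ∀ n, 0 < n → x n ∈ 𝓂[K]) (η : E) :
    ∃ M₀ : ℕ, ∀ M ≥ M₀, N (partialSum p x M η - partialSum p x M₀ η) < 1 := by
  obtain ⟨n₀, h⟩ := hN.exists_mul_frobZ_lt (p := p) η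
  refine ⟨n₀ + 1, fun M hM => ?_⟩
  rw [partialSum_apply, partialSum_apply, ← Finset.sum_Ico_eq_sub _ hM]
  refine hN.sum_lt _ _ one_pos fun n hn => ?_
  have := (Finset.mem_Ico.mp hn).1
  exact h n (by omega) _ (hpos n (by omega))

/-- The partial sums of `x` are approximately the identity. -/
lemma IsIntegralAbs.exists_partialSum_sub_self_lt (hN : IsIntegralAbs K N) {x : ℕ → 𝒪[K]}
    (h0 : x 0 - 1 ∈ 𝓂[K]) (hpos : ∀ n, 0 < n → x n ∈ 𝓂[K]) :
    ∃ ρ : ℝ, 0 < ρ ∧ ρ < 1 ∧ ∀ M > 0, ∀ η : E, N (partialSum p x M η - η) < ρ * max 1 (N η) := by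
  obtain ⟨ρ, hρ0, hρ1, hρ⟩ := hN.exists_bound
  -- a constant larger than `ρ` gives strict inequalities
  refine ⟨(1 + ρ) / 2, by linarith, by linarith, fun M hM η => ?_⟩
  have hmax : 0 < max 1 (N η) := lt_max_of_lt_left one_pos
  have hterm : ∀ c ∈ 𝓂[K], ∀ n : ℕ, N (algebraMap 𝒪[K] E c * frobZ p (-n) η) <
      (1 + ρ) / 2 * max 1 (N η) := fun c hc n => by
    rw [map_mul]
    refine (mul_le_mul (hρ c hc) (abs_frobZ_le N n η) (N.nonneg _) hρ0.le).trans_lt ?_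
    exact mul_lt_mul_of_pos_right (by linarith) hmax
  obtain ⟨M, rfl⟩ := Nat.exists_eq_add_of_lt hM
  rw [partialSum_apply, zero_add, Finset.sum_range_succ', add_sub_assoc]
  refine hN.add_lt (hN.sum_lt _ _ (by positivity) fun n _ => hterm _ (hpos _ n.succ_pos) _) ?_
  convert hterm _ h0 0 using 2
  rw [map_sub, sub_mul, map_one, one_mul]
  rfl

/-- If `f x = x f̄`, then `f` and `f̄` are intertwined by the partial sums up to elements of the
maximal ideal. -/
lemma IsIntegralAbs.exists_act_partialSum_sub_lt (hN : IsIntegralAbs K N) {x : ℕ → 𝒪[K]}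
    (h0 : x 0 - 1 ∈ 𝓂[K]) (hpos : ∀ n, 0 < n → x n ∈ 𝓂[K]) {f : Twisted p 𝒪[K]}
    (hx : defect f (reduce f) (ofNeg x) = 0) (η : E) : ∃ M₀ : ℕ, ∀ M ≥ M₀,
      N (act p 𝒪[K] E f (partialSum p x M η) -
        partialSum p x M (act p 𝒪[K] E (lift (reduce f)) η)) < 1 := by
  obtain ⟨D, hf⟩ := f.exists_bound
  have hφ : ∀ i ≥ D, (reduce f).coeff i = 0 := fun i hi => by
    rw [coeff_reduce, hf i hi, map_zero]
  obtain ⟨n₀, h⟩ := hN.exists_mul_frobZ_lt (p := p) η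
  refine ⟨n₀ + D + 1, fun M hM => ?_⟩
  rw [act_partialSum_sub hf hφ]
  refine hN.sum_lt _ _ one_pos fun m _ => ?_
  set y : ℕ → 𝒪[K] := fun n => if n < M then x n else 0 with hy
  by_cases hm : m ≤ -n₀
  · obtain ⟨n, rfl⟩ : ∃ n : ℕ, m = -n := ⟨(-m).toNat, by omega⟩
    refine h n (by omega) _ (defect_mem f (ofNeg_sub_single_mem ?_ fun n hn => ?_) _)
    · simpa only [hy, if_pos (show 0 < M by omega)] using h0
    · rw [hy]
      dsimp only
      split_ifs
      · exact hpos n hn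
      · exact zero_mem _
  · have : defect f (reduce f) (ofNeg y) m = defect f (reduce f) (ofNeg x) m := by
      rw [defect_apply hf hφ, defect_apply hf hφ]
      refine Finset.sum_congr rfl fun i hi => ?_
      have hi' := Finset.mem_range.mp hi
      have : ofNeg y (m - i) = ofNeg x (m - i) := by
        rw [ofNeg, ofNeg]
        split_ifs
        · exact if_pos (by omega)
        · rfl
      rw [this]
    rw [this, hx]
    change N (algebraMap 𝒪[K] E 0 * _) < 1
    rw [map_zero, zero_mul, map_zero]
    exact one_pos

end PartialSum

variable {A : Type*} [CommRing A] {L : Type*} [Field L] [Algebra K L] [CharP L p]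
  [Algebra.IsAlgebraic K L] [IsAlgClosed L] {ψ : A →+* Twisted p 𝒪[K]} {x : ℕ → 𝒪[K]}

lemma principal_partialSum (M : ℕ) (ξ : perfectClosure K L) :
    ∑ n ∈ Finset.range M,
      principal ψ (x n • ((frobeniusEquiv (perfectClosure K L) p).symm^[n] ξ)) =
    principal ψ (partialSum p x M ξ) := by
  let e : perfectClosure K L →+ KummerDomain L ψ :=
    { toFun := principal ψ, map_zero' := rfl, map_add' := principal_add ψ }
  rw [partialSum_apply]
  refine Eq.trans ?_ (map_sum e _ _).symm
  refine Finset.sum_congr rfl fun n _ => ?_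
  rw [← frobZ_neg_nat, Algebra.smul_def]
  rfl

/-- The isomorphism `χ` exists and is unique. It is injective and surjective because `χ([ξ]) - [ξ]`
is smaller than `[ξ]` by a constant factor. -/
lemma existsUnique_chi
    (hx : IsIntertwiner (perfectClosure K L) ψ (overO (reduction ψ)) x) :
    ∃! χ, IsChi L ψ (overO (reduction ψ)) x χ := by
  obtain ⟨N₀, hN₀⟩ := exists_isIntegralAbs K L
  let N := N₀.comp (perfectClosure K L).val.toRingHom.injective
  have hN : IsIntegralAbs K N := hN₀.comp (perfectClosure K L).val
  set φ := overO (reduction ψ) with hφ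
  have hzero : ∀ {θ : A →+* Twisted p 𝒪[K]} {ξ : perfectClosure K L},
      principal θ ξ = 0 ↔ N ξ ≤ 1 := fun {θ} {ξ} => principal_eq_zero θ hN₀
  have heq : ∀ {θ : A →+* Twisted p 𝒪[K]} {ξ ξ' : perfectClosure K L},
      principal θ ξ = principal θ ξ' ↔ N (ξ - ξ') ≤ 1 := fun {θ} {ξ ξ'} => principal_eq θ hN₀
  choose M₀ hM₀ using hN.exists_partialSum_sub_lt (p := p) hx.pos
  obtain ⟨ρ, hρ0, hρ1, hρ⟩ := hN.exists_partialSum_sub_self_lt (p := p) hx.zero hx.pos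
  -- the value of `χ` on representatives
  let u : perfectClosure K L → KummerDomain L ψ := fun ξ => principal ψ (partialSum p x (M₀ ξ) ξ)
  have hu : ∀ ξ, ∀ M ≥ M₀ ξ, u ξ = principal ψ (partialSum p x M ξ) := fun ξ M hM => by
    refine heq.mpr ?_
    rw [N.map_sub]
    exact (hM₀ ξ M hM).le
  have hadd : ∀ ξ ξ', u (ξ + ξ') = u ξ + u ξ' := fun ξ ξ' => by
    let M := max (M₀ (ξ + ξ')) (max (M₀ ξ) (M₀ ξ'))
    rw [hu _ M (by simp [M]), hu ξ M (by simp [M]), hu ξ' M (by simp [M]), map_add, principal_add]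
  have hker : ∀ ξ, u ξ = 0 ↔ N ξ ≤ 1 := fun ξ => by
    have h1 := hρ (M₀ ξ + 1) (Nat.succ_pos _) ξ
    rw [hu ξ (M₀ ξ + 1) (Nat.le_succ _), hzero]
    set S := partialSum p x (M₀ ξ + 1) ξ
    constructor
    · intro h
      by_contra! hξ
      rw [max_eq_right hξ.le] at h1
      have h2 : N (S - ξ) < N ξ := h1.trans_le (mul_le_of_le_one_left (N.nonneg _) hρ1.le)
      have h3 := hN.sub_lt (h.trans_lt hξ) h2
      rw [sub_sub_cancel] at h3
      exact h3.false
    · intro h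
      rw [max_eq_left h, mul_one] at h1
      rw [← sub_add_cancel S ξ]
      exact (hN.add_le_max _ _).trans (max_le (h1.trans hρ1).le h)
  let e : perfectClosure K L →+ KummerDomain L ψ := AddMonoidHom.mk' u hadd
  have hcongr : ∀ {ξ ξ'}, principal φ ξ = principal φ ξ' → u ξ = u ξ' := fun {ξ ξ'} h => by
    rw [← sub_eq_zero]
    refine (map_sub e ξ ξ').symm.trans ?_
    exact (hker _).mpr (heq.mp h)
  choose rep hrep using principal_surjective (L := L) φ
  have hval : ∀ ξ, u (rep (principal φ ξ)) = u ξ := fun ξ => hcongr (hrep _).symm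
  let χ₀ : KummerDomain L φ →ₗ[A] KummerDomain L ψ :=
    { toFun := fun v => u (rep v)
      map_add' := fun v w => by
        obtain ⟨ξ, rfl⟩ := principal_surjective φ v
        obtain ⟨ξ', rfl⟩ := principal_surjective φ w
        rw [← principal_add, hval, hval, hval, hadd]
      map_smul' := fun a v => by
        obtain ⟨ξ, rfl⟩ := principal_surjective φ v
        obtain ⟨M₁, hM₁⟩ := hN.exists_act_partialSum_sub_lt (p := p) hx.zero hx.pos
          (hx.defect_eq_zero a) ξ
        let η := act p 𝒪[K] (perfectClosure K L) (φ a) ξ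
        let M := max M₁ (max (M₀ ξ) (M₀ η))
        rw [smul_principal, hval, hval, RingHom.id_apply, hu ξ M (by simp [M]),
          hu η M (by simp [M]), smul_principal, eq_comm, heq]
        exact (hM₁ M (by simp [M])).le }
  have hinj : Function.Injective χ₀ := by
    refine (injective_iff_map_eq_zero χ₀).mpr fun v hv => ?_
    obtain ⟨ξ, rfl⟩ := principal_surjective φ v
    exact hzero.mpr ((hker ξ).mp ((hval ξ).symm.trans hv))
  have hsurj : ∀ k : ℕ, ∀ ζ : perfectClosure K L, ρ ^ k * N ζ ≤ 1 →
      ∃ ξ, u ξ = principal ψ ζ := by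
    intro k
    induction k with
    | zero =>
      intro ζ hζ
      rw [pow_zero, one_mul] at hζ
      exact ⟨0, (map_zero e).trans (hzero.mpr hζ).symm⟩
    | succ k ih =>
      intro ζ hζ
      have h1 := hρ (M₀ ζ + 1) (Nat.succ_pos _) ζ
      obtain ⟨ξ, hξ⟩ := ih (ζ - partialSum p x (M₀ ζ + 1) ζ) (by
        rw [N.map_sub]
        refine (mul_le_mul_of_nonneg_left h1.le (pow_nonneg hρ0.le k)).trans ?_
        rw [← mul_assoc, ← pow_succ, mul_max_of_nonneg _ _ (pow_nonneg hρ0.le _), mul_one]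
        exact max_le (pow_le_one₀ hρ0.le hρ1.le) hζ)
      refine ⟨ζ + ξ, ?_⟩
      rw [hadd, hξ, hu ζ _ (Nat.le_succ _), ← principal_add, add_sub_cancel]
  have hbij : Function.Bijective χ₀ := ⟨hinj, fun v => by
    obtain ⟨ζ, rfl⟩ := principal_surjective ψ v
    have hlim := (tendsto_pow_atTop_nhds_zero_of_lt_one hρ0.le hρ1).mul_const (N ζ)
    rw [zero_mul] at hlim
    obtain ⟨k, hk⟩ := (hlim.eventually_le_const one_pos).exists
    obtain ⟨ξ, hξ⟩ := hsurj k ζ hk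
    exact ⟨principal φ ξ, (hval ξ).trans hξ⟩⟩
  refine ⟨LinearEquiv.ofBijective χ₀ hbij, fun ξ => ?_, fun χ hχ => ?_⟩
  · filter_upwards [eventually_ge_atTop (M₀ ξ)] with M hM
    rw [principal_partialSum, ← hu ξ M hM]
    exact hval ξ
  · refine LinearEquiv.ext fun v => ?_
    obtain ⟨ξ, rfl⟩ := principal_surjective φ v
    obtain ⟨M, h1, h2⟩ := ((hχ ξ).and (eventually_ge_atTop (M₀ ξ))).exists
    rw [h1, principal_partialSum, ← hu ξ M h2]
    exact (hval ξ).symm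

variable [IsDomain A]

/-- Compatibility of the local Kummer pairings of `ψ` and its reduction: if `φ_a(η) = ξ`, then
`x(η)` is a root of `ψ_a(X) = χ(ξ)` up to integral elements, and `γ(x(η)) - x(η) = x(γ(η) - η)` is
congruent to `γ(η) - η`, because the latter is integral. -/
lemma IsReductionIso.apply_kummer (hψ : IsGoodDrinfeld ψ)
    {κψ : KummerDomain L ψ →ₗ[A] Additive (InertiaQuot K L p) →+ Tate L ψ}
    {κφ : KummerDomain L (overO (reduction ψ)) →ₗ[A]
      Additive (InertiaQuot K L p) →+ Tate L (overO (reduction ψ))}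
    {res : Tate L ψ ≃ₗ[A] Tate L (overO (reduction ψ))}
    {χ : KummerDomain L (overO (reduction ψ)) ≃ₗ[A] KummerDomain L ψ}
    (hκψ : IsKummerPairing L ψ κψ) (hκφ : IsKummerPairing L (overO (reduction ψ)) κφ)
    (hres : IsReductionIso L ψ (overO (reduction ψ)) res)
    (hx : IsIntertwiner (perfectClosure K L) ψ (overO (reduction ψ)) x)
    (hχ : IsChi L ψ (overO (reduction ψ)) x χ) (ξ : perfectClosure K L) (γ : inertia K L) :
    res (κψ (χ (principal (overO (reduction ψ)) ξ)) (Additive.ofMul (γ : InertiaQuot K L p))) =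
      κφ (principal (overO (reduction ψ)) ξ) (Additive.ofMul (γ : InertiaQuot K L p)) := by
  obtain ⟨N, hN⟩ := exists_isIntegralAbs K L
  refine fracHom_ext fun a ha => ?_
  obtain ⟨η, hη⟩ := hψ.isGoodDrinfeld_reduction.exists_root ha (ξ : L)
  obtain ⟨M₀, hM₀⟩ := hN.exists_act_partialSum_sub_lt (p := p) hx.zero hx.pos
    (hx.defect_eq_zero a) η
  obtain ⟨ρ, -, hρ1, hρ⟩ := hN.exists_partialSum_sub_self_lt (p := p) hx.zero hx.pos
  obtain ⟨M, hM, hMM⟩ := ((hχ ξ).and (eventually_ge_atTop (M₀ + 1))).exists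
  rw [principal_partialSum] at hM
  obtain ⟨r, hr⟩ := hψ.exists_root ha ((partialSum p x M ξ : perfectClosure K L) : L)
  have hS : ((partialSum p x M ξ : perfectClosure K L) : L) = partialSum p x M (ξ : L) :=
    map_partialSum (perfectClosure K L).val x M ξ
  have hle : N (act p 𝒪[K] L (ψ a) r - act p 𝒪[K] L (ψ a) (partialSum p x M η)) ≤ 1 := by
    rw [hr, hS, ← hη, N.map_sub]
    exact (hM₀ M (by omega)).le
  have hγ : (γ : Gal(L/K)) (partialSum p x M η) - partialSum p x M η =
      partialSum p x M ((γ : Gal(L/K)) η - η) := by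
    rw [map_sub]
    exact congrArg (· - _) (map_partialSum ((γ : Gal(L/K)) : L →ₐ[K] L) x M η)
  apply (DMod.of (overO (reduction ψ))).symm.injective
  rw [hres.formula, hM, hκψ.apply_frac _ γ 1 ha hr, hκφ.apply_frac ξ γ 1 ha hη, one_smul, one_smul,
    hψ.modMax_inertia_congr hN γ ha hle, hγ]
  have h1 := hψ.isGoodDrinfeld_reduction.inertia_sub_le hN (γ : Gal(L/K)) ha hη
  have h2 := hρ M (by omega) ((γ : Gal(L/K)) η - η)
  rw [max_eq_left h1, mul_one] at h2
  exact congrArg (DMod.of ψ).symm ((modMax_eq ψ hN).mpr (h2.trans hρ1))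

end Chi

end LocalKummer

end

open LocalKummer in
theorem proposition11p2
    (p : ℕ) [Fact p.Prime]
    (K : Type*) [Field K] [ValuativeRel K] [TopologicalSpace K] [IsNonarchimedeanLocalField K]
    [CharP K p]
    (L : Type*) [Field L] [Algebra K L] [Algebra.IsAlgebraic K L] [IsAlgClosed L] [CharP L p]
    (A : Type*) [CommRing A] [IsDomain A] [Algebra (ZMod p) A] (hA : IsCoefficientRing p A)
    (ψ : A →+* Twisted p 𝒪[K]) (hψ : IsGoodDrinfeld ψ)
    (d : ℕ) (hd : Nat.card 𝓀[K] = p ^ d) :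
    IsGoodDrinfeld (overO (reduction ψ)) ∧ IsGoodDrinfeld (overO (basic p K d)) ∧
    (∃! κ, IsKummerPairing L ψ κ) ∧
    (∃! κ, IsKummerPairing L (overO (reduction ψ)) κ) ∧
    (∃! κ, IsKummerPairing L (overO (basic p K d)) κ) ∧
    (∃! res, IsReductionIso L ψ (overO (reduction ψ)) res) ∧
    (∃! β, IsBasicIso L (reduction ψ) (basic p K d) β) ∧
    (∃! x, IsIntertwiner (perfectClosure K L) ψ (overO (reduction ψ)) x) ∧
    (∀ x, IsIntertwiner (perfectClosure K L) ψ (overO (reduction ψ)) x →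
      ∃! χ, IsChi L ψ (overO (reduction ψ)) x χ) ∧
    ∀ κψ κφ κω res β x χ,
      IsKummerPairing L ψ κψ → IsKummerPairing L (overO (reduction ψ)) κφ →
      IsKummerPairing L (overO (basic p K d)) κω →
      IsReductionIso L ψ (overO (reduction ψ)) res →
      IsBasicIso L (reduction ψ) (basic p K d) β →
      IsIntertwiner (perfectClosure K L) ψ (overO (reduction ψ)) x →
      IsChi L ψ (overO (reduction ψ)) x χ →
      ∀ (ξ : perfectClosure K L) (γ : Additive (InertiaQuot K L p)),
        res (κψ (χ (principal (overO (reduction ψ)) ξ)) γ) = κφ (principal (overO (reduction ψ)) ξ) γ ∧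
        β (κφ (principal (overO (reduction ψ)) ξ) γ) = κω (principal (overO (basic p K d)) ξ) γ ∧
        β (res (κψ (χ (principal (overO (reduction ψ)) ξ)) γ)) = κω (principal (overO (basic p K d)) ξ) γ := by
  have hred : IsGoodDrinfeld (overO (reduction ψ)) := hψ.isGoodDrinfeld_reduction
  have hbasic : IsGoodDrinfeld (overO (basic p K d)) := isGoodDrinfeld_basic hd
  have _ : Infinite A := hψ.infinite
  refine ⟨hred, hbasic, existsUnique_kummerPairing hψ, existsUnique_kummerPairing hred,
    existsUnique_kummerPairing hbasic, existsUnique_reductionIso hψ,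
    existsUnique_basicIso hψ.reduction_ne_zero (basic_ne_zero hd) (basic_commute hd),
    existsUnique_intertwiner hψ, fun x hx => existsUnique_chi hx, ?_⟩
  intro κψ κφ κω res β x χ hκψ hκφ hκω hres hβ hx hχ ξ γ'
  obtain ⟨γ, hγ⟩ := QuotientGroup.mk_surjective (s := inertiaRel K L p) γ'.toMul
  obtain rfl : Additive.ofMul (γ : InertiaQuot K L p) = γ' := congrArg Additive.ofMul hγ
  have h1 := hres.apply_kummer hψ hκψ hκφ hx hχ ξ γ
  have h2 := hβ.apply_kummer hred (basic_ne_zero hd) (basic_commute hd) hκφ hκω ξ γ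
  exact ⟨h1, h2, (congrArg β h1).trans h2⟩
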